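/- Let $a\neq 0$ be a real constant and let $\mathcal M$ be a real function that is $C^3$ on a neighbourhood of $r=0$ (negative values of $r$ are allowed). Consider, in coordinates $(t,r,\theta,\phi)$, the Kerr-like metric $$ds^2=-\frac{\Delta_r}{\Sigma}(dt-a\sin^2\theta\,d\phi)^2+\frac{\Sigma}{\Delta_r}dr^2+\Sigma\,d\theta^2+\frac{\sin^2\theta}{\Sigma}\bigl(a\,dt-(r^2+a^2)d\phi\bigr)^2,$$ where $\Sigma=r^2+a^2\cos^2\theta$ and $\Delta_r=r^2-2\mathcal M(r)\,r+a^2$. A second-order curvature invariant is a scalar polynomial in the Riemann tensor, i.e. a real linear combination of complete contractions of products of Riemann tensors, metrics and volume forms $\epsilon$. A path approaching the ring is a continuous path in the region $0<\theta<\pi$, $\Sigma\neq0$, $\Delta_r\neq0$ along which $(r,\theta)\to(0,\pi/2)$. A scalar is finite at the ring if along every path approaching the ring it is bounded near the end of the path; it diverges along a path if its absolute value tends to infinity there. Let $\mathcal R$ be the curvature scalar and $$I_6=\tfrac1{12}S_\alpha{}^\beta S_\beta{}^\alpha,\qquad I=\tfrac1{24}\bar C_{\alpha\beta\gamma\delta}\bar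 C^{\alpha\beta\gamma\delta},\qquad K=\tfrac14\bar C_{\alpha\gamma\delta\beta}S^{\gamma\delta}S^{\alpha\beta},$$ where $S_{\alpha\beta}=R_{\alpha\beta}-\tfrac14\mathcal R g_{\alpha\beta}$, $C$ is the Weyl tensor, $*C_{\alpha\beta\gamma\delta}=\tfrac12\epsilon_{\alpha\beta\mu\nu}C^{\mu\nu}{}_{\gamma\delta}$ and $\bar C=\tfrac12(C+i\,{*C})$. Then the following are equivalent: 1. all second-order curvature invariants are finite at the ring $(r=0,\theta=\pi/2)$; 2. no second-order curvature invariant diverges along any path approaching the ring; 3. $\mathcal R$, $I_6$, $I$ and $K$ are finite at the ring; 4. $\mathcal M(0)=\mathcal M'(0)=\mathcal M''(0)=0$. -/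

import Mathlib

open Filter Topology

noncomputable section

namespace KerrLike

/-! ### Pseudo-Riemannian geometry of a metric given in a coordinate chart of `ℝ⁴` -/

/-- Coordinates of a point; for the Kerr-like metric `x = (t, r, θ, φ)`. -/
abbrev Coord : Type := Fin 4 → ℝ

/-- A field of covariant 2-tensors, by components. -/
abbrev MetricField : Type := Coord → Matrix (Fin 4) (Fin 4) ℝ

/-- The partial derivative `∂f/∂x^μ` at `x`. -/
def pderiv (μ : Fin 4) (f : Coord → ℝ) (x : Coord) : ℝ :=
  deriv (fun s : ℝ => f (Function.update x μ s)) (x μ)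

/-- The Christoffel symbols `Γ^c_{ab}` of the metric `g`. -/
def christoffel (g : MetricField) (c a b : Fin 4) (x : Coord) : ℝ :=
  (1 / 2) * ∑ d, (g x)⁻¹ c d *
    (pderiv a (fun y => g y d b) x + pderiv b (fun y => g y d a) x
      - pderiv d (fun y => g y a b) x)

/-- The Riemann tensor `R^a_{bcd}`. -/
def riemannUp (g : MetricField) (x : Coord) (a b c d : Fin 4) : ℝ :=
  pderiv c (christoffel g a d b) x - pderiv d (christoffel g a c b) x
    + ∑ e, (christoffel g a c e x * christoffel g e d b x
      - christoffel g a d e x * christoffel g e c b x)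

/-- The covariant Riemann tensor `R_{abcd}`. -/
def riemann (g : MetricField) (x : Coord) (a b c d : Fin 4) : ℝ :=
  ∑ e, g x a e * riemannUp g x e b c d

/-- The Ricci tensor `R_{bd} = R^a_{bad}`. -/
def ricci (g : MetricField) (x : Coord) (b d : Fin 4) : ℝ :=
  ∑ a, riemannUp g x a b a d

/-- The curvature scalar `ℛ`. -/
def scalarCurv (g : MetricField) (x : Coord) : ℝ :=
  ∑ a, ∑ b, (g x)⁻¹ a b * ricci g x a b

/-- The Weyl tensor `C_{abcd}` in dimension four. -/
def weyl (g : MetricField) (x : Coord) (a b c d : Fin 4) : ℝ :=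
  riemann g x a b c d
    - (1 / 2) * (g x a c * ricci g x b d - g x a d * ricci g x b c
      - g x b c * ricci g x a d + g x b d * ricci g x a c)
    + scalarCurv g x / 6 * (g x a c * g x b d - g x a d * g x b c)

/-- The alternating symbol `[abcd]`, with `[0123] = 1`. -/
def altSymbol (a b c d : Fin 4) : ℝ :=
  Matrix.det (Matrix.of fun i j : Fin 4 => if ![a, b, c, d] i = j then (1 : ℝ) else 0)

/-- The volume form `ε_{abcd}`. -/
def volForm (g : MetricField) (x : Coord) (a b c d : Fin 4) : ℝ :=
  √|(g x).det| * altSymbol a b c d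

/-- The dual Weyl tensor `*C_{abcd} = ε_{abmn} C^{mn}_{cd} / 2`. -/
def weylDual (g : MetricField) (x : Coord) (a b c d : Fin 4) : ℝ :=
  (1 / 2) * ∑ m, ∑ n, ∑ m', ∑ n',
    volForm g x a b m n * (g x)⁻¹ m m' * (g x)⁻¹ n n' * weyl g x m' n' c d

/-- The tensor `(C + i *C) / 2`. -/
def weylBar (g : MetricField) (x : Coord) (a b c d : Fin 4) : ℂ :=
  ((weyl g x a b c d : ℂ) + Complex.I * (weylDual g x a b c d : ℂ)) / 2

/-- The trace-free Ricci tensor `S_{ab}`. -/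
def tfRicci (g : MetricField) (x : Coord) (a b : Fin 4) : ℝ :=
  ricci g x a b - scalarCurv g x / 4 * g x a b

/-- The tensor `S^{ab}`. -/
def tfRicciUp (g : MetricField) (x : Coord) (a b : Fin 4) : ℝ :=
  ∑ c, ∑ d, (g x)⁻¹ a c * (g x)⁻¹ b d * tfRicci g x c d

/-- `I₆ = S_a^b S_b^a / 12`. -/
def invI6 (g : MetricField) (x : Coord) : ℝ :=
  (1 / 12) * ∑ a, ∑ b, tfRicci g x a b * tfRicciUp g x a b

/-- `I = C̄_{abcd} C̄^{abcd} / 24`, where `C̄ = (C + i *C) / 2`. -/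
def invI (g : MetricField) (x : Coord) : ℂ :=
  (1 / 24) * ∑ a, ∑ b, ∑ c, ∑ d, weylBar g x a b c d *
    ∑ a', ∑ b', ∑ c', ∑ d',
      (((g x)⁻¹ a a' * (g x)⁻¹ b b' * (g x)⁻¹ c c' * (g x)⁻¹ d d' : ℝ) : ℂ)
        * weylBar g x a' b' c' d'

/-- `K = C̄_{acdb} S^{cd} S^{ab} / 4`, where `C̄ = (C + i *C) / 2`. -/
def invK (g : MetricField) (x : Coord) : ℂ :=
  (1 / 4) * ∑ a, ∑ b, ∑ c, ∑ d,
    weylBar g x a c d b * ((tfRicciUp g x c d * tfRicciUp g x a b : ℝ) : ℂ)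

/-! ### Scalar invariants polynomial in the Riemann tensor -/

/-- A scheme for contracting completely a product of `n` covariant tensors of rank four, each of
which is either the Riemann tensor or the volume form: `isRiemann` says which factors are Riemann
tensors, and `pairing` groups the `4n` index slots into `2n` pairs. -/
structure ContractionScheme where
  n : ℕ
  isRiemann : Fin n → Bool
  pairing : Fin (2 * n) × Fin 2 ≃ Fin n × Fin 4

/-- The complete contraction that a scheme describes: each pair of slots is contracted with the
inverse metric. -/
def ContractionScheme.eval (s : ContractionScheme) (g : MetricField) (x : Coord) : ℝ :=
  ∑ i : Fin s.n × Fin 4 → Fin 4,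
    (∏ k, (if s.isRiemann k then riemann g x else volForm g x)
      (i (k, 0)) (i (k, 1)) (i (k, 2)) (i (k, 3)))
    * ∏ p, (g x)⁻¹ (i (s.pairing (p, 0))) (i (s.pairing (p, 1)))

/-- The second order curvature invariants of `g`: the scalars polynomial in the Riemann tensor,
that is the real linear combinations of complete contractions of products of Riemann tensors,
metrics and volume forms. -/
def curvatureInvariants (g : MetricField) : Submodule ℝ (Coord → ℝ) :=
  Submodule.span ℝ (Set.range fun s : ContractionScheme => s.eval g)

/-! ### The Kerr-like metric -/

/-- `Σ = r² + a² cos² θ`. -/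
def sigma (a r θ : ℝ) : ℝ := r ^ 2 + a ^ 2 * Real.cos θ ^ 2

/-- `Δ_r = r² - 2 M(r) r + a²`. -/
def delta (a : ℝ) (M : ℝ → ℝ) (r : ℝ) : ℝ := r ^ 2 - 2 * M r * r + a ^ 2

/-- The components of `dt - a sin² θ dφ`. -/
def formT (a θ : ℝ) : Fin 4 → ℝ := ![1, 0, 0, -(a * Real.sin θ ^ 2)]

/-- The components of `a dt - (r² + a²) dφ`. -/
def formPhi (a r : ℝ) : Fin 4 → ℝ := ![a, 0, 0, -(r ^ 2 + a ^ 2)]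

/-- The components of `dr`. -/
def formR : Fin 4 → ℝ := ![0, 1, 0, 0]

/-- The components of `dθ`. -/
def formTheta : Fin 4 → ℝ := ![0, 0, 1, 0]

/-- The Kerr-like metric in Boyer-Lindquist-like coordinates `x = (t, r, θ, φ)`. -/
def metric (a : ℝ) (M : ℝ → ℝ) : MetricField := fun x =>
  Matrix.of fun μ ν =>
    -(delta a M (x 1) / sigma a (x 1) (x 2)) * (formT a (x 2) μ * formT a (x 2) ν)
    + sigma a (x 1) (x 2) / delta a M (x 1) * (formR μ * formR ν)
    + sigma a (x 1) (x 2) * (formTheta μ * formTheta ν)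
    + Real.sin (x 2) ^ 2 / sigma a (x 1) (x 2) * (formPhi a (x 1) μ * formPhi a (x 1) ν)

/-- The points where the coordinates are regular: off the ring, the axis and the horizons. -/
def chartDomain (a : ℝ) (M : ℝ → ℝ) : Set Coord :=
  {x | 0 < x 2 ∧ x 2 < Real.pi ∧ sigma a (x 1) (x 2) ≠ 0 ∧ delta a M (x 1) ≠ 0}

/-- A path `γ : (0, 1] → spacetime` that approaches the ring `(r = 0, θ = π/2)` as its parameter
tends to `0`. -/
structure IsPathToRing (a : ℝ) (M : ℝ → ℝ) (γ : ℝ → Coord) : Prop where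
  continuousOn : ContinuousOn γ (Set.Ioc 0 1)
  mem_chart : ∀ s ∈ Set.Ioc (0 : ℝ) 1, γ s ∈ chartDomain a M
  tendsto_r : Tendsto (fun s => γ s 1) (𝓝[>] 0) (𝓝 0)
  tendsto_theta : Tendsto (fun s => γ s 2) (𝓝[>] 0) (𝓝 (Real.pi / 2))

/-- The scalar `f` stays finite (bounded) on approach to the ring along every path. -/
def FiniteAtRing {E : Type*} [Norm E] (a : ℝ) (M : ℝ → ℝ) (f : Coord → E) : Prop :=
  ∀ γ : ℝ → Coord, IsPathToRing a M γ → ∃ B : ℝ, ∀ᶠ s in 𝓝[>] (0 : ℝ), ‖f (γ s)‖ ≤ B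

/-- The scalar `f` diverges on approach to the ring along some path. -/
def DivergesAtRing {E : Type*} [Norm E] (a : ℝ) (M : ℝ → ℝ) (f : Coord → E) : Prop :=
  ∃ γ : ℝ → Coord, IsPathToRing a M γ ∧ Tendsto (fun s => ‖f (γ s)‖) (𝓝[>] 0) atTop

end KerrLike

end

noncomputable section

namespace KerrLike

/-! ### Partial derivatives -/

/-! Near the ring `Δ_r` is close to `a² > 0`, so the metric has a real orthonormal coframe there,
`kerrCoframe`. In this coframe the Riemann tensor has the shape `curvForm u v w z`: four scalars
built from `r`, `a cos θ`, `m = r M` and the first two derivatives of `m`, with powers of `Σ` as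
denominators. Complete contractions do not depend on the frame (`HasFrame.eval_eq`), so each
curvature invariant, and likewise `ℛ`, `I₆`, `I` and `K`, is a polynomial in `u, v, w, z` and the
orientation sign of the coframe.

If the 2-jet of `M` vanishes at `0`, then `M = O(r³)`, `M' = O(r²)` and `M'' = O(r)`. Since `r² ≤ Σ`
and `|r a cos θ| ≤ Σ`, the four scalars are bounded near the ring, uniformly over all paths
(`kerrCurv_bounded`), and continuity bounds every invariant (`finiteAtRing_of_continuous`).

Conversely, on the equatorial plane `z = 0` and `v = 2 M(r) / r³`, which is unbounded as `r → 0⁺`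
unless the 2-jet vanishes (`tendsto_abs_div_cube`). When `z = 0` the only nonzero components are
`R_{ABAB}` and `R_{ABBA}`, so in quadratic contractions the Lorentzian signs cancel in pairs and
every term is nonnegative. The Kretschmann scalar is therefore at least `v²`, while `I₆` and `|I|`
control `(u + v)²` and `(u - v - 2w)²`. Together with `ℛ = -2u - 8w + 2v` these combinations
determine `v`.

The curvature is found by Cartan's method. The explicit `kerrConn` is metric and torsion-free, hence
is the Levi-Civita connection, and `mul_riemannMat_eq_frameCurv` carries the coordinate definition
of the Riemann tensor over to the frame. -/

lemma hasDerivAt_update_coord (μ : Fin 4) (x : Coord) :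
    HasDerivAt (fun s : ℝ => Function.update x μ s) (Pi.single μ (1 : ℝ)) (x μ) := by
  simpa using hasDerivAt_update x μ (x μ)

lemma pderiv_eq_fderiv {f : Coord → ℝ} {x : Coord} (μ : Fin 4) (hf : DifferentiableAt ℝ f x) :
    pderiv μ f x = fderiv ℝ f x (Pi.single μ 1) := by
  have h : HasFDerivAt f (fderiv ℝ f x) (Function.update x μ (x μ)) := by
    simpa using hf.hasFDerivAt
  exact (h.comp_hasDerivAt (x μ) (hasDerivAt_update_coord μ x)).deriv

lemma pderiv_congr {f g : Coord → ℝ} {x : Coord} (μ : Fin 4) (h : f =ᶠ[𝓝 x] g) :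
    pderiv μ f x = pderiv μ g x := by
  have hc : Tendsto (fun s : ℝ => Function.update x μ s) (𝓝 (x μ)) (𝓝 x) := by
    have := (hasDerivAt_update_coord μ x).continuousAt.tendsto
    simpa using this
  exact Filter.EventuallyEq.deriv_eq (hc.eventually h)

lemma pderiv_add {f g : Coord → ℝ} {x : Coord} (μ : Fin 4) (hf : DifferentiableAt ℝ f x)
    (hg : DifferentiableAt ℝ g x) :
    pderiv μ (fun y => f y + g y) x = pderiv μ f x + pderiv μ g x := by
  rw [pderiv_eq_fderiv μ hf, pderiv_eq_fderiv μ hg, pderiv_eq_fderiv μ (hf.fun_add hg),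
    fderiv_fun_add hf hg]
  rfl

lemma pderiv_mul {f g : Coord → ℝ} {x : Coord} (μ : Fin 4) (hf : DifferentiableAt ℝ f x)
    (hg : DifferentiableAt ℝ g x) :
    pderiv μ (fun y => f y * g y) x = pderiv μ f x * g x + f x * pderiv μ g x := by
  rw [pderiv_eq_fderiv μ hf, pderiv_eq_fderiv μ hg, pderiv_eq_fderiv μ (hf.fun_mul hg),
    fderiv_fun_mul hf hg]
  simp only [add_apply, smul_apply, smul_eq_mul]
  ring

lemma pderiv_sum {ι : Type*} (s : Finset ι) {f : ι → Coord → ℝ} {x : Coord} (μ : Fin 4)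
    (hf : ∀ i, DifferentiableAt ℝ (f i) x) :
    pderiv μ (fun y => ∑ i ∈ s, f i y) x = ∑ i ∈ s, pderiv μ (f i) x := by
  rw [pderiv_eq_fderiv μ (DifferentiableAt.fun_sum fun i _ => hf i),
    fderiv_fun_sum fun i _ => hf i]
  simp [pderiv_eq_fderiv μ (hf _)]

lemma pderiv_eventuallyEq_fderiv {f : Coord → ℝ} {x : Coord} (μ : Fin 4)
    (hf : ContDiffAt ℝ 2 f x) :
    pderiv μ f =ᶠ[𝓝 x] fun y => fderiv ℝ f y (Pi.single μ 1) := by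
  filter_upwards [hf.eventually (by simp)] with y hy
  exact pderiv_eq_fderiv μ (hy.differentiableAt (by simp))

lemma differentiableAt_fderiv_of_contDiffAt {f : Coord → ℝ} {x : Coord}
    (hf : ContDiffAt ℝ 2 f x) : DifferentiableAt ℝ (fderiv ℝ f) x :=
  (hf.fderiv_right (m := 1) (by norm_num)).differentiableAt (by simp)

lemma differentiableAt_pderiv {f : Coord → ℝ} {x : Coord} (μ : Fin 4)
    (hf : ContDiffAt ℝ 2 f x) : DifferentiableAt ℝ (pderiv μ f) x :=
  ((differentiableAt_fderiv_of_contDiffAt hf).clm_apply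
    (differentiableAt_const _)).congr_of_eventuallyEq (pderiv_eventuallyEq_fderiv μ hf)

lemma pderiv_comm {f : Coord → ℝ} {x : Coord} (μ ν : Fin 4) (hf : ContDiffAt ℝ 2 f x) :
    pderiv μ (pderiv ν f) x = pderiv ν (pderiv μ f) x := by
  have key : ∀ μ ν : Fin 4, pderiv μ (pderiv ν f) x =
      fderiv ℝ (fderiv ℝ f) x (Pi.single μ 1) (Pi.single ν 1) := by
    intro μ ν
    have hd := differentiableAt_fderiv_of_contDiffAt hf
    rw [pderiv_congr μ (pderiv_eventuallyEq_fderiv ν hf),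
      pderiv_eq_fderiv μ (hd.clm_apply (differentiableAt_const _)),
      fderiv_clm_apply hd (differentiableAt_const _)]
    simp
  rw [key, key]
  exact (hf.isSymmSndFDerivAt (by simp)) _ _

/-! ### Matrix-valued functions -/

/-- A matrix-valued function is differentiable entry by entry. -/
def EntryDiff (X : Coord → Matrix (Fin 4) (Fin 4) ℝ) (x : Coord) : Prop :=
  ∀ i j, DifferentiableAt ℝ (fun y => X y i j) x

/-- The entrywise partial derivative of a matrix-valued function. -/
def pderivMat (μ : Fin 4) (X : Coord → Matrix (Fin 4) (Fin 4) ℝ) (x : Coord) :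
    Matrix (Fin 4) (Fin 4) ℝ :=
  Matrix.of fun i j => pderiv μ (fun y => X y i j) x

lemma pderivMat_congr {X Y : Coord → Matrix (Fin 4) (Fin 4) ℝ} {x : Coord} (μ : Fin 4)
    (h : X =ᶠ[𝓝 x] Y) : pderivMat μ X x = pderivMat μ Y x := by
  ext i j
  have h' : (fun y => X y i j) =ᶠ[𝓝 x] fun y => Y y i j := h.mono fun y hy => by simp only [hy]
  exact pderiv_congr μ h'

lemma EntryDiff.congr {X Y : Coord → Matrix (Fin 4) (Fin 4) ℝ} {x : Coord}
    (hX : EntryDiff X x) (h : Y =ᶠ[𝓝 x] X) : EntryDiff Y x := fun i j =>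
  (hX i j).congr_of_eventuallyEq (h.mono fun y hy => by simp only [hy])

lemma EntryDiff.add {X Y : Coord → Matrix (Fin 4) (Fin 4) ℝ} {x : Coord}
    (hX : EntryDiff X x) (hY : EntryDiff Y x) : EntryDiff (fun y => X y + Y y) x :=
  fun i j => (hX i j).add (hY i j)

lemma EntryDiff.mul {X Y : Coord → Matrix (Fin 4) (Fin 4) ℝ} {x : Coord}
    (hX : EntryDiff X x) (hY : EntryDiff Y x) : EntryDiff (fun y => X y * Y y) x := by
  intro i j
  simp only [Matrix.mul_apply]
  exact DifferentiableAt.fun_sum fun k _ => (hX i k).mul (hY k j)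

lemma EntryDiff.transpose {X : Coord → Matrix (Fin 4) (Fin 4) ℝ} {x : Coord}
    (hX : EntryDiff X x) : EntryDiff (fun y => (X y).transpose) x := fun i j => hX j i

lemma entryDiff_const (X : Matrix (Fin 4) (Fin 4) ℝ) (x : Coord) : EntryDiff (fun _ => X) x :=
  fun _ _ => differentiableAt_const _

lemma pderivMat_add {X Y : Coord → Matrix (Fin 4) (Fin 4) ℝ} {x : Coord} (μ : Fin 4)
    (hX : EntryDiff X x) (hY : EntryDiff Y x) :
    pderivMat μ (fun y => X y + Y y) x = pderivMat μ X x + pderivMat μ Y x := by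
  ext i j
  exact pderiv_add μ (hX i j) (hY i j)

lemma pderivMat_mul {X Y : Coord → Matrix (Fin 4) (Fin 4) ℝ} {x : Coord} (μ : Fin 4)
    (hX : EntryDiff X x) (hY : EntryDiff Y x) :
    pderivMat μ (fun y => X y * Y y) x = pderivMat μ X x * Y x + X x * pderivMat μ Y x := by
  ext i j
  simp only [pderivMat, Matrix.of_apply, Matrix.mul_apply, Matrix.add_apply]
  rw [pderiv_sum _ μ fun k => (hX i k).fun_mul (hY k j), ← Finset.sum_add_distrib]
  exact Finset.sum_congr rfl fun k _ => pderiv_mul μ (hX i k) (hY k j)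

lemma pderivMat_const (X : Matrix (Fin 4) (Fin 4) ℝ) (μ : Fin 4) (x : Coord) :
    pderivMat μ (fun _ => X) x = 0 := by
  ext i j
  simp [pderivMat, pderiv]

/-! ### Moving frames -/

/-- The Christoffel symbols as matrices `(Γ_μ)^c_b`. -/
def christoffelMat (g : MetricField) (μ : Fin 4) (x : Coord) : Matrix (Fin 4) (Fin 4) ℝ :=
  Matrix.of fun c b => christoffel g c μ b x

/-- The Riemann tensor as matrices `(R_{μν})^a_b`. -/
def riemannMat (g : MetricField) (x : Coord) (μ ν : Fin 4) : Matrix (Fin 4) (Fin 4) ℝ :=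
  Matrix.of fun a b => riemannUp g x a b μ ν

lemma riemannMat_eq (g : MetricField) (x : Coord) (μ ν : Fin 4) :
    riemannMat g x μ ν = pderivMat μ (christoffelMat g ν) x - pderivMat ν (christoffelMat g μ) x
      + (christoffelMat g μ x * christoffelMat g ν x
        - christoffelMat g ν x * christoffelMat g μ x) := by
  ext a b
  simp only [riemannMat, riemannUp, pderivMat, christoffelMat, Matrix.of_apply, Matrix.add_apply,
    Matrix.sub_apply, Matrix.mul_apply, Finset.sum_sub_distrib]

/-- The connection matrices `A_μ = e^C_μ γ_C` in the coordinate directions. -/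
def connMat (E : Coord → Matrix (Fin 4) (Fin 4) ℝ) (γ : Fin 4 → Coord → Matrix (Fin 4) (Fin 4) ℝ)
    (μ : Fin 4) (y : Coord) : Matrix (Fin 4) (Fin 4) ℝ :=
  ∑ C, E y C μ • γ C y

/-- The curvature `(R_{CD})^A_B` of a connection with frame components `γ_C`, whose frame
derivatives are `dγ C D = e_C (γ_D)`. -/
def frameCurv (γ : Fin 4 → Matrix (Fin 4) (Fin 4) ℝ)
    (dγ : Fin 4 → Fin 4 → Matrix (Fin 4) (Fin 4) ℝ) (C D : Fin 4) : Matrix (Fin 4) (Fin 4) ℝ :=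
  dγ C D - dγ D C + (γ C * γ D - γ D * γ C) - ∑ e, (γ C e D - γ D e C) • γ e

/-- A coframe `E` with dual frame `F` in which `g` has the constant components `η`, and the
torsion-free metric connection `γ` of `g` in it, on a set `U`. -/
structure IsMovingFrame (U : Set Coord) (g : MetricField) (η : Matrix (Fin 4) (Fin 4) ℝ)
    (E F : Coord → Matrix (Fin 4) (Fin 4) ℝ)
    (γ : Fin 4 → Coord → Matrix (Fin 4) (Fin 4) ℝ) : Prop where
  isOpen : IsOpen U
  eta_mul_eta : η * η = 1
  eta_symm : η.transpose = η
  metric_eq : ∀ y ∈ U, g y = (E y).transpose * η * E y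
  mul_dual : ∀ y ∈ U, E y * F y = 1
  contDiff : ∀ y ∈ U, ∀ i j, ContDiffAt ℝ 2 (fun z => E z i j) y
  diff_dual : ∀ y ∈ U, EntryDiff F y
  diff_conn : ∀ y ∈ U, ∀ C, EntryDiff (γ C) y
  skew : ∀ y ∈ U, ∀ C, (γ C y).transpose * η + η * γ C y = 0
  torsion : ∀ y ∈ U, ∀ μ ν A, (pderivMat μ E y + connMat E γ μ y * E y) A ν =
    (pderivMat ν E y + connMat E γ ν y * E y) A μ

namespace IsMovingFrame

variable {U : Set Coord} {g : MetricField} {η : Matrix (Fin 4) (Fin 4) ℝ}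
  {E F : Coord → Matrix (Fin 4) (Fin 4) ℝ} {γ : Fin 4 → Coord → Matrix (Fin 4) (Fin 4) ℝ}
  {x : Coord}

lemma dual_mul (h : IsMovingFrame U g η E F γ) (hx : x ∈ U) : F x * E x = 1 :=
  mul_eq_one_comm.mp (h.mul_dual x hx)

lemma entryDiff (h : IsMovingFrame U g η E F γ) (hx : x ∈ U) : EntryDiff E x :=
  fun i j => (h.contDiff x hx i j).differentiableAt (by simp)

lemma metric_eventuallyEq (h : IsMovingFrame U g η E F γ) (hx : x ∈ U) :
    g =ᶠ[𝓝 x] fun y => (E y).transpose * η * E y :=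
  Filter.mem_of_superset (h.isOpen.mem_nhds hx) h.metric_eq

/-- Metric compatibility. The connection terms added to the derivative of `E` contribute `Eᵀ (Aᵀ η +
η A) E`, which vanishes because `A` is skew for `η`. -/
lemma pderivMat_metric (h : IsMovingFrame U g η E F γ) (hx : x ∈ U) (μ : Fin 4) :
    pderivMat μ g x = (pderivMat μ E x + connMat E γ μ x * E x).transpose * η * E x
      + (E x).transpose * η * (pderivMat μ E x + connMat E γ μ x * E x) := by
  have hE := h.entryDiff hx
  have hskew : (connMat E γ μ x).transpose * η + η * connMat E γ μ x = 0 := by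
    simp only [connMat, Matrix.transpose_sum, Matrix.transpose_smul, Matrix.sum_mul,
      Matrix.mul_sum, ← Finset.sum_add_distrib, Matrix.smul_mul, Matrix.mul_smul, ← smul_add,
      h.skew x hx, smul_zero, Finset.sum_const_zero]
  have ht : pderivMat μ (fun y => (E y).transpose) x = (pderivMat μ E x).transpose := rfl
  rw [pderivMat_congr μ (h.metric_eventuallyEq hx),
    pderivMat_mul μ (hE.transpose.mul (entryDiff_const η x)) hE,
    pderivMat_mul μ hE.transpose (entryDiff_const η x), pderivMat_const, ht]
  have : (E x).transpose * ((connMat E γ μ x).transpose * η + η * connMat E γ μ x) * E x = 0 := by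
    rw [hskew]; simp
  refine (sub_eq_zero.mp (Eq.trans ?_ this)).symm
  simp only [Matrix.transpose_add, Matrix.transpose_mul]
  noncomm_ring

/-- Uniqueness of the Levi-Civita connection, in matrix form: the Christoffel symbols are the gauge
transform of `A` by the coframe. This is what allows a guessed connection to be certified by
skewness and vanishing torsion alone. -/
lemma mul_christoffelMat (h : IsMovingFrame U g η E F γ) (hx : x ∈ U) (μ : Fin 4) :
    E x * christoffelMat g μ x = pderivMat μ E x + connMat E γ μ x * E x := by
  set N : Fin 4 → Matrix (Fin 4) (Fin 4) ℝ :=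
    fun μ => pderivMat μ E x + connMat E γ μ x * E x with hN
  -- `Q` holds the Christoffel symbols of the first kind: zero torsion makes it symmetric in its
  -- outer indices, and compatibility says that `Q` plus its transpose is the derivative of `g`.
  set Q : Fin 4 → Matrix (Fin 4) (Fin 4) ℝ := fun μ => (E x).transpose * η * N μ with hQ
  have hQs : ∀ a b d, Q a d b = Q b d a := by
    intro a b d
    simp only [hQ, Matrix.mul_apply (N := N _)]
    exact Finset.sum_congr rfl fun A _ => congrArg _ (h.torsion x hx a b A)
  have hdg : ∀ a d b, pderiv a (fun y => g y d b) x = Q a b d + Q a d b := by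
    intro a d b
    have h1 := congrFun (congrFun (h.pderivMat_metric hx a) d) b
    have h2 : (N a).transpose * η * E x = (Q a).transpose := by
      simp only [hQ, Matrix.transpose_mul, Matrix.transpose_transpose, h.eta_symm, Matrix.mul_assoc]
    rw [h2] at h1
    exact h1
  have hinv : (g x)⁻¹ * (E x).transpose * η = F x := by
    have hFE := h.dual_mul hx
    have h3 : (F x * η * (F x).transpose) * g x = 1 := by
      have h4 : (F x).transpose * (E x).transpose = 1 := by
        rw [← Matrix.transpose_mul, h.mul_dual x hx, Matrix.transpose_one]
      rw [h.metric_eq x hx]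
      calc F x * η * (F x).transpose * ((E x).transpose * η * E x)
          = F x * η * ((F x).transpose * (E x).transpose) * η * E x := by noncomm_ring
        _ = F x * (η * η) * E x := by rw [h4]; noncomm_ring
        _ = 1 := by rw [h.eta_mul_eta, mul_one, hFE]
    have h4 : (F x).transpose * (E x).transpose = 1 := by
      rw [← Matrix.transpose_mul, h.mul_dual x hx, Matrix.transpose_one]
    rw [Matrix.inv_eq_left_inv h3]
    calc F x * η * (F x).transpose * (E x).transpose * η
        = F x * η * ((F x).transpose * (E x).transpose) * η := by noncomm_ring
      _ = F x * (η * η) := by rw [h4]; noncomm_ring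
      _ = F x := by rw [h.eta_mul_eta, mul_one]
  have hΓ : christoffelMat g μ x = (g x)⁻¹ * Q μ := by
    ext c b
    simp only [christoffelMat, christoffel, Matrix.of_apply, Matrix.mul_apply (M := (g x)⁻¹),
      Finset.mul_sum]
    refine Finset.sum_congr rfl fun d _ => ?_
    -- In Koszul's combination the symmetry of `Q` cancels four of the six terms and leaves `2 Q`.
    rw [hdg, hdg, hdg, hQs d μ b, hQs d b μ, hQs b μ d]
    ring
  rw [hΓ, hQ]
  calc E x * ((g x)⁻¹ * ((E x).transpose * η * N μ))
      = E x * ((g x)⁻¹ * (E x).transpose * η) * N μ := by noncomm_ring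
    _ = N μ := by rw [hinv, h.mul_dual x hx, one_mul]

lemma entryDiff_connMat (h : IsMovingFrame U g η E F γ) (hx : x ∈ U) (μ : Fin 4) :
    EntryDiff (connMat E γ μ) x := by
  intro i j
  simp only [connMat, Matrix.sum_apply, Matrix.smul_apply, smul_eq_mul]
  exact DifferentiableAt.fun_sum fun C _ => (h.entryDiff hx C μ).mul (h.diff_conn x hx C i j)

lemma entryDiff_pderivMat (h : IsMovingFrame U g η E F γ) (hx : x ∈ U) (μ : Fin 4) :
    EntryDiff (pderivMat μ E) x := fun i j => differentiableAt_pderiv μ (h.contDiff x hx i j)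

lemma entryDiff_christoffelMat (h : IsMovingFrame U g η E F γ) (hx : x ∈ U) (μ : Fin 4) :
    EntryDiff (christoffelMat g μ) x := by
  refine ((h.diff_dual x hx).mul ((h.entryDiff_pderivMat hx μ).add
    ((h.entryDiff_connMat hx μ).mul (h.entryDiff hx)))).congr ?_
  refine Filter.mem_of_superset (h.isOpen.mem_nhds hx) fun y hy => ?_
  change christoffelMat g μ y = F y * (pderivMat μ E y + connMat E γ μ y * E y)
  rw [← h.mul_christoffelMat hy, ← Matrix.mul_assoc, h.dual_mul hy, Matrix.one_mul]

/-- The derivative of the relation between the Christoffel symbols and the connection matrices. -/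
lemma mul_pderivMat_christoffelMat (h : IsMovingFrame U g η E F γ) (hx : x ∈ U) (μ ν : Fin 4) :
    pderivMat μ E x * christoffelMat g ν x + E x * pderivMat μ (christoffelMat g ν) x =
      pderivMat μ (pderivMat ν E) x + (pderivMat μ (connMat E γ ν) x * E x
        + connMat E γ ν x * pderivMat μ E x) := by
  have hE := h.entryDiff hx
  have hA := h.entryDiff_connMat hx ν
  rw [← pderivMat_mul μ hE (h.entryDiff_christoffelMat hx ν), ← pderivMat_mul μ hA hE,
    ← pderivMat_add μ (h.entryDiff_pderivMat hx ν) (hA.mul hE)]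
  exact pderivMat_congr μ (Filter.mem_of_superset (h.isOpen.mem_nhds hx)
    fun y hy => h.mul_christoffelMat hy ν)

/-- Gauge-related connections have conjugate curvatures: differentiate `E Γ = ∂E + A E` and
antisymmetrise. -/
lemma mul_riemannMat (h : IsMovingFrame U g η E F γ) (hx : x ∈ U) (μ ν : Fin 4) :
    E x * riemannMat g x μ ν = (pderivMat μ (connMat E γ ν) x - pderivMat ν (connMat E γ μ) x
      + (connMat E γ μ x * connMat E γ ν x - connMat E γ ν x * connMat E γ μ x)) * E x := by
  have h1 := h.mul_pderivMat_christoffelMat hx μ ν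
  have h2 := h.mul_pderivMat_christoffelMat hx ν μ
  have hs : pderivMat μ (pderivMat ν E) x = pderivMat ν (pderivMat μ E) x := by
    ext i j
    exact pderiv_comm μ ν (h.contDiff x hx i j)
  have hm := h.mul_christoffelMat hx μ
  have hn := h.mul_christoffelMat hx ν
  -- Equality of mixed partials makes the second derivatives of `E` drop out of the difference.
  rw [hs] at h1
  have e1 := eq_sub_of_add_eq' h1
  have e2 := eq_sub_of_add_eq' h2
  rw [riemannMat_eq]
  calc E x * (pderivMat μ (christoffelMat g ν) x - pderivMat ν (christoffelMat g μ) x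
      + (christoffelMat g μ x * christoffelMat g ν x
        - christoffelMat g ν x * christoffelMat g μ x))
      = E x * pderivMat μ (christoffelMat g ν) x - E x * pderivMat ν (christoffelMat g μ) x
        + ((E x * christoffelMat g μ x) * christoffelMat g ν x
        - (E x * christoffelMat g ν x) * christoffelMat g μ x) := by noncomm_ring
    _ = (pderivMat μ (connMat E γ ν) x - pderivMat ν (connMat E γ μ) x) * E x
        + connMat E γ ν x * pderivMat μ E x - connMat E γ μ x * pderivMat ν E x
        + (connMat E γ μ x * (E x * christoffelMat g ν x)
          - connMat E γ ν x * (E x * christoffelMat g μ x)) := by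
      conv_lhs => rw [e1, e2, hm, hn]
      noncomm_ring
    _ = _ := by rw [hm, hn]; noncomm_ring

lemma pderivMat_connMat (h : IsMovingFrame U g η E F γ) (hx : x ∈ U)
    {dγ : Fin 4 → Fin 4 → Matrix (Fin 4) (Fin 4) ℝ}
    (hdγ : ∀ μ D, pderivMat μ (γ D) x = ∑ C, E x C μ • dγ C D) (μ ν : Fin 4) :
    pderivMat μ (connMat E γ ν) x = ∑ D, pderivMat μ E x D ν • γ D x
      + ∑ C, ∑ D, (E x C μ * E x D ν) • dγ C D := by
  ext i j
  have h1 : pderivMat μ (connMat E γ ν) x i j =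
      ∑ D, (pderivMat μ E x D ν * γ D x i j + E x D ν * pderivMat μ (γ D) x i j) := by
    simp only [pderivMat, Matrix.of_apply, connMat, Matrix.sum_apply, Matrix.smul_apply,
      smul_eq_mul]
    rw [pderiv_sum _ μ fun D => (h.entryDiff hx D ν).fun_mul (h.diff_conn x hx D i j)]
    exact Finset.sum_congr rfl fun D _ => pderiv_mul μ (h.entryDiff hx D ν)
      (h.diff_conn x hx D i j)
  rw [h1, Finset.sum_add_distrib]
  simp only [Matrix.add_apply, Matrix.sum_apply, Matrix.smul_apply, smul_eq_mul, hdγ,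
    Finset.mul_sum]
  congr 1
  rw [Finset.sum_comm]
  exact Finset.sum_congr rfl fun _ _ => Finset.sum_congr rfl fun _ _ => by ring

/-- The Riemann tensor of a metric from the connection in a moving frame. -/
theorem mul_riemannMat_eq_frameCurv (h : IsMovingFrame U g η E F γ) (hx : x ∈ U)
    {dγ : Fin 4 → Fin 4 → Matrix (Fin 4) (Fin 4) ℝ}
    (hdγ : ∀ μ D, pderivMat μ (γ D) x = ∑ C, E x C μ • dγ C D) (μ ν : Fin 4) :
    E x * riemannMat g x μ ν =
      (∑ C, ∑ D, (E x C μ * E x D ν) • frameCurv (fun C => γ C x) dγ C D) * E x := by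
  rw [h.mul_riemannMat hx, h.pderivMat_connMat hx hdγ, h.pderivMat_connMat hx hdγ]
  congr 1
  -- Zero torsion expresses the curl of the coframe by the antisymmetric part of the connection;
  -- this produces the last sum in `frameCurv`.
  have ht : ∀ e, pderivMat μ E x e ν - pderivMat ν E x e μ =
      - ∑ C, ∑ D, (E x C μ * E x D ν) * (γ C x e D - γ D x e C) := by
    intro e
    have h1 := h.torsion x hx μ ν e
    have h2 : ∀ μ ν, (connMat E γ μ x * E x) e ν =
        ∑ C, ∑ D, (E x C μ * E x D ν) * γ C x e D := by
      intro μ ν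
      rw [connMat, Matrix.sum_mul, Matrix.sum_apply]
      refine Finset.sum_congr rfl fun _ _ => ?_
      rw [Matrix.smul_mul, Matrix.smul_apply, Matrix.mul_apply, smul_eq_mul, Finset.mul_sum]
      exact Finset.sum_congr rfl fun _ _ => by ring
    have h3 : ∑ C, ∑ D, (E x C μ * E x D ν) * γ D x e C =
        ∑ C, ∑ D, (E x C ν * E x D μ) * γ C x e D := by
      rw [Finset.sum_comm]
      exact Finset.sum_congr rfl fun _ _ => Finset.sum_congr rfl fun _ _ => by ring
    simp only [Matrix.add_apply, h2] at h1
    simp only [mul_sub, Finset.sum_sub_distrib, h3]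
    linarith
  have hcomm : connMat E γ μ x * connMat E γ ν x - connMat E γ ν x * connMat E γ μ x =
      ∑ C, ∑ D, (E x C μ * E x D ν) • (γ C x * γ D x - γ D x * γ C x) := by
    simp only [connMat, Matrix.sum_mul, Matrix.mul_sum, Matrix.smul_mul, Matrix.mul_smul,
      Finset.smul_sum, smul_smul, smul_sub, Finset.sum_sub_distrib]
    congr 1
    rw [Finset.sum_comm]
    exact Finset.sum_congr rfl fun _ _ => Finset.sum_congr rfl fun _ _ => by rw [mul_comm]
  have hd : ∑ C, ∑ D, (E x C ν * E x D μ) • dγ C D = ∑ C, ∑ D, (E x C μ * E x D ν) • dγ D C := by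
    rw [Finset.sum_comm]
    exact Finset.sum_congr rfl fun _ _ => Finset.sum_congr rfl fun _ _ => by rw [mul_comm]
  have hE : ∑ D, pderivMat μ E x D ν • γ D x - ∑ D, pderivMat ν E x D μ • γ D x =
      - ∑ C, ∑ D, (E x C μ * E x D ν) • ∑ e, (γ C x e D - γ D x e C) • γ e x := by
    rw [← Finset.sum_sub_distrib]
    simp only [← sub_smul, ht, Finset.smul_sum, Finset.sum_smul, neg_smul, Finset.sum_neg_distrib,
      smul_smul]
    congr 1
    rw [Finset.sum_comm]
    exact Finset.sum_congr rfl fun _ _ => Finset.sum_comm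
  rw [hcomm, hd]
  simp only [frameCurv, smul_sub, smul_add, Finset.sum_sub_distrib, Finset.sum_add_distrib]
  rw [add_sub_add_comm, hE]
  abel

end IsMovingFrame

/-! ### The curvature of the Kerr-like frame -/

/-- The Minkowski metric. -/
def minkowski : Matrix (Fin 4) (Fin 4) ℝ := Matrix.diagonal ![-1, 1, 1, 1]

/-- The shape of the connection in the Kerr-like frame. -/
def connForm (α β δ ρ κ τ : ℝ) : Fin 4 → Matrix (Fin 4) (Fin 4) ℝ :=
  ![!![0, α, -β, 0; α, 0, 0, τ; -β, 0, 0, δ; 0, -τ, -δ, 0],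
    !![0, 0, 0, τ; 0, 0, -β, 0; 0, β, 0, 0; τ, 0, 0, 0],
    !![0, 0, 0, -δ; 0, 0, -ρ, 0; 0, ρ, 0, 0; -δ, 0, 0, 0],
    !![0, τ, δ, 0; τ, 0, 0, -ρ; δ, 0, 0, -κ; 0, ρ, κ, 0]]

/-- The elementary bivector `e_i ∧ e_j`. -/
def biv (i j : Fin 4) : Matrix (Fin 4) (Fin 4) ℝ := Matrix.single i j 1 - Matrix.single j i 1

/-- The shape of the Riemann tensor in the Kerr-like frame. -/
def curvForm (u v w z : ℝ) (A B C D : Fin 4) : ℝ :=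
  u * (biv 0 1 A B * biv 0 1 C D) + v * (biv 2 3 A B * biv 2 3 C D)
    + w * (biv 0 2 A B * biv 0 2 C D + biv 0 3 A B * biv 0 3 C D
      - biv 1 2 A B * biv 1 2 C D - biv 1 3 A B * biv 1 3 C D)
    + z * (2 * (biv 0 1 A B * biv 2 3 C D + biv 2 3 A B * biv 0 1 C D)
      + (biv 0 2 A B * biv 1 3 C D + biv 1 3 A B * biv 0 2 C D)
      - (biv 0 3 A B * biv 1 2 C D + biv 1 2 A B * biv 0 3 C D))

lemma frameCurv_swap (γ : Fin 4 → Matrix (Fin 4) (Fin 4) ℝ)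
    (dγ : Fin 4 → Fin 4 → Matrix (Fin 4) (Fin 4) ℝ) (C D : Fin 4) :
    frameCurv γ dγ D C = -frameCurv γ dγ C D := by
  have h : ∑ e, (γ D e C - γ C e D) • γ e = -∑ e, (γ C e D - γ D e C) • γ e := by
    rw [← Finset.sum_neg_distrib]
    exact Finset.sum_congr rfl fun e _ => by rw [← neg_smul, neg_sub]
  rw [frameCurv, frameCurv, h]
  abel

lemma biv_swap (i j A B : Fin 4) : biv i j B A = -biv i j A B := by
  simp only [biv, Matrix.sub_apply, Matrix.single_apply]
  rw [neg_sub]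
  congr 1 <;> simp only [and_comm]

lemma curvForm_swap (u v w z : ℝ) (A B C D : Fin 4) :
    curvForm u v w z A B D C = -curvForm u v w z A B C D := by
  simp only [curvForm, biv_swap _ _ C D]
  ring

/-- The suffixes `₁` and `₂` mark derivatives along the frame vectors `e₁` and `e₂`. Those along
`e₀` and `e₃` are zero because the coefficients depend on `r` and `θ` only. This lemma and the next
five treat one coordinate 2-plane each. -/
lemma frameCurv_connForm_0_1 (α β δ ρ κ τ α₁ β₁ δ₁ ρ₁ κ₁ τ₁ α₂ β₂ δ₂ ρ₂ κ₂ τ₂ : ℝ) :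
    frameCurv (connForm α β δ ρ κ τ) ![fun _ => 0, connForm α₁ β₁ δ₁ ρ₁ κ₁ τ₁,
      connForm α₂ β₂ δ₂ ρ₂ κ₂ τ₂, fun _ => 0] 0 1 =
    !![0, -α₁ - α * α - β * β + 3 * τ * τ, β₁ + 3 * δ * τ, 0;
      -α₁ - α * α - β * β + 3 * τ * τ, 0, 0, -τ₁ + β * δ - 2 * ρ * τ;
      β₁ + 3 * δ * τ, 0, 0, -δ₁ - α * δ - 2 * β * τ - 2 * κ * τ;
      0, τ₁ - β * δ + 2 * ρ * τ, δ₁ + α * δ + 2 * β * τ + 2 * κ * τ, 0] := by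
  simp only [frameCurv, connForm, Fin.sum_univ_four]
  ext A B
  fin_cases A <;> fin_cases B <;> simp <;> ring

lemma frameCurv_connForm_0_2 (α β δ ρ κ τ α₁ β₁ δ₁ ρ₁ κ₁ τ₁ α₂ β₂ δ₂ ρ₂ κ₂ τ₂ : ℝ) :
    frameCurv (connForm α β δ ρ κ τ) ![fun _ => 0, connForm α₁ β₁ δ₁ ρ₁ κ₁ τ₁,
      connForm α₂ β₂ δ₂ ρ₂ κ₂ τ₂, fun _ => 0] 0 2 =
    !![0, -α₂ + α * β - β * ρ - δ * τ, β₂ - α * ρ - β * β - δ * δ, 0;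
      -α₂ + α * β - β * ρ - δ * τ, 0, 0, -τ₂ - α * δ + β * τ + δ * ρ;
      β₂ - α * ρ - β * β - δ * δ, 0, 0, -δ₂ + 2 * β * δ - ρ * τ;
      0, τ₂ + α * δ - β * τ - δ * ρ, δ₂ - 2 * β * δ + ρ * τ, 0] := by
  simp only [frameCurv, connForm, Fin.sum_univ_four]
  ext A B
  fin_cases A <;> fin_cases B <;> simp <;> ring

lemma frameCurv_connForm_0_3 (α β δ ρ κ τ α₁ β₁ δ₁ ρ₁ κ₁ τ₁ α₂ β₂ δ₂ ρ₂ κ₂ τ₂ : ℝ) :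
    frameCurv (connForm α β δ ρ κ τ) ![fun _ => 0, connForm α₁ β₁ δ₁ ρ₁ κ₁ τ₁,
      connForm α₂ β₂ δ₂ ρ₂ κ₂ τ₂, fun _ => 0] 0 3 =
    !![0, 0, 0, -α * ρ + β * κ - δ * δ - τ * τ;
      0, 0, α * δ + β * τ - δ * ρ + κ * τ, 0;
      0, -α * δ - β * τ + δ * ρ - κ * τ, 0, 0;
      -α * ρ + β * κ - δ * δ - τ * τ, 0, 0, 0] := by
  simp only [frameCurv, connForm, Fin.sum_univ_four]
  ext A B
  fin_cases A <;> fin_cases B <;> simp <;> ring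

lemma frameCurv_connForm_1_2 (α β δ ρ κ τ α₁ β₁ δ₁ ρ₁ κ₁ τ₁ α₂ β₂ δ₂ ρ₂ κ₂ τ₂ : ℝ) :
    frameCurv (connForm α β δ ρ κ τ) ![fun _ => 0, connForm α₁ β₁ δ₁ ρ₁ κ₁ τ₁,
      connForm α₂ β₂ δ₂ ρ₂ κ₂ τ₂, fun _ => 0] 1 2 =
    !![0, 0, 0, -δ₁ - τ₂ + β * τ - δ * ρ;
      0, 0, β₂ - ρ₁ - β * β - ρ * ρ, 0;
      0, -β₂ + ρ₁ + β * β + ρ * ρ, 0, 0;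
      -δ₁ - τ₂ + β * τ - δ * ρ, 0, 0, 0] := by
  simp only [frameCurv, connForm, Fin.sum_univ_four]
  ext A B
  fin_cases A <;> fin_cases B <;> simp <;> ring

lemma frameCurv_connForm_1_3 (α β δ ρ κ τ α₁ β₁ δ₁ ρ₁ κ₁ τ₁ α₂ β₂ δ₂ ρ₂ κ₂ τ₂ : ℝ) :
    frameCurv (connForm α β δ ρ κ τ) ![fun _ => 0, connForm α₁ β₁ δ₁ ρ₁ κ₁ τ₁,
      connForm α₂ β₂ δ₂ ρ₂ κ₂ τ₂, fun _ => 0] 1 3 =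
    !![0, τ₁ - β * δ + 2 * ρ * τ, δ₁ + β * τ + δ * ρ + κ * τ, 0;
      τ₁ - β * δ + 2 * ρ * τ, 0, 0, -ρ₁ + β * κ - ρ * ρ - τ * τ;
      δ₁ + β * τ + δ * ρ + κ * τ, 0, 0, -κ₁ - β * ρ - δ * τ - κ * ρ;
      0, ρ₁ - β * κ + ρ * ρ + τ * τ, κ₁ + β * ρ + δ * τ + κ * ρ, 0] := by
  simp only [frameCurv, connForm, Fin.sum_univ_four]
  ext A B
  fin_cases A <;> fin_cases B <;> simp <;> ring

lemma frameCurv_connForm_2_3 (α β δ ρ κ τ α₁ β₁ δ₁ ρ₁ κ₁ τ₁ α₂ β₂ δ₂ ρ₂ κ₂ τ₂ : ℝ) :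
    frameCurv (connForm α β δ ρ κ τ) ![fun _ => 0, connForm α₁ β₁ δ₁ ρ₁ κ₁ τ₁,
      connForm α₂ β₂ δ₂ ρ₂ κ₂ τ₂, fun _ => 0] 2 3 =
    !![0, τ₂ + 2 * α * δ - 2 * δ * ρ + κ * τ, δ₂ - 2 * β * δ + ρ * τ, 0;
      τ₂ + 2 * α * δ - 2 * δ * ρ + κ * τ, 0, 0, -ρ₂ + 3 * δ * τ;
      δ₂ - 2 * β * δ + ρ * τ, 0, 0, -κ₂ + 3 * δ * δ - κ * κ - ρ * ρ;
      0, ρ₂ - 3 * δ * τ, κ₂ - 3 * δ * δ + κ * κ + ρ * ρ, 0] := by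
  simp only [frameCurv, connForm, Fin.sum_univ_four]
  ext A B
  fin_cases A <;> fin_cases B <;> simp <;> ring

/-- The equations that say that the curvature of `connForm` is `curvForm`. -/
structure IsCurvatureOf (u v w z α β δ ρ κ τ α₁ β₁ δ₁ ρ₁ κ₁ τ₁ α₂ β₂ δ₂ ρ₂ κ₂ τ₂ : ℝ) :
    Prop where
  c0101 : -α₁ - α * α - β * β + 3 * τ * τ = -u
  c0201 : β₁ + 3 * δ * τ = 0
  c1301 : τ₁ - β * δ + 2 * ρ * τ = 0
  c2301 : δ₁ + α * δ + 2 * β * τ + 2 * κ * τ = -(2 * z)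
  c0102 : -α₂ + α * β - β * ρ - δ * τ = 0
  c0202 : β₂ - α * ρ - β * β - δ * δ = -w
  c1302 : τ₂ + α * δ - β * τ - δ * ρ = -z
  c2302 : δ₂ - 2 * β * δ + ρ * τ = 0
  c0303 : -α * ρ + β * κ - δ * δ - τ * τ = -w
  c1203 : α * δ + β * τ - δ * ρ + κ * τ = -z
  c0312 : -δ₁ - τ₂ + β * τ - δ * ρ = z
  c1212 : β₂ - ρ₁ - β * β - ρ * ρ = -w
  c0213 : δ₁ + β * τ + δ * ρ + κ * τ = -z
  c1313 : ρ₁ - β * κ + ρ * ρ + τ * τ = w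
  c2313 : κ₁ + β * ρ + δ * τ + κ * ρ = 0
  c0123 : τ₂ + 2 * α * δ - 2 * δ * ρ + κ * τ = -(2 * z)
  c1323 : ρ₂ - 3 * δ * τ = 0
  c2323 : κ₂ - 3 * δ * δ + κ * κ + ρ * ρ = -v

set_option maxHeartbeats 1000000 in
lemma IsCurvatureOf.minkowski_mul_frameCurv_of_lt
    {u v w z α β δ ρ κ τ α₁ β₁ δ₁ ρ₁ κ₁ τ₁ α₂ β₂ δ₂ ρ₂ κ₂ τ₂ : ℝ}
    (h : IsCurvatureOf u v w z α β δ ρ κ τ α₁ β₁ δ₁ ρ₁ κ₁ τ₁ α₂ β₂ δ₂ ρ₂ κ₂ τ₂)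
    (A B C D : Fin 4) (hCD : C < D) :
    (minkowski * frameCurv (connForm α β δ ρ κ τ) ![fun _ => 0, connForm α₁ β₁ δ₁ ρ₁ κ₁ τ₁,
      connForm α₂ β₂ δ₂ ρ₂ κ₂ τ₂, fun _ => 0] C D) A B = curvForm u v w z A B C D := by
  obtain ⟨h1, h2, h3, h4, h5, h6, h7, h8, h9, h10, h11, h12, h13, h14, h15, h16, h17, h18⟩ := h
  rw [minkowski, Matrix.diagonal_mul]
  have h01 : ∀ A B, ![-1, 1, 1, 1] A * frameCurv (connForm α β δ ρ κ τ) ![fun _ => 0,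
      connForm α₁ β₁ δ₁ ρ₁ κ₁ τ₁, connForm α₂ β₂ δ₂ ρ₂ κ₂ τ₂, fun _ => 0] 0 1 A B =
      curvForm u v w z A B 0 1 := by
    intro A B
    rw [frameCurv_connForm_0_1]
    fin_cases A <;> fin_cases B <;> simp [curvForm, biv] <;> linarith
  have h02 : ∀ A B, ![-1, 1, 1, 1] A * frameCurv (connForm α β δ ρ κ τ) ![fun _ => 0,
      connForm α₁ β₁ δ₁ ρ₁ κ₁ τ₁, connForm α₂ β₂ δ₂ ρ₂ κ₂ τ₂, fun _ => 0] 0 2 A B =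
      curvForm u v w z A B 0 2 := by
    intro A B
    rw [frameCurv_connForm_0_2]
    fin_cases A <;> fin_cases B <;> simp [curvForm, biv] <;> linarith
  have h03 : ∀ A B, ![-1, 1, 1, 1] A * frameCurv (connForm α β δ ρ κ τ) ![fun _ => 0,
      connForm α₁ β₁ δ₁ ρ₁ κ₁ τ₁, connForm α₂ β₂ δ₂ ρ₂ κ₂ τ₂, fun _ => 0] 0 3 A B =
      curvForm u v w z A B 0 3 := by
    intro A B
    rw [frameCurv_connForm_0_3]
    fin_cases A <;> fin_cases B <;> simp [curvForm, biv] <;> linarith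
  have h12 : ∀ A B, ![-1, 1, 1, 1] A * frameCurv (connForm α β δ ρ κ τ) ![fun _ => 0,
      connForm α₁ β₁ δ₁ ρ₁ κ₁ τ₁, connForm α₂ β₂ δ₂ ρ₂ κ₂ τ₂, fun _ => 0] 1 2 A B =
      curvForm u v w z A B 1 2 := by
    intro A B
    rw [frameCurv_connForm_1_2]
    fin_cases A <;> fin_cases B <;> simp [curvForm, biv] <;> linarith
  have h13 : ∀ A B, ![-1, 1, 1, 1] A * frameCurv (connForm α β δ ρ κ τ) ![fun _ => 0,
      connForm α₁ β₁ δ₁ ρ₁ κ₁ τ₁, connForm α₂ β₂ δ₂ ρ₂ κ₂ τ₂, fun _ => 0] 1 3 A B =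
      curvForm u v w z A B 1 3 := by
    intro A B
    rw [frameCurv_connForm_1_3]
    fin_cases A <;> fin_cases B <;> simp [curvForm, biv] <;> linarith
  have h23 : ∀ A B, ![-1, 1, 1, 1] A * frameCurv (connForm α β δ ρ κ τ) ![fun _ => 0,
      connForm α₁ β₁ δ₁ ρ₁ κ₁ τ₁, connForm α₂ β₂ δ₂ ρ₂ κ₂ τ₂, fun _ => 0] 2 3 A B =
      curvForm u v w z A B 2 3 := by
    intro A B
    rw [frameCurv_connForm_2_3]
    fin_cases A <;> fin_cases B <;> simp [curvForm, biv] <;> linarith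
  fin_cases C <;> fin_cases D <;> first
    | exact absurd hCD (by decide)
    | exact h01 A B
    | exact h02 A B
    | exact h03 A B
    | exact h12 A B
    | exact h13 A B
    | exact h23 A B

lemma IsCurvatureOf.minkowski_mul_frameCurv
    {u v w z α β δ ρ κ τ α₁ β₁ δ₁ ρ₁ κ₁ τ₁ α₂ β₂ δ₂ ρ₂ κ₂ τ₂ : ℝ}
    (h : IsCurvatureOf u v w z α β δ ρ κ τ α₁ β₁ δ₁ ρ₁ κ₁ τ₁ α₂ β₂ δ₂ ρ₂ κ₂ τ₂)
    (A B C D : Fin 4) :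
    (minkowski * frameCurv (connForm α β δ ρ κ τ) ![fun _ => 0, connForm α₁ β₁ δ₁ ρ₁ κ₁ τ₁,
      connForm α₂ β₂ δ₂ ρ₂ κ₂ τ₂, fun _ => 0] C D) A B = curvForm u v w z A B C D := by
  rcases lt_trichotomy C D with hCD | rfl | hCD
  · exact h.minkowski_mul_frameCurv_of_lt A B C D hCD
  · have h1 := self_eq_neg.mp (curvForm_swap u v w z A B C C)
    simp [h1, frameCurv]
  · rw [frameCurv_swap, curvForm_swap, Matrix.mul_neg, Matrix.neg_apply,
      h.minkowski_mul_frameCurv_of_lt A B D C hCD]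

/-- Cartan's second structure equation as pure algebra, with `p = √Δ_r`, `q = √Σ`, `x = a cos θ`, `y
= a sin θ`, `d = Δ_r'/2` and `e = d'`. For `m = r M` one has `r² + x² + y² - p² = 2m`, `r - d = m'`
and `1 - e = m''`. After clearing denominators `q² = r² + x²` is the only relation needed. -/
lemma isCurvatureOf {p q r x y d e : ℝ} (hp : p ≠ 0) (hq : q ≠ 0) (hy : y ≠ 0)
    (hq2 : q ^ 2 = r ^ 2 + x ^ 2) :
    IsCurvatureOf
      (-(1 - e) / q ^ 2 + 4 * r * (r - d) / q ^ 4
          - (r ^ 2 + x ^ 2 + y ^ 2 - p ^ 2) * (3 * r ^ 2 - x ^ 2) / q ^ 6)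
      ((r ^ 2 + x ^ 2 + y ^ 2 - p ^ 2) * (r ^ 2 - 3 * x ^ 2) / q ^ 6)
      (-(r * (r - d)) / q ^ 4 + (r ^ 2 + x ^ 2 + y ^ 2 - p ^ 2) * (r ^ 2 - x ^ 2) / q ^ 6)
      ((r - d) * x / q ^ 4 - 2 * (r ^ 2 + x ^ 2 + y ^ 2 - p ^ 2) * r * x / q ^ 6)
      (d / (p * q) - p * r / q ^ 3) (x * y / q ^ 3) (p * x / q ^ 3) (p * r / q ^ 3)
      (x / (y * q) + x * y / q ^ 3) (r * y / q ^ 3)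
      (p / q * (e / (p * q) - d ^ 2 / (p ^ 3 * q) - 2 * d * r / (p * q ^ 3) - p / q ^ 3
            + 3 * p * r ^ 2 / q ^ 5))
      (p / q * (-(3 * x * y * r) / q ^ 5))
      (p / q * (d * x / (p * q ^ 3) - 3 * p * x * r / q ^ 5))
      (p / q * (d * r / (p * q ^ 3) + p / q ^ 3 - 3 * p * r ^ 2 / q ^ 5))
      (p / q * (-(x * r) / (y * q ^ 3) - 3 * x * y * r / q ^ 5))
      (p / q * (y / q ^ 3 - 3 * r ^ 2 * y / q ^ 5))
      (1 / q * (d * x * y / (p * q ^ 3) - 3 * p * r * x * y / q ^ 5))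
      (1 / q * ((x ^ 2 - y ^ 2) / q ^ 3 + 3 * x ^ 2 * y ^ 2 / q ^ 5))
      (1 / q * (-(p * y) / q ^ 3 + 3 * p * x ^ 2 * y / q ^ 5))
      (1 / q * (3 * p * r * x * y / q ^ 5))
      (1 / q * (-1 / q - x ^ 2 / (y ^ 2 * q) + x ^ 2 / q ^ 3 + (x ^ 2 - y ^ 2) / q ^ 3
            + 3 * x ^ 2 * y ^ 2 / q ^ 5))
      (1 / q * (r * x / q ^ 3 + 3 * r * x * y ^ 2 / q ^ 5)) := by
  constructor
  all_goals
    field_simp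
    first
    | (ring_nf; done)
    | (simp only [hq2]; ring_nf)

/-! ### The Kerr-like frame -/

/-- `√Δ_r`. -/
def sqrtDelta (a : ℝ) (M : ℝ → ℝ) (r : ℝ) : ℝ := √(delta a M r)

/-- `√Σ`. -/
def sqrtSigma (a r θ : ℝ) : ℝ := √(sigma a r θ)

/-- `Δ_r' / 2`. -/
def halfDerivDelta (M : ℝ → ℝ) (r : ℝ) : ℝ := r - M r - r * deriv M r

/-- The part of the chart where `Δ_r` is positive and `M` is smooth. -/
def frameDomain (a : ℝ) (M : ℝ → ℝ) : Set Coord :=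
  {x | ContDiffAt ℝ 3 M (x 1) ∧ 0 < delta a M (x 1) ∧ 0 < x 2 ∧ x 2 < Real.pi ∧
    0 < sigma a (x 1) (x 2)}

/-- The orthonormal coframe of the Kerr-like metric. -/
def kerrCoframe (a : ℝ) (M : ℝ → ℝ) (x : Coord) : Matrix (Fin 4) (Fin 4) ℝ :=
  !![sqrtDelta a M (x 1) / sqrtSigma a (x 1) (x 2), 0, 0,
      -(a * Real.sin (x 2) ^ 2 * (sqrtDelta a M (x 1) / sqrtSigma a (x 1) (x 2)));
    0, sqrtSigma a (x 1) (x 2) / sqrtDelta a M (x 1), 0, 0;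
    0, 0, sqrtSigma a (x 1) (x 2), 0;
    a * Real.sin (x 2) / sqrtSigma a (x 1) (x 2), 0, 0,
      -(((x 1) ^ 2 + a ^ 2) * Real.sin (x 2) / sqrtSigma a (x 1) (x 2))]

/-- The orthonormal frame of the Kerr-like metric. -/
def kerrFrame (a : ℝ) (M : ℝ → ℝ) (x : Coord) : Matrix (Fin 4) (Fin 4) ℝ :=
  !![((x 1) ^ 2 + a ^ 2) / (sqrtDelta a M (x 1) * sqrtSigma a (x 1) (x 2)), 0, 0,
      -(a * Real.sin (x 2) / sqrtSigma a (x 1) (x 2));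
    0, sqrtDelta a M (x 1) / sqrtSigma a (x 1) (x 2), 0, 0;
    0, 0, 1 / sqrtSigma a (x 1) (x 2), 0;
    a / (sqrtDelta a M (x 1) * sqrtSigma a (x 1) (x 2)), 0, 0,
      -(1 / (sqrtSigma a (x 1) (x 2) * Real.sin (x 2)))]

/-- The connection coefficients in terms of `p = √Δ_r`, `q = √Σ`, `r`, `x = a cos θ`,
`y = a sin θ` and `d = Δ_r' / 2`. -/
def kerrConnAt (p q r x y d : ℝ) : Fin 4 → Matrix (Fin 4) (Fin 4) ℝ :=
  connForm (d / (p * q) - p * r / q ^ 3) (x * y / q ^ 3) (p * x / q ^ 3) (p * r / q ^ 3)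
    (x / (y * q) + x * y / q ^ 3) (r * y / q ^ 3)

/-- The connection of the Kerr-like metric in its orthonormal frame. -/
def kerrConn (a : ℝ) (M : ℝ → ℝ) (C : Fin 4) (x : Coord) : Matrix (Fin 4) (Fin 4) ℝ :=
  kerrConnAt (sqrtDelta a M (x 1)) (sqrtSigma a (x 1) (x 2)) (x 1) (a * Real.cos (x 2))
    (a * Real.sin (x 2)) (halfDerivDelta M (x 1)) C

section Derivatives

variable {a : ℝ} {M : ℝ → ℝ} {r θ : ℝ}

lemma sqrtDelta_pos (h : 0 < delta a M r) : 0 < sqrtDelta a M r := Real.sqrt_pos.mpr h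

lemma sqrtSigma_pos (h : 0 < sigma a r θ) : 0 < sqrtSigma a r θ := Real.sqrt_pos.mpr h

lemma sqrtSigma_sq (h : 0 < sigma a r θ) :
    sqrtSigma a r θ ^ 2 = r ^ 2 + (a * Real.cos θ) ^ 2 := by
  rw [sqrtSigma, Real.sq_sqrt h.le, sigma]; ring

lemma sqrtDelta_sq (h : 0 < delta a M r) : sqrtDelta a M r ^ 2 = r ^ 2 - 2 * M r * r + a ^ 2 := by
  rw [sqrtDelta, Real.sq_sqrt h.le, delta]

lemma hasDerivAt_sqrtDelta (hM : ContDiffAt ℝ 3 M r) (h : 0 < delta a M r) :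
    HasDerivAt (sqrtDelta a M) (halfDerivDelta M r / sqrtDelta a M r) r := by
  have h1 : HasDerivAt M (deriv M r) r := (hM.differentiableAt (by simp)).hasDerivAt
  have h2 : HasDerivAt (delta a M) (2 * r - (2 * deriv M r * r + 2 * M r)) r := by
    have := ((hasDerivAt_pow 2 r).sub ((h1.const_mul 2).mul (hasDerivAt_id r))).add_const (a ^ 2)
    refine this.congr_deriv ?_
    simp
  refine (h2.sqrt h.ne').congr_deriv ?_
  have := sqrtDelta_pos h
  change _ / (2 * sqrtDelta a M r) = _
  rw [halfDerivDelta]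
  field_simp
  ring

lemma contDiffAt_deriv {m n : WithTop ℕ∞} (hM : ContDiffAt ℝ n M r) (hmn : m + 1 ≤ n) :
    ContDiffAt ℝ m (deriv M) r := by
  have h : deriv M = fun x => fderiv ℝ M x 1 := by
    funext x
    exact fderiv_apply_one_eq_deriv.symm
  rw [h]
  exact (hM.fderiv_right hmn).clm_apply contDiffAt_const

lemma hasDerivAt_halfDerivDelta (hM : ContDiffAt ℝ 3 M r) :
    HasDerivAt (halfDerivDelta M) (1 - 2 * deriv M r - r * deriv (deriv M) r) r := by
  have h1 : HasDerivAt M (deriv M r) r := (hM.differentiableAt (by simp)).hasDerivAt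
  have h2 : HasDerivAt (deriv M) (deriv (deriv M) r) r := by
    have : ContDiffAt ℝ 2 (deriv M) r := contDiffAt_deriv hM (by norm_num)
    exact (this.differentiableAt (by simp)).hasDerivAt
  refine (((hasDerivAt_id r).sub h1).sub ((hasDerivAt_id r).mul h2)).congr_deriv ?_
  simp
  ring

lemma hasDerivAt_sqrtSigma_r (h : 0 < sigma a r θ) :
    HasDerivAt (fun r => sqrtSigma a r θ) (r / sqrtSigma a r θ) r := by
  have h2 : HasDerivAt (fun r => sigma a r θ) (2 * r) r := by
    refine ((hasDerivAt_pow 2 r).add_const (a ^ 2 * Real.cos θ ^ 2)).congr_deriv ?_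
    simp
  refine (h2.sqrt h.ne').congr_deriv ?_
  have := sqrtSigma_pos h
  change _ / (2 * sqrtSigma a r θ) = _
  field_simp

lemma hasDerivAt_sqrtSigma_theta (h : 0 < sigma a r θ) :
    HasDerivAt (fun θ => sqrtSigma a r θ)
      (-(a * Real.cos θ * (a * Real.sin θ)) / sqrtSigma a r θ) θ := by
  have h2 : HasDerivAt (fun θ => sigma a r θ) (-(2 * a ^ 2 * Real.cos θ * Real.sin θ)) θ := by
    refine ((((Real.hasDerivAt_cos θ).pow 2).const_mul (a ^ 2)).const_add (r ^ 2)).congr_deriv ?_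
    simp
    ring
  refine (h2.sqrt h.ne').congr_deriv ?_
  have := sqrtSigma_pos h
  change _ / (2 * sqrtSigma a r θ) = _
  field_simp

end Derivatives

lemma isOpen_frameDomain (a : ℝ) (M : ℝ → ℝ) : IsOpen (frameDomain a M) := by
  rw [isOpen_iff_mem_nhds]
  rintro x ⟨h1, h2, h3, h4, h5⟩
  have c1 : ContinuousAt (fun y : Coord => y 1) x := (continuous_apply 1).continuousAt
  have c2 : ContinuousAt (fun y : Coord => y 2) x := (continuous_apply 2).continuousAt
  have cM : ContinuousAt (fun y : Coord => M (y 1)) x :=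
    ContinuousAt.comp (f := fun y : Coord => y 1) h1.continuousAt c1
  have cΔ : ContinuousAt (fun y : Coord => delta a M (y 1)) x := ((c1.pow 2).sub ((continuousAt_const.mul cM).mul c1)).add continuousAt_const
  have cS : ContinuousAt (fun y : Coord => sigma a (y 1) (y 2)) x := by
    unfold sigma
    fun_prop
  filter_upwards [c1.eventually (h1.eventually (by simp)), cΔ.eventually_const_lt h2,
    c2.eventually_const_lt h3, c2.eventually_lt_const h4, cS.eventually_const_lt h5]
    with y g1 g2 g3 g4 g5
  exact ⟨g1, g2, g3, g4, g5⟩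

/-! ### Regularity of the coframe, its dual and the connection -/

section Smoothness

variable {a : ℝ} {M : ℝ → ℝ} {x : Coord}

lemma contDiffAt_sqrtDelta (h : x ∈ frameDomain a M) :
    ContDiffAt ℝ 2 (fun y : Coord => sqrtDelta a M (y 1)) x := by
  have hM : ContDiffAt ℝ 2 (fun y : Coord => M (y 1)) x :=
    ContDiffAt.comp (f := fun y : Coord => y 1) x (h.1.of_le (by norm_num)) (by fun_prop)
  unfold sqrtDelta
  refine ContDiffAt.sqrt ?_ h.2.1.ne'
  have h1 : ContDiffAt ℝ 2 (fun y : Coord => y 1) x := by fun_prop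
  exact ((h1.pow 2).sub ((contDiffAt_const.mul hM).mul h1)).add contDiffAt_const

lemma contDiffAt_sqrtSigma (h : x ∈ frameDomain a M) :
    ContDiffAt ℝ 2 (fun y : Coord => sqrtSigma a (y 1) (y 2)) x := by
  unfold sqrtSigma
  refine ContDiffAt.sqrt ?_ h.2.2.2.2.ne'
  unfold sigma
  fun_prop

lemma differentiableAt_halfDerivDelta (h : x ∈ frameDomain a M) :
    DifferentiableAt ℝ (fun y : Coord => halfDerivDelta M (y 1)) x :=
  DifferentiableAt.comp (f := fun y : Coord => y 1) x
    (hasDerivAt_halfDerivDelta h.1).differentiableAt (by fun_prop)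

lemma sin_pos_of_mem_frameDomain (h : x ∈ frameDomain a M) : 0 < Real.sin (x 2) :=
  Real.sin_pos_of_pos_of_lt_pi h.2.2.1 h.2.2.2.1

lemma contDiffAt_kerrCoframe (h : x ∈ frameDomain a M) (i j : Fin 4) :
    ContDiffAt ℝ 2 (fun y => kerrCoframe a M y i j) x := by
  have hp := contDiffAt_sqrtDelta h
  have hq := contDiffAt_sqrtSigma h
  have hp0 := (sqrtDelta_pos h.2.1).ne'
  have hq0 := (sqrtSigma_pos h.2.2.2.2).ne'
  fin_cases i <;> fin_cases j <;> simp [kerrCoframe] <;> fun_prop (disch := assumption)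

lemma entryDiff_kerrFrame (h : x ∈ frameDomain a M) : EntryDiff (kerrFrame a M) x := by
  have hp := (contDiffAt_sqrtDelta h).differentiableAt (by simp)
  have hq := (contDiffAt_sqrtSigma h).differentiableAt (by simp)
  have hp0 := (sqrtDelta_pos h.2.1).ne'
  have hq0 := (sqrtSigma_pos h.2.2.2.2).ne'
  have hs0 := (sin_pos_of_mem_frameDomain h).ne'
  have hpq := mul_ne_zero hp0 hq0
  intro i j
  fin_cases i <;> fin_cases j <;> simp [kerrFrame] <;> fun_prop (disch := assumption)

lemma entryDiff_connForm {α β δ ρ κ τ : Coord → ℝ} (hα : DifferentiableAt ℝ α x)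
    (hβ : DifferentiableAt ℝ β x) (hδ : DifferentiableAt ℝ δ x) (hρ : DifferentiableAt ℝ ρ x)
    (hκ : DifferentiableAt ℝ κ x) (hτ : DifferentiableAt ℝ τ x) (C : Fin 4) :
    EntryDiff (fun y => connForm (α y) (β y) (δ y) (ρ y) (κ y) (τ y) C) x := by
  intro i j
  fin_cases C <;> fin_cases i <;> fin_cases j <;> simp [connForm] <;> assumption

lemma pderivMat_connForm (α β δ ρ κ τ : Coord → ℝ) (μ C : Fin 4) :
    pderivMat μ (fun y => connForm (α y) (β y) (δ y) (ρ y) (κ y) (τ y) C) x =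
      connForm (pderiv μ α x) (pderiv μ β x) (pderiv μ δ x) (pderiv μ ρ x) (pderiv μ κ x)
        (pderiv μ τ x) C := by
  ext i j
  fin_cases C <;> fin_cases i <;> fin_cases j <;> simp [connForm, pderivMat, pderiv]

lemma entryDiff_kerrConn (ha : a ≠ 0) (h : x ∈ frameDomain a M) (C : Fin 4) :
    EntryDiff (kerrConn a M C) x := by
  have hp := (contDiffAt_sqrtDelta h).differentiableAt (by simp)
  have hq := (contDiffAt_sqrtSigma h).differentiableAt (by simp)
  have hd := differentiableAt_halfDerivDelta h
  have hp0 := (sqrtDelta_pos h.2.1).ne'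
  have hq0 := (sqrtSigma_pos h.2.2.2.2).ne'
  have hs0 := mul_ne_zero ha (sin_pos_of_mem_frameDomain h).ne'
  have hpq := mul_ne_zero hp0 hq0
  have hsq := mul_ne_zero hs0 hq0
  have hq3 := pow_ne_zero 3 hq0
  refine entryDiff_connForm ?_ ?_ ?_ ?_ ?_ ?_ C <;> fun_prop (disch := assumption)

end Smoothness

/-! ### The structure equations of the Kerr-like frame -/

lemma pderiv_one_eq {φ : ℝ → ℝ → ℝ} {φ' : ℝ} {x : Coord}
    (h : HasDerivAt (fun r => φ r (x 2)) φ' (x 1)) :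
    pderiv 1 (fun y => φ (y 1) (y 2)) x = φ' := h.deriv

lemma pderiv_two_eq {φ : ℝ → ℝ → ℝ} {φ' : ℝ} {x : Coord}
    (h : HasDerivAt (fun θ => φ (x 1) θ) φ' (x 2)) :
    pderiv 2 (fun y => φ (y 1) (y 2)) x = φ' := h.deriv

lemma pderiv_zero_eq (φ : ℝ → ℝ → ℝ) (x : Coord) :
    pderiv 0 (fun y => φ (y 1) (y 2)) x = 0 := deriv_const (x 0) (φ (x 1) (x 2))

lemma pderiv_three_eq (φ : ℝ → ℝ → ℝ) (x : Coord) :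
    pderiv 3 (fun y => φ (y 1) (y 2)) x = 0 := deriv_const (x 3) (φ (x 1) (x 2))

/-- The derivatives of the Kerr-like connection in the frame directions. -/
def kerrConnDeriv (p q r x y d e : ℝ) : Fin 4 → Fin 4 → Matrix (Fin 4) (Fin 4) ℝ :=
  ![fun _ => 0,
    connForm
      (p / q * (e / (p * q) - d ^ 2 / (p ^ 3 * q) - 2 * d * r / (p * q ^ 3) - p / q ^ 3
            + 3 * p * r ^ 2 / q ^ 5))
      (p / q * (-(3 * x * y * r) / q ^ 5))
      (p / q * (d * x / (p * q ^ 3) - 3 * p * x * r / q ^ 5))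
      (p / q * (d * r / (p * q ^ 3) + p / q ^ 3 - 3 * p * r ^ 2 / q ^ 5))
      (p / q * (-(x * r) / (y * q ^ 3) - 3 * x * y * r / q ^ 5))
      (p / q * (y / q ^ 3 - 3 * r ^ 2 * y / q ^ 5)),
    connForm
      (1 / q * (d * x * y / (p * q ^ 3) - 3 * p * r * x * y / q ^ 5))
      (1 / q * ((x ^ 2 - y ^ 2) / q ^ 3 + 3 * x ^ 2 * y ^ 2 / q ^ 5))
      (1 / q * (-(p * y) / q ^ 3 + 3 * p * x ^ 2 * y / q ^ 5))
      (1 / q * (3 * p * r * x * y / q ^ 5))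
      (1 / q * (-1 / q - x ^ 2 / (y ^ 2 * q) + x ^ 2 / q ^ 3 + (x ^ 2 - y ^ 2) / q ^ 3
            + 3 * x ^ 2 * y ^ 2 / q ^ 5))
      (1 / q * (r * x / q ^ 3 + 3 * r * x * y ^ 2 / q ^ 5)),
    fun _ => 0]

lemma smul_connForm (c α β δ ρ κ τ : ℝ) (C : Fin 4) :
    c • connForm α β δ ρ κ τ C = connForm (c * α) (c * β) (c * δ) (c * ρ) (c * κ) (c * τ) C := by
  ext i j
  fin_cases C <;> fin_cases i <;> fin_cases j <;> simp [connForm]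

/-! ### Partial derivatives of the connection coefficients -/

section

variable {a : ℝ} {M : ℝ → ℝ} {x : Coord}

lemma pderivMat_one_kerrConn (ha : a ≠ 0) (h : x ∈ frameDomain a M) (C : Fin 4) :
    pderivMat 1 (kerrConn a M C) x = (sqrtSigma a (x 1) (x 2) / sqrtDelta a M (x 1)) •
      kerrConnDeriv (sqrtDelta a M (x 1)) (sqrtSigma a (x 1) (x 2)) (x 1) (a * Real.cos (x 2))
        (a * Real.sin (x 2)) (halfDerivDelta M (x 1))
        (1 - 2 * deriv M (x 1) - x 1 * deriv (deriv M) (x 1)) 1 C := by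
  have hp := hasDerivAt_sqrtDelta h.1 h.2.1
  have hq := hasDerivAt_sqrtSigma_r h.2.2.2.2
  have hd := hasDerivAt_halfDerivDelta h.1
  have hp0 := (sqrtDelta_pos h.2.1).ne'
  have hq0 := (sqrtSigma_pos h.2.2.2.2).ne'
  have hy0 := mul_ne_zero ha (sin_pos_of_mem_frameDomain h).ne'
  have hr := hasDerivAt_id' (x 1)
  refine (pderivMat_connForm _ _ _ _ _ _ 1 C).trans ?_
  have hq3 := (hq.pow 3)
  have hX := hasDerivAt_const (x 1) (a * Real.cos (x 2))
  have hY := hasDerivAt_const (x 1) (a * Real.sin (x 2))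
  have h1 := pderiv_one_eq (φ := fun r θ => halfDerivDelta M r / (sqrtDelta a M r
    * sqrtSigma a r θ) - sqrtDelta a M r * r / sqrtSigma a r θ ^ 3)
    ((hd.div (hp.mul hq) (mul_ne_zero hp0 hq0)).sub ((hp.mul hr).div hq3 (pow_ne_zero 3 hq0)))
  have h2 := pderiv_one_eq (φ := fun r θ => a * Real.cos θ * (a * Real.sin θ) /
    sqrtSigma a r θ ^ 3) ((hX.mul hY).div hq3 (pow_ne_zero 3 hq0))
  have h3 := pderiv_one_eq (φ := fun r θ => sqrtDelta a M r * (a * Real.cos θ) /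
    sqrtSigma a r θ ^ 3) ((hp.mul hX).div hq3 (pow_ne_zero 3 hq0))
  have h4 := pderiv_one_eq (φ := fun r θ => sqrtDelta a M r * r /
    sqrtSigma a r θ ^ 3) ((hp.mul hr).div hq3 (pow_ne_zero 3 hq0))
  have h5 := pderiv_one_eq (φ := fun r θ => a * Real.cos θ / (a * Real.sin θ * sqrtSigma a r θ)
    + a * Real.cos θ * (a * Real.sin θ) / sqrtSigma a r θ ^ 3)
    ((hX.div (hY.mul hq) (mul_ne_zero hy0 hq0)).add ((hX.mul hY).div hq3 (pow_ne_zero 3 hq0)))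
  have h6 := pderiv_one_eq (φ := fun r θ => r * (a * Real.sin θ) /
    sqrtSigma a r θ ^ 3) ((hr.mul hY).div hq3 (pow_ne_zero 3 hq0))
  rw [h1, h2, h3, h4, h5, h6]
  simp only [kerrConnDeriv, Matrix.cons_val_one, Matrix.cons_val_zero, Pi.pow_apply, Pi.mul_apply]
  rw [smul_connForm]
  generalize a * Real.cos (x 2) = X at *
  generalize a * Real.sin (x 2) = Y at *
  generalize sqrtSigma a (x 1) (x 2) = q at *
  generalize sqrtDelta a M (x 1) = p at *
  congr 1 <;> field_simp <;> ring

lemma pderivMat_two_kerrConn (ha : a ≠ 0) (h : x ∈ frameDomain a M) (C : Fin 4) :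
    pderivMat 2 (kerrConn a M C) x = sqrtSigma a (x 1) (x 2) •
      kerrConnDeriv (sqrtDelta a M (x 1)) (sqrtSigma a (x 1) (x 2)) (x 1) (a * Real.cos (x 2))
        (a * Real.sin (x 2)) (halfDerivDelta M (x 1))
        (1 - 2 * deriv M (x 1) - x 1 * deriv (deriv M) (x 1)) 2 C := by
  have hp := hasDerivAt_const (x 2) (sqrtDelta a M (x 1))
  have hq := hasDerivAt_sqrtSigma_theta h.2.2.2.2
  have hd := hasDerivAt_const (x 2) (halfDerivDelta M (x 1))
  have hp0 := (sqrtDelta_pos h.2.1).ne'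
  have hq0 := (sqrtSigma_pos h.2.2.2.2).ne'
  have hy0 := mul_ne_zero ha (sin_pos_of_mem_frameDomain h).ne'
  have hr := hasDerivAt_const (x 2) (x 1)
  refine (pderivMat_connForm _ _ _ _ _ _ 2 C).trans ?_
  have hq3 := (hq.pow 3)
  have hX := (Real.hasDerivAt_cos (x 2)).const_mul a
  have hY := (Real.hasDerivAt_sin (x 2)).const_mul a
  rw [mul_neg] at hX
  have h1 := pderiv_two_eq (φ := fun r θ => halfDerivDelta M r / (sqrtDelta a M r
    * sqrtSigma a r θ) - sqrtDelta a M r * r / sqrtSigma a r θ ^ 3)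
    ((hd.div (hp.mul hq) (mul_ne_zero hp0 hq0)).sub ((hp.mul hr).div hq3 (pow_ne_zero 3 hq0)))
  have h2 := pderiv_two_eq (φ := fun r θ => a * Real.cos θ * (a * Real.sin θ) /
    sqrtSigma a r θ ^ 3) ((hX.mul hY).div hq3 (pow_ne_zero 3 hq0))
  have h3 := pderiv_two_eq (φ := fun r θ => sqrtDelta a M r * (a * Real.cos θ) /
    sqrtSigma a r θ ^ 3) ((hp.mul hX).div hq3 (pow_ne_zero 3 hq0))
  have h4 := pderiv_two_eq (φ := fun r θ => sqrtDelta a M r * r /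
    sqrtSigma a r θ ^ 3) ((hp.mul hr).div hq3 (pow_ne_zero 3 hq0))
  have h5 := pderiv_two_eq (φ := fun r θ => a * Real.cos θ / (a * Real.sin θ * sqrtSigma a r θ)
    + a * Real.cos θ * (a * Real.sin θ) / sqrtSigma a r θ ^ 3)
    ((hX.div (hY.mul hq) (mul_ne_zero hy0 hq0)).add ((hX.mul hY).div hq3 (pow_ne_zero 3 hq0)))
  have h6 := pderiv_two_eq (φ := fun r θ => r * (a * Real.sin θ) /
    sqrtSigma a r θ ^ 3) ((hr.mul hY).div hq3 (pow_ne_zero 3 hq0))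
  rw [h1, h2, h3, h4, h5, h6]
  simp only [kerrConnDeriv, Matrix.cons_val, Pi.pow_apply, Pi.mul_apply]
  rw [smul_connForm]
  generalize a * Real.cos (x 2) = X at *
  generalize a * Real.sin (x 2) = Y at *
  generalize sqrtSigma a (x 1) (x 2) = q at *
  generalize sqrtDelta a M (x 1) = p at *
  congr 1 <;> field_simp <;> ring

lemma pderivMat_zero_kerrConn (C : Fin 4) : pderivMat 0 (kerrConn a M C) x = 0 := by
  ext i j
  exact pderiv_zero_eq (fun r θ => kerrConnAt (sqrtDelta a M r) (sqrtSigma a r θ) r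
    (a * Real.cos θ) (a * Real.sin θ) (halfDerivDelta M r) C i j) x

lemma pderivMat_three_kerrConn (C : Fin 4) : pderivMat 3 (kerrConn a M C) x = 0 := by
  ext i j
  exact pderiv_three_eq (fun r θ => kerrConnAt (sqrtDelta a M r) (sqrtSigma a r θ) r
    (a * Real.cos θ) (a * Real.sin θ) (halfDerivDelta M r) C i j) x

lemma pderivMat_kerrConn (ha : a ≠ 0) (h : x ∈ frameDomain a M) (μ D : Fin 4) :
    pderivMat μ (kerrConn a M D) x = ∑ C, kerrCoframe a M x C μ •
      kerrConnDeriv (sqrtDelta a M (x 1)) (sqrtSigma a (x 1) (x 2)) (x 1) (a * Real.cos (x 2))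
        (a * Real.sin (x 2)) (halfDerivDelta M (x 1))
        (1 - 2 * deriv M (x 1) - x 1 * deriv (deriv M) (x 1)) C D := by
  have h0 : ∀ p q r x y d e, kerrConnDeriv p q r x y d e 0 D = 0 := fun _ _ _ _ _ _ _ => rfl
  have h3 : ∀ p q r x y d e, kerrConnDeriv p q r x y d e 3 D = 0 := fun _ _ _ _ _ _ _ => rfl
  rw [Fin.sum_univ_four, h0, h3, smul_zero, smul_zero, zero_add, add_zero]
  fin_cases μ
  · refine (pderivMat_zero_kerrConn D).trans ?_
    simp [kerrCoframe]
  · refine (pderivMat_one_kerrConn ha h D).trans ?_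
    simp [kerrCoframe]
  · refine (pderivMat_two_kerrConn ha h D).trans ?_
    simp [kerrCoframe]
  · refine (pderivMat_three_kerrConn D).trans ?_
    simp [kerrCoframe]

end

/-- The entries of the Kerr-like coframe. -/
def coframeForm (e₀₀ e₀₃ e₁₁ e₂₂ e₃₀ e₃₃ : ℝ) : Matrix (Fin 4) (Fin 4) ℝ :=
  !![e₀₀, 0, 0, e₀₃; 0, e₁₁, 0, 0; 0, 0, e₂₂, 0; e₃₀, 0, 0, e₃₃]

lemma pderivMat_coframeForm (e₀₀ e₀₃ e₁₁ e₂₂ e₃₀ e₃₃ : Coord → ℝ) (μ : Fin 4) (x : Coord) :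
    pderivMat μ (fun y => coframeForm (e₀₀ y) (e₀₃ y) (e₁₁ y) (e₂₂ y) (e₃₀ y) (e₃₃ y)) x =
      coframeForm (pderiv μ e₀₀ x) (pderiv μ e₀₃ x) (pderiv μ e₁₁ x) (pderiv μ e₂₂ x)
        (pderiv μ e₃₀ x) (pderiv μ e₃₃ x) := by
  ext i j
  fin_cases i <;> fin_cases j <;> simp [coframeForm, pderivMat, pderiv]

/-- The partial derivatives of the Kerr-like coframe. -/
def kerrCoframeDeriv (a p q r s c d : ℝ) : Fin 4 → Matrix (Fin 4) (Fin 4) ℝ :=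
  ![0,
    coframeForm (d / (p * q) - p * r / q ^ 3) (-(a * s ^ 2 * (d / (p * q) - p * r / q ^ 3)))
      (r / (q * p) - q * d / p ^ 3) (r / q) (-(a * s * r) / q ^ 3)
      (-(2 * r * s / q) + (r ^ 2 + a ^ 2) * s * r / q ^ 3),
    coframeForm (p * (a ^ 2 * s * c) / q ^ 3)
      (-(2 * a * s * c * p / q) - a * s ^ 2 * p * (a ^ 2 * s * c) / q ^ 3)
      (-(a ^ 2 * s * c) / (q * p)) (-(a ^ 2 * s * c) / q)
      (a * c / q + a * s * (a ^ 2 * s * c) / q ^ 3)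
      (-((r ^ 2 + a ^ 2) * (c / q + s * (a ^ 2 * s * c) / q ^ 3))),
    0]

/-! ### Partial derivatives of the coframe -/

section

variable {a : ℝ} {M : ℝ → ℝ} {x : Coord}

lemma pderivMat_one_kerrCoframe (h : x ∈ frameDomain a M) :
    pderivMat 1 (kerrCoframe a M) x = kerrCoframeDeriv a (sqrtDelta a M (x 1))
      (sqrtSigma a (x 1) (x 2)) (x 1) (Real.sin (x 2)) (Real.cos (x 2))
      (halfDerivDelta M (x 1)) 1 := by
  have hp := hasDerivAt_sqrtDelta h.1 h.2.1
  have hq := hasDerivAt_sqrtSigma_r h.2.2.2.2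
  have hp0 := (sqrtDelta_pos h.2.1).ne'
  have hq0 := (sqrtSigma_pos h.2.2.2.2).ne'
  have hr := ((hasDerivAt_id' (x 1)).pow 2).add_const (a ^ 2)
  refine (pderivMat_coframeForm _ _ _ _ _ _ 1 x).trans ?_
  have hS := hasDerivAt_const (x 1) (Real.sin (x 2))
  have h1 := pderiv_one_eq (φ := fun r θ => sqrtDelta a M r / sqrtSigma a r θ)
    (hp.div hq hq0)
  have h2 := pderiv_one_eq (φ := fun r θ => -(a * Real.sin θ ^ 2 *
    (sqrtDelta a M r / sqrtSigma a r θ))) (((hp.div hq hq0).const_mul (a * Real.sin (x 2) ^ 2)).neg)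
  have h3 := pderiv_one_eq (φ := fun r θ => sqrtSigma a r θ / sqrtDelta a M r) (hq.div hp hp0)
  have h4 := pderiv_one_eq (φ := fun r θ => sqrtSigma a r θ) hq
  have h5 := pderiv_one_eq (φ := fun r θ => a * Real.sin θ / sqrtSigma a r θ)
    ((hS.const_mul a).div hq hq0)
  have h6 := pderiv_one_eq (φ := fun r θ => -((r ^ 2 + a ^ 2) * Real.sin θ / sqrtSigma a r θ))
    ((hr.mul hS).div hq hq0).neg
  rw [h1, h2, h3, h4, h5, h6]
  simp only [kerrCoframeDeriv, Matrix.cons_val, Pi.pow_apply, Pi.mul_apply]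
  generalize sqrtSigma a (x 1) (x 2) = q at *
  generalize sqrtDelta a M (x 1) = p at *
  congr 1 <;> field_simp <;> ring

lemma pderivMat_two_kerrCoframe (h : x ∈ frameDomain a M) :
    pderivMat 2 (kerrCoframe a M) x = kerrCoframeDeriv a (sqrtDelta a M (x 1))
      (sqrtSigma a (x 1) (x 2)) (x 1) (Real.sin (x 2)) (Real.cos (x 2))
      (halfDerivDelta M (x 1)) 2 := by
  have hp := hasDerivAt_const (x 2) (sqrtDelta a M (x 1))
  have hq := hasDerivAt_sqrtSigma_theta h.2.2.2.2
  have hp0 := (sqrtDelta_pos h.2.1).ne'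
  have hq0 := (sqrtSigma_pos h.2.2.2.2).ne'
  refine (pderivMat_coframeForm _ _ _ _ _ _ 2 x).trans ?_
  have hS := Real.hasDerivAt_sin (x 2)
  have h1 := pderiv_two_eq (φ := fun r θ => sqrtDelta a M r / sqrtSigma a r θ)
    (hp.div hq hq0)
  have h2 := pderiv_two_eq (φ := fun r θ => -(a * Real.sin θ ^ 2 *
    (sqrtDelta a M r / sqrtSigma a r θ))) ((((hS.pow 2).const_mul a).mul (hp.div hq hq0)).neg)
  have h3 := pderiv_two_eq (φ := fun r θ => sqrtSigma a r θ / sqrtDelta a M r) (hq.div hp hp0)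
  have h4 := pderiv_two_eq (φ := fun r θ => sqrtSigma a r θ) hq
  have h5 := pderiv_two_eq (φ := fun r θ => a * Real.sin θ / sqrtSigma a r θ)
    ((hS.const_mul a).div hq hq0)
  have h6 := pderiv_two_eq (φ := fun r θ => -((r ^ 2 + a ^ 2) * Real.sin θ / sqrtSigma a r θ))
    ((hS.const_mul ((x 1) ^ 2 + a ^ 2)).div hq hq0).neg
  rw [h1, h2, h3, h4, h5, h6]
  simp only [kerrCoframeDeriv, Matrix.cons_val, Pi.pow_apply, Pi.div_apply, Nat.cast_ofNat]
  generalize sqrtSigma a (x 1) (x 2) = q at *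
  generalize sqrtDelta a M (x 1) = p at *
  congr 1 <;> field_simp <;> ring

lemma pderivMat_kerrCoframe (h : x ∈ frameDomain a M) (μ : Fin 4) :
    pderivMat μ (kerrCoframe a M) x = kerrCoframeDeriv a (sqrtDelta a M (x 1))
      (sqrtSigma a (x 1) (x 2)) (x 1) (Real.sin (x 2)) (Real.cos (x 2))
      (halfDerivDelta M (x 1)) μ := by
  fin_cases μ
  · ext i j
    exact pderiv_zero_eq (fun r θ => coframeForm (sqrtDelta a M r / sqrtSigma a r θ)
      (-(a * Real.sin θ ^ 2 * (sqrtDelta a M r / sqrtSigma a r θ)))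
      (sqrtSigma a r θ / sqrtDelta a M r) (sqrtSigma a r θ) (a * Real.sin θ / sqrtSigma a r θ)
      (-((r ^ 2 + a ^ 2) * Real.sin θ / sqrtSigma a r θ)) i j) x
  · exact pderivMat_one_kerrCoframe h
  · exact pderivMat_two_kerrCoframe h
  · ext i j
    exact pderiv_three_eq (fun r θ => coframeForm (sqrtDelta a M r / sqrtSigma a r θ)
      (-(a * Real.sin θ ^ 2 * (sqrtDelta a M r / sqrtSigma a r θ)))
      (sqrtSigma a r θ / sqrtDelta a M r) (sqrtSigma a r θ) (a * Real.sin θ / sqrtSigma a r θ)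
      (-((r ^ 2 + a ^ 2) * Real.sin θ / sqrtSigma a r θ)) i j) x

end

/-- The first structure equation, reduced to polynomial identities modulo `Σ = r² + a² cos² θ` and
`sin² θ = 1 - cos² θ`. -/
lemma kerr_torsion {a p q r s c d : ℝ} (ha : a ≠ 0) (hp : p ≠ 0) (hq : q ≠ 0) (hs : s ≠ 0)
    (hq2 : q ^ 2 = r ^ 2 + (a * c) ^ 2) (hsc : s ^ 2 = 1 - c ^ 2)
    {E : Matrix (Fin 4) (Fin 4) ℝ} (hE : E = coframeForm (p / q) (-(a * s ^ 2 * (p / q))) (q / p) q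
      (a * s / q) (-((r ^ 2 + a ^ 2) * s / q))) (μ ν A : Fin 4) (hμν : μ < ν) :
    (kerrCoframeDeriv a p q r s c d μ
      + (∑ C, E C μ • kerrConnAt p q r (a * c) (a * s) d C) * E) A ν =
    (kerrCoframeDeriv a p q r s c d ν
      + (∑ C, E C ν • kerrConnAt p q r (a * c) (a * s) d C) * E) A μ := by
  subst hE
  simp only [kerrCoframeDeriv, kerrConnAt, coframeForm, connForm, Fin.sum_univ_four]
  fin_cases μ <;> fin_cases ν <;> (first | exact absurd hμν (by decide) | skip) <;>
    fin_cases A <;> simp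
  all_goals try field_simp
  all_goals try (ring_nf; done)
  all_goals (simp only [hq2, hsc]; ring_nf)

lemma kerrCoframe_mul_kerrFrame {a : ℝ} {M : ℝ → ℝ} {x : Coord} (h : x ∈ frameDomain a M) :
    kerrCoframe a M x * kerrFrame a M x = 1 := by
  have hp0 := (sqrtDelta_pos h.2.1).ne'
  have hq0 := (sqrtSigma_pos h.2.2.2.2).ne'
  have hs0 := (sin_pos_of_mem_frameDomain h).ne'
  have hq2 := sqrtSigma_sq h.2.2.2.2
  have hsc := Real.sin_sq (x 2)
  simp only [kerrCoframe, kerrFrame]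
  generalize sqrtSigma a (x 1) (x 2) = q at *
  generalize sqrtDelta a M (x 1) = p at *
  generalize Real.sin (x 2) = s at *
  generalize Real.cos (x 2) = c at *
  ext i j
  fin_cases i <;> fin_cases j <;> simp [Matrix.mul_apply, Fin.sum_univ_four]
  all_goals try field_simp
  all_goals try (ring_nf; done)
  all_goals (simp only [hq2, hsc]; ring_nf)

lemma metric_eq_kerrCoframe {a : ℝ} {M : ℝ → ℝ} {x : Coord} (h : x ∈ frameDomain a M) :
    metric a M x = (kerrCoframe a M x).transpose * minkowski * kerrCoframe a M x := by
  have hp0 := (sqrtDelta_pos h.2.1).ne'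
  have hq0 := (sqrtSigma_pos h.2.2.2.2).ne'
  have hq2 : sigma a (x 1) (x 2) = sqrtSigma a (x 1) (x 2) ^ 2 := (Real.sq_sqrt h.2.2.2.2.le).symm
  have hp2 : delta a M (x 1) = sqrtDelta a M (x 1) ^ 2 := (Real.sq_sqrt h.2.1.le).symm
  simp only [kerrCoframe, metric, minkowski, hq2, hp2]
  generalize sqrtSigma a (x 1) (x 2) = q at *
  generalize sqrtDelta a M (x 1) = p at *
  ext i j
  fin_cases i <;> fin_cases j <;>
    simp [Matrix.mul_apply, Fin.sum_univ_four, Matrix.diagonal_apply, formT, formPhi, formR,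
      formTheta]
  all_goals field_simp
  all_goals ring

lemma connForm_skew (α β δ ρ κ τ : ℝ) (C : Fin 4) :
    (connForm α β δ ρ κ τ C).transpose * minkowski + minkowski * connForm α β δ ρ κ τ C = 0 := by
  ext i j
  rw [minkowski, Matrix.add_apply, Matrix.mul_diagonal, Matrix.diagonal_mul, Matrix.transpose_apply]
  fin_cases C <;> fin_cases i <;> fin_cases j <;> simp [connForm]

/-- Identifies the explicit `kerrConn` as the Levi-Civita connection in the coframe, so that the
general curvature formula applies to it. -/
lemma isMovingFrame_kerr {a : ℝ} (ha : a ≠ 0) (M : ℝ → ℝ) :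
    IsMovingFrame (frameDomain a M) (metric a M) minkowski (kerrCoframe a M) (kerrFrame a M)
      (kerrConn a M) where
  isOpen := isOpen_frameDomain a M
  eta_mul_eta := by
    rw [minkowski, Matrix.diagonal_mul_diagonal, ← Matrix.diagonal_one]
    congr 1
    ext i
    fin_cases i <;> simp
  eta_symm := Matrix.diagonal_transpose _
  metric_eq _ h := metric_eq_kerrCoframe h
  mul_dual _ h := kerrCoframe_mul_kerrFrame h
  contDiff _ h := contDiffAt_kerrCoframe h
  diff_dual _ h := entryDiff_kerrFrame h
  diff_conn _ h := entryDiff_kerrConn ha h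
  skew _ _ := connForm_skew _ _ _ _ _ _
  torsion y h := by
    have key : ∀ μ ν A, μ < ν → (pderivMat μ (kerrCoframe a M) y
        + connMat (kerrCoframe a M) (kerrConn a M) μ y * kerrCoframe a M y) A ν =
        (pderivMat ν (kerrCoframe a M) y
        + connMat (kerrCoframe a M) (kerrConn a M) ν y * kerrCoframe a M y) A μ := by
      intro μ ν A hμν
      rw [pderivMat_kerrCoframe h, pderivMat_kerrCoframe h]
      exact kerr_torsion ha (sqrtDelta_pos h.2.1).ne' (sqrtSigma_pos h.2.2.2.2).ne'
        (sin_pos_of_mem_frameDomain h).ne' (sqrtSigma_sq h.2.2.2.2) (Real.sin_sq _) rfl μ ν A hμν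
    intro μ ν A
    rcases lt_trichotomy μ ν with hμν | rfl | hμν
    · exact key μ ν A hμν
    · rfl
    · exact (key ν μ A hμν).symm

/-- The components of the Riemann tensor of the Kerr-like metric in its orthonormal frame. -/
def kerrCurv (a : ℝ) (M : ℝ → ℝ) (x : Coord) : Fin 4 → Fin 4 → Fin 4 → Fin 4 → ℝ :=
  let r := x 1
  let c := a * Real.cos (x 2)
  let q := sigma a (x 1) (x 2)
  let m := r * M r
  let m' := M r + r * deriv M r
  let m'' := 2 * deriv M r + r * deriv (deriv M) r
  curvForm (-m'' / q + 4 * r * m' / q ^ 2 - 2 * m * (3 * r ^ 2 - c ^ 2) / q ^ 3)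
    (2 * m * (r ^ 2 - 3 * c ^ 2) / q ^ 3)
    (-(r * m') / q ^ 2 + 2 * m * (r ^ 2 - c ^ 2) / q ^ 3)
    (m' * c / q ^ 2 - 4 * m * r * c / q ^ 3)

/-- The curvature of the Kerr-like metric, as matrices, in terms of its frame components. -/
lemma kerr_mul_riemannMat {a : ℝ} (ha : a ≠ 0) {M : ℝ → ℝ} {x : Coord} (h : x ∈ frameDomain a M)
    (μ ν : Fin 4) :
    minkowski * (kerrCoframe a M x * riemannMat (metric a M) x μ ν) =
      (∑ C, ∑ D, (kerrCoframe a M x C μ * kerrCoframe a M x D ν) •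
        Matrix.of fun A B => kerrCurv a M x A B C D) * kerrCoframe a M x := by
  have hp0 := (sqrtDelta_pos h.2.1).ne'
  have hq0 := (sqrtSigma_pos h.2.2.2.2).ne'
  have hs0 := (sin_pos_of_mem_frameDomain h).ne'
  have hq2 : sqrtSigma a (x 1) (x 2) ^ 2 = sigma a (x 1) (x 2) := Real.sq_sqrt h.2.2.2.2.le
  have hq4 : sqrtSigma a (x 1) (x 2) ^ 4 = sigma a (x 1) (x 2) ^ 2 := by rw [← hq2]; ring
  have hq6 : sqrtSigma a (x 1) (x 2) ^ 6 = sigma a (x 1) (x 2) ^ 3 := by rw [← hq2]; ring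
  have hp2 := sqrtDelta_sq h.2.1
  have hR := isCurvatureOf (e := 1 - 2 * deriv M (x 1) - x 1 * deriv (deriv M) (x 1))
    (d := halfDerivDelta M (x 1)) hp0 hq0 (mul_ne_zero ha hs0) (sqrtSigma_sq h.2.2.2.2)
  rw [(isMovingFrame_kerr ha M).mul_riemannMat_eq_frameCurv h (pderivMat_kerrConn ha h),
    ← Matrix.mul_assoc, Matrix.mul_sum]
  congr 1
  refine Finset.sum_congr rfl fun C _ => ?_
  rw [Matrix.mul_sum]
  refine Finset.sum_congr rfl fun D _ => ?_
  rw [Matrix.mul_smul]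
  congr 1
  ext A B
  refine (hR.minkowski_mul_frameCurv A B C D).trans ?_
  rw [Matrix.of_apply, kerrCurv, hq2, hq4, hq6, hp2, halfDerivDelta]
  -- The combination left by `isCurvatureOf` is twice `r M`: the terms in `a²` cancel by `sin² +
  -- cos² = 1`.
  have hsc : x 1 ^ 2 + (a * Real.cos (x 2)) ^ 2 + (a * Real.sin (x 2)) ^ 2 -
      (x 1 ^ 2 - 2 * M (x 1) * x 1 + a ^ 2) = 2 * (x 1 * M (x 1)) := by
    rw [mul_pow a (Real.sin _), Real.sin_sq]; ring
  rw [hsc]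
  congr 1 <;> ring

/-- The Riemann tensor of the Kerr-like metric in terms of its frame components. -/
theorem riemann_metric {a : ℝ} (ha : a ≠ 0) {M : ℝ → ℝ} {x : Coord} (h : x ∈ frameDomain a M)
    (i j k l : Fin 4) :
    riemann (metric a M) x i j k l = ∑ A, ∑ B, ∑ C, ∑ D,
      kerrCoframe a M x A i * kerrCoframe a M x B j * kerrCoframe a M x C k *
        kerrCoframe a M x D l * kerrCurv a M x A B C D := by
  have h1 : riemann (metric a M) x i j k l = (metric a M x * riemannMat (metric a M) x k l) i j := by
    rw [riemann, Matrix.mul_apply]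
    rfl
  rw [h1, metric_eq_kerrCoframe h, Matrix.mul_assoc, Matrix.mul_assoc, kerr_mul_riemannMat ha h,
    Matrix.mul_apply]
  refine Finset.sum_congr rfl fun A _ => ?_
  rw [Matrix.mul_apply, Finset.mul_sum]
  refine Finset.sum_congr rfl fun B _ => ?_
  rw [Matrix.sum_apply, Finset.sum_mul, Finset.mul_sum]
  refine Finset.sum_congr rfl fun C _ => ?_
  rw [Matrix.sum_apply, Finset.sum_mul, Finset.mul_sum]
  refine Finset.sum_congr rfl fun D _ => ?_
  simp only [Matrix.transpose_apply, Matrix.smul_apply, Matrix.of_apply, smul_eq_mul]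
  ring

/-! ### Tensors in a frame -/

/-- The tensor power of a matrix, indexed by multi-indices. -/
def tensorPow {ι : Type*} [Fintype ι] (E : Matrix (Fin 4) (Fin 4) ℝ) (J j : ι → Fin 4) : ℝ :=
  ∏ l, E (J l) (j l)

/-- Tensor powers are functorial: a product over slots of sums over one index expands into a sum
over multi-indices. -/
lemma sum_tensorPow_mul {ι : Type*} [Fintype ι] [DecidableEq ι] (E F : Matrix (Fin 4) (Fin 4) ℝ)
    (J K : ι → Fin 4) : ∑ j, tensorPow E J j * tensorPow F j K = tensorPow (E * F) J K := by
  simp only [tensorPow, Matrix.mul_apply, ← Finset.prod_mul_distrib]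
  rw [Finset.prod_univ_sum, Fintype.piFinset_univ]

lemma tensorPow_one {ι : Type*} [Fintype ι] [DecidableEq ι] (J K : ι → Fin 4) :
    tensorPow 1 J K = if J = K then 1 else 0 := by
  simp only [tensorPow, Matrix.one_apply]
  rw [Finset.prod_ite_zero]
  simp [funext_iff]

lemma tensorPow_transpose {ι : Type*} [Fintype ι] (E : Matrix (Fin 4) (Fin 4) ℝ)
    (J j : ι → Fin 4) : tensorPow E.transpose J j = tensorPow E j J := rfl

lemma tensorPow_diagonal {ι : Type*} [Fintype ι] [DecidableEq ι] (e : Fin 4 → ℝ)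
    (J K : ι → Fin 4) :
    tensorPow (Matrix.diagonal e) J K = if J = K then ∏ l, e (J l) else 0 := by
  simp only [tensorPow, Matrix.diagonal_apply]
  rw [Finset.prod_ite_zero]
  simp [funext_iff]

section Pull

variable {V : Type*} [AddCommGroup V] [Module ℝ V] {𝕜 : Type*} [CommRing 𝕜] [Algebra ℝ 𝕜]
  {ι κ P : Type*} [Fintype ι] [DecidableEq ι] [Fintype κ] [DecidableEq κ] [Fintype P]
  [DecidableEq P] {E F : Matrix (Fin 4) (Fin 4) ℝ}

/-- The tensor `T` has the components `Tf` in the frame whose dual coframe is `E`. -/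
def IsPull (E : Matrix (Fin 4) (Fin 4) ℝ) (T Tf : (ι → Fin 4) → V) : Prop :=
  ∀ j, T j = ∑ J, tensorPow E J j • Tf J

lemma IsPull.add {T Tf S Sf : (ι → Fin 4) → V} (hT : IsPull E T Tf) (hS : IsPull E S Sf) :
    IsPull E (fun j => T j + S j) (fun j => Tf j + Sf j) := fun j => by
  simp only [hT j, hS j, smul_add, Finset.sum_add_distrib]

lemma IsPull.sub {T Tf S Sf : (ι → Fin 4) → V} (hT : IsPull E T Tf) (hS : IsPull E S Sf) :
    IsPull E (fun j => T j - S j) (fun j => Tf j - Sf j) := fun j => by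
  simp only [hT j, hS j, smul_sub, Finset.sum_sub_distrib]

lemma IsPull.const_mul {T Tf : (ι → Fin 4) → 𝕜} (c : 𝕜) (hT : IsPull E T Tf) :
    IsPull E (fun j => c * T j) (fun j => c * Tf j) := fun j => by
  simp only [hT j, Finset.mul_sum, mul_smul_comm]

lemma IsPull.map {W : Type*} [AddCommGroup W] [Module ℝ W] (f : V →ₗ[ℝ] W)
    {T Tf : (ι → Fin 4) → V} (hT : IsPull E T Tf) :
    IsPull E (fun j => f (T j)) (fun j => f (Tf j)) := fun j => by
  simp only [hT j, map_sum, map_smul]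

/-- Tensor products of pulled-back tensors are pulled back, with `e` saying which slot of which
factor each index fills. It serves both for the Riemann and volume factors of a contraction scheme
and, with `e` the pairing, for its inverse metrics. -/
lemma IsPull.prod {X Xf : P → (ι → Fin 4) → 𝕜} (hX : ∀ p, IsPull E (X p) (Xf p))
    (e : P × ι ≃ κ) :
    IsPull E (fun j : κ → Fin 4 => ∏ p, X p (fun i => j (e (p, i))))
      (fun j => ∏ p, Xf p (fun i => j (e (p, i)))) := by
  intro j
  simp only [hX _ _]
  rw [Finset.prod_univ_sum, Fintype.piFinset_univ]
  refine Fintype.sum_equiv ((Equiv.curry P ι (Fin 4)).symm.trans (e.arrowCongr (Equiv.refl _)))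
    _ _ fun J => ?_
  have h1 : ∀ p i, ((Equiv.curry P ι (Fin 4)).symm.trans (e.arrowCongr (Equiv.refl _))) J
      (e (p, i)) = J p i := fun p i => by simp [Equiv.arrowCongr, Function.uncurry]
  simp only [h1, tensorPow]
  rw [← Equiv.prod_comp e, Fintype.prod_prod_type]
  simp only [h1, Algebra.smul_def, Finset.prod_mul_distrib, map_prod]

/-- Frame independence of complete contractions: `E` on the covariant tensor meets its dual `F` on
the contravariant one in every slot. -/
lemma IsPull.sum_mul (hEF : E * F = 1) {S Sf U Uf : (ι → Fin 4) → 𝕜} (hS : IsPull E S Sf)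
    (hU : IsPull F.transpose U Uf) : ∑ j, S j * U j = ∑ J, Sf J * Uf J := by
  have h1 : ∀ J K : ι → Fin 4, ∑ j, tensorPow E J j * tensorPow F.transpose K j =
      if J = K then 1 else 0 := fun J K => by
    simp only [tensorPow_transpose, sum_tensorPow_mul, hEF, tensorPow_one]
  calc ∑ j, S j * U j
      = ∑ j, ∑ J, ∑ K, (tensorPow E J j * tensorPow F.transpose K j) • (Sf J * Uf K) := by
        refine Finset.sum_congr rfl fun j _ => ?_
        rw [hS j, hU j, Finset.sum_mul_sum]
        simp only [smul_mul_smul_comm]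
    _ = ∑ J, ∑ K, (∑ j, tensorPow E J j * tensorPow F.transpose K j) • (Sf J * Uf K) := by
        rw [Finset.sum_comm]
        refine Finset.sum_congr rfl fun J _ => ?_
        rw [Finset.sum_comm]
        simp only [Finset.sum_smul]
    _ = ∑ J, Sf J * Uf J := by
        simp only [h1, ite_smul, one_smul, zero_smul, Finset.sum_ite_eq, Finset.mem_univ, if_true]

/-- With `G` the inverse metric, raising all indices amounts in the frame to multiplying by one sign
`e` per index, since `G Eᵀ = F diag(e)`. -/
lemma IsPull.raise (hEF : E * F = 1) {e : Fin 4 → ℝ} {G : Matrix (Fin 4) (Fin 4) ℝ}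
    (hG : G = F * Matrix.diagonal e * F.transpose) {T Tf : (ι → Fin 4) → V}
    (hT : IsPull E T Tf) :
    IsPull F.transpose (fun j => ∑ j', tensorPow G j j' • T j')
      (fun J => (∏ l, e (J l)) • Tf J) := by
  intro j
  have h1 : ∀ J, ∑ j', tensorPow G j j' * tensorPow E J j' =
      tensorPow F j J * ∏ l, e (J l) := by
    intro J
    have h2 : G * E.transpose = F * Matrix.diagonal e := by
      rw [hG, Matrix.mul_assoc, ← Matrix.transpose_mul, hEF, Matrix.transpose_one, Matrix.mul_one]
    have h3 : ∑ j', tensorPow G j j' * tensorPow E J j' =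
        ∑ j', tensorPow G j j' * tensorPow E.transpose j' J := rfl
    rw [h3, sum_tensorPow_mul, h2, ← sum_tensorPow_mul]
    simp only [tensorPow_diagonal, mul_ite, mul_zero, Finset.sum_ite_eq', Finset.mem_univ, if_true]
  calc ∑ j', tensorPow G j j' • T j'
      = ∑ j', ∑ J, (tensorPow G j j' * tensorPow E J j') • Tf J := by
        refine Finset.sum_congr rfl fun j' _ => ?_
        rw [hT j', Finset.smul_sum]
        simp only [smul_smul]
    _ = ∑ J, (∑ j', tensorPow G j j' * tensorPow E J j') • Tf J := by
        rw [Finset.sum_comm]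
        simp only [Finset.sum_smul]
    _ = _ := by
        simp only [h1, mul_smul]
        rfl

end Pull

/-! ### Multi-indices of length two and four -/

lemma sum_multiIndex_two {V : Type*} [AddCommMonoid V] (f : (Fin 2 → Fin 4) → V) :
    ∑ j, f j = ∑ a, ∑ b, f ![a, b] := by
  rw [← (finTwoArrowEquiv (Fin 4)).symm.sum_comp, Fintype.sum_prod_type]
  rfl

/-- Multi-indices of length four are quadruples. -/
def multiIndexFourEquiv : (Fin 4 × Fin 4 × Fin 4 × Fin 4) ≃ (Fin 4 → Fin 4) where
  toFun q := ![q.1, q.2.1, q.2.2.1, q.2.2.2]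
  invFun j := (j 0, j 1, j 2, j 3)
  left_inv _ := rfl
  right_inv j := by
    funext i
    fin_cases i <;> rfl

lemma sum_multiIndex_four {V : Type*} [AddCommMonoid V] (f : (Fin 4 → Fin 4) → V) :
    ∑ j, f j = ∑ a, ∑ b, ∑ c, ∑ d, f ![a, b, c, d] := by
  rw [← multiIndexFourEquiv.sum_comp, Fintype.sum_prod_type]
  simp only [Fintype.sum_prod_type]
  rfl

/-- A rank two tensor as a function of a multi-index. -/
def uncurry₂ {V : Type*} (T : Fin 4 → Fin 4 → V) (j : Fin 2 → Fin 4) : V := T (j 0) (j 1)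

/-- A rank four tensor as a function of a multi-index. -/
def uncurry₄ {V : Type*} (T : Fin 4 → Fin 4 → Fin 4 → Fin 4 → V) (j : Fin 4 → Fin 4) : V :=
  T (j 0) (j 1) (j 2) (j 3)

lemma isPull_uncurry₂_iff {V : Type*} [AddCommGroup V] [Module ℝ V]
    {E : Matrix (Fin 4) (Fin 4) ℝ} {T Tf : Fin 4 → Fin 4 → V} :
    IsPull E (uncurry₂ T) (uncurry₂ Tf) ↔
      ∀ a b, T a b = ∑ A, ∑ B, (E A a * E B b) • Tf A B := by
  constructor
  · intro h a b
    have := h ![a, b]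
    rw [sum_multiIndex_two] at this
    simpa [uncurry₂, tensorPow, Fin.prod_univ_two] using this
  · intro h j
    rw [sum_multiIndex_two]
    simpa [uncurry₂, tensorPow, Fin.prod_univ_two] using h (j 0) (j 1)

lemma isPull_uncurry₄_iff {V : Type*} [AddCommGroup V] [Module ℝ V]
    {E : Matrix (Fin 4) (Fin 4) ℝ} {T Tf : Fin 4 → Fin 4 → Fin 4 → Fin 4 → V} :
    IsPull E (uncurry₄ T) (uncurry₄ Tf) ↔ ∀ a b c d, T a b c d =
      ∑ A, ∑ B, ∑ C, ∑ D, (E A a * E B b * E C c * E D d) • Tf A B C D := by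
  constructor
  · intro h a b c d
    have := h ![a, b, c, d]
    rw [sum_multiIndex_four] at this
    simpa [uncurry₄, tensorPow, Fin.prod_univ_four] using this
  · intro h j
    rw [sum_multiIndex_four]
    simpa [uncurry₄, tensorPow, Fin.prod_univ_four] using h (j 0) (j 1) (j 2) (j 3)

/-- The product of two rank two tensors, with its indices distributed by `e`. -/
lemma IsPull.mul {𝕜 : Type*} [CommRing 𝕜] [Algebra ℝ 𝕜] {E : Matrix (Fin 4) (Fin 4) ℝ}
    {X Xf Y Yf : Fin 4 → Fin 4 → 𝕜} (hX : IsPull E (uncurry₂ X) (uncurry₂ Xf))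
    (hY : IsPull E (uncurry₂ Y) (uncurry₂ Yf)) (e : Fin 2 × Fin 2 ≃ Fin 4) :
    IsPull E (fun j => X (j (e (0, 0))) (j (e (0, 1))) * Y (j (e (1, 0))) (j (e (1, 1))))
      (fun j => Xf (j (e (0, 0))) (j (e (0, 1))) * Yf (j (e (1, 0))) (j (e (1, 1)))) := by
  have h := IsPull.prod (X := ![uncurry₂ X, uncurry₂ Y]) (Xf := ![uncurry₂ Xf, uncurry₂ Yf])
    (E := E) (fun p => by fin_cases p <;> assumption) e
  simp only [Fin.prod_univ_two] at h
  exact h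

/-! ### Curvature invariants in an orthonormal frame -/

/-- The components of a rank four tensor. -/
abbrev Tensor₄ : Type := Fin 4 → Fin 4 → Fin 4 → Fin 4 → ℝ

/-- The signs of the Minkowski metric. -/
def mink (A : Fin 4) : ℝ := (![-1, 1, 1, 1] : Fin 4 → ℝ) A

lemma minkowski_eq : minkowski = Matrix.diagonal mink := rfl

/-- The Ricci tensor in an orthonormal frame. -/
def frameRicci (R : Tensor₄) (B D : Fin 4) : ℝ := ∑ A, mink A * R A B A D

/-- The curvature scalar in an orthonormal frame. -/
def frameScalar (R : Tensor₄) : ℝ := ∑ A, mink A * frameRicci R A A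

/-- The Weyl tensor in an orthonormal frame. -/
def frameWeyl (R : Tensor₄) (A B C D : Fin 4) : ℝ :=
  R A B C D
    - (1 / 2) * (minkowski A C * frameRicci R B D - minkowski A D * frameRicci R B C
      - minkowski B C * frameRicci R A D + minkowski B D * frameRicci R A C)
    + frameScalar R / 6 * (minkowski A C * minkowski B D - minkowski A D * minkowski B C)

/-- The trace-free Ricci tensor in an orthonormal frame. -/
def frameTfRicci (R : Tensor₄) (A B : Fin 4) : ℝ :=
  frameRicci R A B - frameScalar R / 4 * minkowski A B

/-- The dual Weyl tensor in an orthonormal frame of orientation `o`. -/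
def frameWeylDual (o : ℝ) (R : Tensor₄) (A B C D : Fin 4) : ℝ :=
  (1 / 2) * ∑ M, ∑ N, o * altSymbol A B M N * (mink M * mink N * frameWeyl R M N C D)

/-- The tensor `(C + i *C) / 2` in an orthonormal frame of orientation `o`. -/
def frameWeylBar (o : ℝ) (R : Tensor₄) (A B C D : Fin 4) : ℂ :=
  ((frameWeyl R A B C D : ℂ) + Complex.I * (frameWeylDual o R A B C D : ℂ)) / 2

/-- At the point `x`, the metric `g` is Minkowskian in the coframe `E` with dual frame `F`, and its
Riemann tensor has the components `R` in it. -/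
structure HasFrame (g : MetricField) (x : Coord) (E F : Matrix (Fin 4) (Fin 4) ℝ)
    (R : Tensor₄) : Prop where
  metric_eq : g x = E.transpose * minkowski * E
  mul_dual : E * F = 1
  riemann_eq : IsPull E (uncurry₄ (riemann g x)) (uncurry₄ R)

namespace HasFrame

variable {g : MetricField} {x : Coord} {E F : Matrix (Fin 4) (Fin 4) ℝ} {R : Tensor₄}

lemma inv_eq (h : HasFrame g x E F R) : (g x)⁻¹ = F * Matrix.diagonal mink * F.transpose := by
  have hη : minkowski * minkowski = 1 := by
    rw [minkowski, Matrix.diagonal_mul_diagonal, ← Matrix.diagonal_one]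
    congr 1
    ext i
    fin_cases i <;> simp
  have h2 : F.transpose * E.transpose = 1 := by
    rw [← Matrix.transpose_mul, h.mul_dual, Matrix.transpose_one]
  refine Matrix.inv_eq_left_inv ?_
  rw [h.metric_eq, ← minkowski_eq]
  calc F * minkowski * F.transpose * (E.transpose * minkowski * E)
      = F * minkowski * (F.transpose * E.transpose) * minkowski * E := by noncomm_ring
    _ = F * (minkowski * minkowski) * E := by rw [h2]; noncomm_ring
    _ = 1 := by rw [hη, mul_one, mul_eq_one_comm.mp h.mul_dual]

lemma isUnit_det (h : HasFrame g x E F R) : IsUnit (g x).det := by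
  have h1 : E.det * F.det = 1 := by rw [← Matrix.det_mul, h.mul_dual, Matrix.det_one]
  have h2 : IsUnit E.det := IsUnit.of_mul_eq_one _ h1
  have h3 : minkowski.det = -1 := by
    simp [minkowski, Matrix.det_diagonal, Fin.prod_univ_four]
  rw [h.metric_eq, Matrix.det_mul, Matrix.det_mul, Matrix.det_transpose, h3]
  exact (h2.mul (by simp)).mul h2

/-- Contravariant tensors are expressed as pulled back along `F.transpose`, so that one predicate
covers both variances. -/
lemma inv_isPull (h : HasFrame g x E F R) : IsPull F.transpose (uncurry₂ fun a b => (g x)⁻¹ a b)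
    (uncurry₂ fun A B => minkowski A B) := by
  rw [isPull_uncurry₂_iff, minkowski_eq]
  intro a b
  rw [h.inv_eq, Matrix.mul_apply]
  simp only [Matrix.mul_apply, Finset.sum_mul, Matrix.transpose_apply, smul_eq_mul]
  rw [Finset.sum_comm]
  exact Finset.sum_congr rfl fun _ _ => Finset.sum_congr rfl fun _ _ => by ring

/-- The trace of a pulled back rank two tensor. -/
lemma sum_inv_mul (h : HasFrame g x E F R) {T Tf : Fin 4 → Fin 4 → ℝ}
    (hT : IsPull E (uncurry₂ T) (uncurry₂ Tf)) :
    ∑ a, ∑ b, (g x)⁻¹ a b * T a b = ∑ A, mink A * Tf A A := by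
  have hG := h.inv_isPull
  have := hT.sum_mul h.mul_dual hG
  simp only [sum_multiIndex_two] at this
  calc ∑ a, ∑ b, (g x)⁻¹ a b * T a b = ∑ a, ∑ b, T a b * (g x)⁻¹ a b := by simp only [mul_comm]
    _ = ∑ A, ∑ B, Tf A B * Matrix.diagonal mink A B := this
    _ = ∑ A, mink A * Tf A A := by
      refine Finset.sum_congr rfl fun A _ => ?_
      rw [Finset.sum_eq_single A]
      · rw [Matrix.diagonal_apply_eq, mul_comm]
      · intro B _ hB
        rw [Matrix.diagonal_apply_ne _ hB.symm, mul_zero]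
      · simp

lemma metric_isPull (h : HasFrame g x E F R) :
    IsPull E (uncurry₂ fun a b => g x a b) (uncurry₂ fun A B => minkowski A B) := by
  rw [isPull_uncurry₂_iff]
  intro a b
  rw [h.metric_eq]
  simp only [Matrix.mul_apply, Finset.sum_mul, Matrix.transpose_apply, smul_eq_mul]
  rw [Finset.sum_comm]
  exact Finset.sum_congr rfl fun _ _ => Finset.sum_congr rfl fun _ _ => by ring

lemma ricci_eq_sum (h : HasFrame g x E F R) (b d : Fin 4) :
    ricci g x b d = ∑ a, ∑ e, (g x)⁻¹ a e * riemann g x e b a d := by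
  have h1 : ∀ a, riemannUp g x a b a d = ∑ e, (g x)⁻¹ a e * riemann g x e b a d := by
    intro a
    simp only [riemann, Finset.mul_sum]
    rw [Finset.sum_comm]
    simp only [← mul_assoc, ← Finset.sum_mul, ← Matrix.mul_apply]
    rw [Matrix.nonsing_inv_mul _ h.isUnit_det]
    simp [Matrix.one_apply]
  exact Finset.sum_congr rfl fun a _ => h1 a

lemma ricci_isPull (h : HasFrame g x E F R) :
    IsPull E (uncurry₂ (ricci g x)) (uncurry₂ (frameRicci R)) := by
  rw [isPull_uncurry₂_iff]
  intro b d
  rw [h.ricci_eq_sum, Finset.sum_comm]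
  have hsymm : ∀ a e, (g x)⁻¹ a e = (g x)⁻¹ e a := by
    have : ((g x)⁻¹).transpose = (g x)⁻¹ := by
      rw [h.inv_eq]
      simp [Matrix.transpose_mul, Matrix.mul_assoc]
    intro a e
    exact congrFun (congrFun this e) a
  -- With `b` and `d` frozen the Riemann tensor is a rank two tensor, to which the trace formula
  -- applies.
  have hp : IsPull E (uncurry₂ fun e a => riemann g x e b a d)
      (uncurry₂ fun A C => ∑ B, ∑ D, (E B b * E D d) * R A B C D) := by
    rw [isPull_uncurry₂_iff]
    intro e a
    rw [isPull_uncurry₄_iff.mp h.riemann_eq]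
    refine Finset.sum_congr rfl fun A _ => ?_
    rw [Finset.sum_comm]
    refine Finset.sum_congr rfl fun C _ => ?_
    simp only [smul_eq_mul, Finset.mul_sum]
    exact Finset.sum_congr rfl fun _ _ => Finset.sum_congr rfl fun _ _ => by ring
  have h2 : ∑ e, ∑ a, (g x)⁻¹ a e * riemann g x e b a d = _ := Eq.trans
    (Finset.sum_congr rfl fun e _ => Finset.sum_congr rfl fun a _ => by rw [hsymm a e])
    (h.sum_inv_mul hp)
  rw [h2]
  simp only [frameRicci, Finset.mul_sum, smul_eq_mul]
  rw [Finset.sum_comm]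
  refine Finset.sum_congr rfl fun B _ => ?_
  rw [Finset.sum_comm]
  exact Finset.sum_congr rfl fun _ _ => Finset.sum_congr rfl fun _ _ => by ring

lemma scalarCurv_eq (h : HasFrame g x E F R) : scalarCurv g x = frameScalar R :=
  h.sum_inv_mul h.ricci_isPull

lemma tfRicci_isPull (h : HasFrame g x E F R) :
    IsPull E (uncurry₂ (tfRicci g x)) (uncurry₂ (frameTfRicci R)) := by
  have := h.ricci_isPull.sub (h.metric_isPull.const_mul (scalarCurv g x / 4))
  have hf : uncurry₂ (frameTfRicci R) = uncurry₂ fun A B =>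
      frameRicci R A B - scalarCurv g x / 4 * minkowski A B := by
    rw [h.scalarCurv_eq]
    rfl
  rw [hf]
  exact this

lemma weyl_isPull (h : HasFrame g x E F R) :
    IsPull E (uncurry₄ (weyl g x)) (uncurry₄ (frameWeyl R)) := by
  -- The four equivalences place the indices of a product of two rank two tensors in the patterns
  -- `ac·bd`, `ad·bc`, `bc·ad` and `bd·ac` of the Weyl tensor.
  let e₁ : Fin 2 × Fin 2 ≃ Fin 4 :=
    Equiv.ofBijective (fun p => ![![0, 2], ![1, 3]] p.1 p.2) (by decide)
  let e₂ : Fin 2 × Fin 2 ≃ Fin 4 :=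
    Equiv.ofBijective (fun p => ![![0, 3], ![1, 2]] p.1 p.2) (by decide)
  let e₃ : Fin 2 × Fin 2 ≃ Fin 4 :=
    Equiv.ofBijective (fun p => ![![1, 2], ![0, 3]] p.1 p.2) (by decide)
  let e₄ : Fin 2 × Fin 2 ≃ Fin 4 :=
    Equiv.ofBijective (fun p => ![![1, 3], ![0, 2]] p.1 p.2) (by decide)
  have hg := h.metric_isPull
  have hr := h.ricci_isPull
  have := (h.riemann_eq.sub (((((hg.mul hr e₁).sub (hg.mul hr e₂)).sub (hg.mul hr e₃)).add
    (hg.mul hr e₄)).const_mul (1 / 2))).add (((hg.mul hg e₁).sub (hg.mul hg e₂)).const_mul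
      (scalarCurv g x / 6))
  have hf : uncurry₄ (frameWeyl R) = uncurry₄ fun A B C D => R A B C D
    - (1 / 2) * (minkowski A C * frameRicci R B D - minkowski A D * frameRicci R B C
      - minkowski B C * frameRicci R A D + minkowski B D * frameRicci R A C)
    + scalarCurv g x / 6 * (minkowski A C * minkowski B D - minkowski A D * minkowski B C) := by
    rw [h.scalarCurv_eq]
    rfl
  rw [hf]
  exact this

lemma tfRicciUp_isPull (h : HasFrame g x E F R) :
    IsPull F.transpose (uncurry₂ (tfRicciUp g x))
      (uncurry₂ fun A B => mink A * mink B * frameTfRicci R A B) := by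
  have := h.tfRicci_isPull.raise h.mul_dual h.inv_eq
  intro j
  refine Eq.trans ?_ ((this j).trans ?_)
  · simp [uncurry₂, tfRicciUp, sum_multiIndex_two, tensorPow, Fin.prod_univ_two]
  · simp [uncurry₂, Fin.prod_univ_two]

lemma invI6_eq (h : HasFrame g x E F R) : invI6 g x =
    (1 / 12) * ∑ A, ∑ B, frameTfRicci R A B * (mink A * mink B * frameTfRicci R A B) := by
  have := h.tfRicci_isPull.sum_mul h.mul_dual h.tfRicciUp_isPull
  simp only [sum_multiIndex_two, uncurry₂, Matrix.cons_val_zero, Matrix.cons_val_one] at this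
  rw [invI6, this]

end HasFrame

lemma sum_comm_pairs {ι V : Type*} [Fintype ι] [AddCommMonoid V] (f : ι → ι → ι → ι → V) :
    ∑ A, ∑ B, ∑ M, ∑ N, f A B M N = ∑ M, ∑ N, ∑ A, ∑ B, f A B M N := by
  calc _ = ∑ p : ι × ι, ∑ q : ι × ι, f p.1 p.2 q.1 q.2 := by simp only [Fintype.sum_prod_type]
    _ = ∑ q : ι × ι, ∑ p : ι × ι, f p.1 p.2 q.1 q.2 := Finset.sum_comm
    _ = _ := by simp only [Fintype.sum_prod_type]

/-- The symbol at `J` is the determinant of the standard basis rows `e_{J i}`. Expanding the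
determinant of selected columns of `E` multilinearly in that basis gives the left side;
multiplicativity of the determinant gives the right. -/
lemma sum_tensorPow_mul_altSymbol (E : Matrix (Fin 4) (Fin 4) ℝ) (j : Fin 4 → Fin 4) :
    ∑ J, tensorPow E J j * uncurry₄ altSymbol J = E.det * uncurry₄ altSymbol j := by
  have halt : ∀ J : Fin 4 → Fin 4, uncurry₄ altSymbol J =
      Matrix.detRowAlternating fun i => (Pi.single (J i) (1 : ℝ) : Fin 4 → ℝ) := by
    intro J
    rw [uncurry₄, altSymbol]
    have h0 : ![J 0, J 1, J 2, J 3] = J := by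
      funext i
      fin_cases i <;> rfl
    rw [h0]
    change Matrix.det _ = Matrix.det _
    congr 1
    ext i k
    simp [Pi.single_apply, eq_comm]
  have h1 : Matrix.detRowAlternating (fun i k => E k (j i)) = E.det * uncurry₄ altSymbol j := by
    rw [halt, mul_comm, ← Matrix.det_transpose E]
    refine Eq.trans ?_ (Matrix.det_mul
      (Matrix.of fun i => (Pi.single (j i) (1 : ℝ) : Fin 4 → ℝ)) E.transpose)
    change Matrix.det _ = Matrix.det _
    congr 1
    ext i k
    simp [Matrix.mul_apply, Pi.single_apply]
  rw [← h1]
  have h2 : (fun i k => E k (j i)) =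
      fun i => ∑ K, E K (j i) • (Pi.single K (1 : ℝ) : Fin 4 → ℝ) := by
    funext i k
    simp [Finset.sum_apply, Pi.single_apply]
  rw [h2]
  have h3 := (Matrix.detRowAlternating (n := Fin 4) (R := ℝ)).toMultilinearMap.map_sum
    (fun i K => E K (j i) • (Pi.single K (1 : ℝ) : Fin 4 → ℝ))
  refine Eq.trans ?_ h3.symm
  refine Finset.sum_congr rfl fun J _ => ?_
  rw [halt, tensorPow]
  exact ((Matrix.detRowAlternating (n := Fin 4) (R := ℝ)).toMultilinearMap.map_smul_univ
    (fun i => E (J i) (j i)) _).symm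

namespace HasFrame

variable {g : MetricField} {x : Coord} {E F : Matrix (Fin 4) (Fin 4) ℝ} {R : Tensor₄}

/-- As the Minkowski determinant is `-1`, `√|det g| = |det E| = sign(det E) · det E`. The factor
`det E` is absorbed by pulling back the symbol, and the orientation sign remains. -/
lemma volForm_isPull (h : HasFrame g x E F R) : IsPull E (uncurry₄ (volForm g x))
    (uncurry₄ fun A B C D => (SignType.sign E.det : ℝ) * altSymbol A B C D) := by
  intro j
  have h3 : minkowski.det = -1 := by
    simp [minkowski, Matrix.det_diagonal, Fin.prod_univ_four]
  have hd : √|(g x).det| = |E.det| := by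
    rw [h.metric_eq, Matrix.det_mul, Matrix.det_mul, Matrix.det_transpose, h3, mul_neg_one, neg_mul,
      abs_neg, ← sq, abs_of_nonneg (sq_nonneg _), Real.sqrt_sq_eq_abs]
  calc uncurry₄ (volForm g x) j = |E.det| * uncurry₄ altSymbol j := by
        rw [← hd]
        rfl
    _ = (SignType.sign E.det : ℝ) * (E.det * uncurry₄ altSymbol j) := by
        rw [← mul_assoc, sign_mul_self]
    _ = (SignType.sign E.det : ℝ) * ∑ J, tensorPow E J j * uncurry₄ altSymbol J := by
        rw [sum_tensorPow_mul_altSymbol]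
    _ = _ := by
        rw [Finset.mul_sum]
        exact Finset.sum_congr rfl fun J _ => by
          rw [smul_eq_mul, uncurry₄, uncurry₄]
          ring

lemma weylDual_isPull (h : HasFrame g x E F R) : IsPull E (uncurry₄ (weylDual g x))
    (uncurry₄ (frameWeylDual (SignType.sign E.det) R)) := by
  rw [isPull_uncurry₄_iff]
  intro a b c d
  set o : ℝ := (SignType.sign E.det : ℝ)
  -- Freezing `a, b` in the volume form and `c, d` in the Weyl tensor makes the dual a contraction
  -- of two rank two tensors.
  have hv : IsPull E (uncurry₂ fun m n => volForm g x a b m n)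
      (uncurry₂ fun M N => ∑ A, ∑ B, (E A a * E B b) * (o * altSymbol A B M N)) := by
    rw [isPull_uncurry₂_iff]
    intro m n
    rw [isPull_uncurry₄_iff.mp h.volForm_isPull]
    simp only [smul_eq_mul, Finset.mul_sum]
    rw [sum_comm_pairs]
    exact Finset.sum_congr rfl fun _ _ => Finset.sum_congr rfl fun _ _ =>
      Finset.sum_congr rfl fun _ _ => Finset.sum_congr rfl fun _ _ => by ring
  have hw : IsPull E (uncurry₂ fun m n => weyl g x m n c d)
      (uncurry₂ fun M N => ∑ C, ∑ D, (E C c * E D d) * frameWeyl R M N C D) := by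
    rw [isPull_uncurry₂_iff]
    intro m n
    rw [isPull_uncurry₄_iff.mp h.weyl_isPull]
    simp only [smul_eq_mul, Finset.mul_sum]
    exact Finset.sum_congr rfl fun _ _ => Finset.sum_congr rfl fun _ _ =>
      Finset.sum_congr rfl fun _ _ => Finset.sum_congr rfl fun _ _ => by ring
  have := hv.sum_mul h.mul_dual (hw.raise h.mul_dual h.inv_eq)
  simp only [sum_multiIndex_two, uncurry₂, tensorPow, Fin.prod_univ_two, Matrix.cons_val_zero,
    Matrix.cons_val_one, smul_eq_mul] at this
  have hL : weylDual g x a b c d = (1 / 2) * ∑ m, ∑ n, volForm g x a b m n *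
      ∑ m', ∑ n', (g x)⁻¹ m m' * (g x)⁻¹ n n' * weyl g x m' n' c d := by
    simp only [weylDual, Finset.mul_sum, mul_assoc]
  rw [hL, this]
  have hR : ∀ M N, (∑ A, ∑ B, (E A a * E B b) * (o * altSymbol A B M N)) *
      (mink M * mink N * ∑ C, ∑ D, (E C c * E D d) * frameWeyl R M N C D) =
      ∑ A, ∑ B, ∑ C, ∑ D, (E A a * E B b * E C c * E D d) *
        (o * altSymbol A B M N * (mink M * mink N * frameWeyl R M N C D)) := by
    intro M N
    rw [Finset.sum_mul]
    refine Finset.sum_congr rfl fun _ _ => ?_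
    rw [Finset.sum_mul]
    refine Finset.sum_congr rfl fun _ _ => ?_
    simp only [Finset.mul_sum]
    exact Finset.sum_congr rfl fun _ _ => Finset.sum_congr rfl fun _ _ => by ring
  simp only [hR]
  rw [sum_comm_pairs]
  simp only [Finset.mul_sum]
  refine Finset.sum_congr rfl fun A _ => Finset.sum_congr rfl fun B _ => ?_
  rw [sum_comm_pairs]
  refine Finset.sum_congr rfl fun C _ => Finset.sum_congr rfl fun D _ => ?_
  simp only [frameWeylDual, smul_eq_mul, Finset.mul_sum]
  exact Finset.sum_congr rfl fun _ _ => Finset.sum_congr rfl fun _ _ => by ring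

lemma weylBar_isPull (h : HasFrame g x E F R) : IsPull E (uncurry₄ (weylBar g x))
    (uncurry₄ (frameWeylBar (SignType.sign E.det) R)) := by
  have h1 := h.weyl_isPull.map (Complex.ofRealCLM : ℝ →ₗ[ℝ] ℂ)
  have h2 := (h.weylDual_isPull.map (Complex.ofRealCLM : ℝ →ₗ[ℝ] ℂ)).const_mul Complex.I
  have h3 := (h1.add h2).const_mul (1 / 2 : ℂ)
  intro j
  refine Eq.trans ?_ ((h3 j).trans ?_)
  · simp only [uncurry₄, weylBar, ContinuousLinearMap.coe_coe, Complex.ofRealCLM_apply]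
    ring
  · refine Finset.sum_congr rfl fun J _ => ?_
    congr 1
    simp only [uncurry₄, frameWeylBar, ContinuousLinearMap.coe_coe, Complex.ofRealCLM_apply]
    ring

lemma invI_eq (h : HasFrame g x E F R) : invI g x = (1 / 24) * ∑ A, ∑ B, ∑ C, ∑ D,
    frameWeylBar (SignType.sign E.det) R A B C D *
      ((mink A * mink B * mink C * mink D : ℝ) * frameWeylBar (SignType.sign E.det) R A B C D) := by
  have := h.weylBar_isPull.sum_mul h.mul_dual (h.weylBar_isPull.raise h.mul_dual h.inv_eq)
  simp only [sum_multiIndex_four, uncurry₄, tensorPow, Fin.prod_univ_four, Matrix.cons_val,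
    Complex.real_smul] at this
  rw [invI, this]

lemma invK_eq (h : HasFrame g x E F R) : invK g x = (1 / 4) * ∑ A, ∑ B, ∑ C, ∑ D,
    frameWeylBar (SignType.sign E.det) R A C D B *
      ((mink C * mink D * frameTfRicci R C D * (mink A * mink B * frameTfRicci R A B) : ℝ) : ℂ) := by
  -- In the slot order `a c d b` of the Weyl factor, the first `S` occupies the middle slots and the
  -- second the outer ones.
  let e : Fin 2 × Fin 2 ≃ Fin 4 :=
    Equiv.ofBijective (fun p => ![![1, 2], ![0, 3]] p.1 p.2) (by decide)
  have hS := h.tfRicciUp_isPull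
  have := h.weylBar_isPull.sum_mul h.mul_dual
    ((hS.mul hS e).map (Complex.ofRealCLM : ℝ →ₗ[ℝ] ℂ))
  simp only [sum_multiIndex_four, uncurry₄, e, Equiv.ofBijective_apply, Matrix.cons_val] at this
  have hc : ∀ f : Fin 4 → Fin 4 → Fin 4 → Fin 4 → ℂ,
      ∑ a, ∑ b, ∑ c, ∑ d, f a b c d = ∑ a, ∑ c, ∑ d, ∑ b, f a b c d := by
    intro f
    refine Finset.sum_congr rfl fun a _ => ?_
    rw [Finset.sum_comm]
    exact Finset.sum_congr rfl fun c _ => Finset.sum_comm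
  rw [invK, hc, hc (fun A B C D => frameWeylBar _ R A C D B * _)]
  congr 1

end HasFrame

/-- The complete contraction that a scheme describes, in an orthonormal frame of orientation `o`. -/
def ContractionScheme.frameEval (s : ContractionScheme) (o : ℝ) (R : Tensor₄) : ℝ :=
  ∑ i : Fin s.n × Fin 4 → Fin 4,
    (∏ k, (if s.isRiemann k then R else fun A B C D => o * altSymbol A B C D)
      (i (k, 0)) (i (k, 1)) (i (k, 2)) (i (k, 3)))
    * ∏ p, minkowski (i (s.pairing (p, 0))) (i (s.pairing (p, 1)))

/-- Reduces the value of any contraction at a point to a polynomial in the frame components of the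
curvature and the orientation sign. -/
lemma HasFrame.eval_eq {g : MetricField} {x : Coord} {E F : Matrix (Fin 4) (Fin 4) ℝ}
    {R : Tensor₄} (h : HasFrame g x E F R) (s : ContractionScheme) :
    s.eval g x = s.frameEval (SignType.sign E.det) R := by
  have h1 := IsPull.prod (E := E)
    (X := fun k => uncurry₄ (if s.isRiemann k then riemann g x else volForm g x))
    (Xf := fun k => uncurry₄ (if s.isRiemann k then R else
      fun A B C D => (SignType.sign E.det : ℝ) * altSymbol A B C D))
    (fun k => by
      by_cases hk : s.isRiemann k
      · rw [if_pos hk, if_pos hk]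
        exact h.riemann_eq
      · rw [if_neg hk, if_neg hk]
        exact h.volForm_isPull) (Equiv.refl (Fin s.n × Fin 4))
  have hG : IsPull F.transpose (uncurry₂ fun a b => (g x)⁻¹ a b)
      (uncurry₂ fun A B => minkowski A B) := h.inv_isPull
  have h2 := IsPull.prod (fun _ => hG) s.pairing
  exact h1.sum_mul h.mul_dual h2

/-! ### Approaching the ring -/

lemma hasFrame_kerr {a : ℝ} (ha : a ≠ 0) {M : ℝ → ℝ} {x : Coord} (h : x ∈ frameDomain a M) :
    HasFrame (metric a M) x (kerrCoframe a M x) (kerrFrame a M x) (kerrCurv a M x) where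
  metric_eq := metric_eq_kerrCoframe h
  mul_dual := kerrCoframe_mul_kerrFrame h
  riemann_eq := isPull_uncurry₄_iff.mpr (riemann_metric ha h)

/-- The filter of the approach to the ring. -/
def ringFilter (a : ℝ) (M : ℝ → ℝ) : Filter Coord :=
  comap (fun x => x 1) (𝓝 0) ⊓ comap (fun x => x 2) (𝓝 (Real.pi / 2)) ⊓ 𝓟 (chartDomain a M)

/-- A bound that holds eventually along `ringFilter` therefore holds near the end of every path,
with the same constant. -/
lemma IsPathToRing.tendsto {a : ℝ} {M : ℝ → ℝ} {γ : ℝ → Coord} (h : IsPathToRing a M γ) :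
    Tendsto γ (𝓝[>] 0) (ringFilter a M) := by
  refine tendsto_inf.mpr ⟨tendsto_inf.mpr ⟨tendsto_comap_iff.mpr h.tendsto_r,
    tendsto_comap_iff.mpr h.tendsto_theta⟩, tendsto_principal.mpr ?_⟩
  filter_upwards [Ioc_mem_nhdsGT (zero_lt_one' ℝ)] with s hs using h.mem_chart s hs

lemma tendsto_radius_ringFilter (a : ℝ) (M : ℝ → ℝ) :
    Tendsto (fun x : Coord => x 1) (ringFilter a M) (𝓝 0) :=
  (tendsto_comap.mono_left inf_le_left).mono_left inf_le_left

/-- `Δ_r(0) = a²`. Hence no horizon comes close to the ring and the orthonormal coframe is real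
there. -/
lemma eventually_delta_pos {a : ℝ} (ha : a ≠ 0) {M : ℝ → ℝ} (hM : ContDiffAt ℝ 3 M 0) :
    ∀ᶠ r in 𝓝 0, 0 < delta a M r := by
  have hc : ContinuousAt (delta a M) 0 :=
    ((continuousAt_id.pow 2).sub ((continuousAt_const.mul hM.continuousAt).mul
      continuousAt_id)).add continuousAt_const
  refine hc.eventually_const_lt ?_
  have : 0 < a ^ 2 := by positivity
  simpa [delta] using this

lemma eventually_mem_frameDomain {a : ℝ} (ha : a ≠ 0) {M : ℝ → ℝ} (hM : ContDiffAt ℝ 3 M 0) :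
    ∀ᶠ x in ringFilter a M, x ∈ frameDomain a M := by
  have hr := tendsto_radius_ringFilter a M
  have hc : ∀ᶠ x in ringFilter a M, x ∈ chartDomain a M :=
    mem_of_superset (mem_inf_of_right (mem_principal_self _)) fun _ h => h
  filter_upwards [hr.eventually (hM.eventually (by simp)), hr.eventually
    (eventually_delta_pos ha hM), hc] with x h1 h2 h3
  refine ⟨h1, h2, h3.1, h3.2.1, lt_of_le_of_ne ?_ (Ne.symm h3.2.2.1)⟩
  unfold sigma
  positivity

/-! ### Vanishing to third order -/

/-- The mean value inequality on the ball of radius `|r|`, where `K |t|ⁿ ≤ K |r|ⁿ`. -/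
lemma abs_le_mul_abs_pow_succ {f : ℝ → ℝ} {K : ℝ} {n : ℕ} (hK : 0 ≤ K) (hf0 : f 0 = 0)
    (hf : ∀ᶠ r in 𝓝 0, DifferentiableAt ℝ f r) (hd : ∀ᶠ r in 𝓝 0, |deriv f r| ≤ K * |r| ^ n) :
    ∀ᶠ r in 𝓝 0, |f r| ≤ K * |r| ^ (n + 1) := by
  obtain ⟨ε, hε, h⟩ := Metric.eventually_nhds_iff.mp (hf.and hd)
  refine Metric.eventually_nhds_iff.mpr ⟨ε, hε, fun r hr => ?_⟩
  have hball : ∀ t ∈ Metric.closedBall (0 : ℝ) |r|, dist t 0 < ε ∧ |t| ≤ |r| := by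
    intro t ht
    rw [mem_closedBall_zero_iff, Real.norm_eq_abs] at ht
    rw [dist_zero_right, Real.norm_eq_abs] at hr ⊢
    exact ⟨ht.trans_lt hr, ht⟩
  have := (convex_closedBall (0 : ℝ) |r|).norm_image_sub_le_of_norm_deriv_le (f := f)
    (C := K * |r| ^ n) (fun t ht => (h (hball t ht).1).1) (fun t ht => by
      refine (h (hball t ht).1).2.trans ?_
      have := (hball t ht).2
      gcongr) (x := 0) (y := r) (by simp) (by simp)
  simp only [hf0, sub_zero, Real.norm_eq_abs] at this
  rwa [pow_succ, ← mul_assoc]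

/-- Differentiability of `M''` at `0` gives `M'' = O(r)`; two applications of the mean value
inequality give the rest, with the same constant. -/
lemma bounds_of_jet_eq_zero {M : ℝ → ℝ} (hM : ContDiffAt ℝ 3 M 0) (h0 : M 0 = 0)
    (h1 : deriv M 0 = 0) (h2 : deriv (deriv M) 0 = 0) :
    ∃ K : ℝ, 0 ≤ K ∧ ∀ᶠ r in 𝓝 0, |M r| ≤ K * |r| ^ 3 ∧ |deriv M r| ≤ K * |r| ^ 2 ∧
      |deriv (deriv M) r| ≤ K * |r| := by
  have hM1 : ContDiffAt ℝ 2 (deriv M) 0 := contDiffAt_deriv hM (by norm_num)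
  have hM2 : ContDiffAt ℝ 1 (deriv (deriv M)) 0 := contDiffAt_deriv hM1 (by norm_num)
  obtain ⟨K, hK, hb⟩ := (hM2.differentiableAt (by simp)).isBigO_sub.exists_nonneg
  have hb2 : ∀ᶠ r in 𝓝 0, |deriv (deriv M) r| ≤ K * |r| ^ 1 := by
    filter_upwards [hb.bound] with r hr
    simpa [h2] using hr
  have d1 : ∀ᶠ r in 𝓝 0, DifferentiableAt ℝ (deriv M) r :=
    (hM1.eventually (by simp)).mono fun r hr => hr.differentiableAt (by simp)
  have d0 : ∀ᶠ r in 𝓝 0, DifferentiableAt ℝ M r :=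
    (hM.eventually (by simp)).mono fun r hr => hr.differentiableAt (by simp)
  have hb1 := abs_le_mul_abs_pow_succ hK h1 d1 hb2
  have hb0 := abs_le_mul_abs_pow_succ hK h0 d0 hb1
  refine ⟨K, hK, ?_⟩
  filter_upwards [hb0, hb1, hb2] with r g0 g1 g2
  exact ⟨g0, g1, by simpa using g2⟩

lemma abs_div_le_of_abs_le_mul {x y C : ℝ} (hy : 0 < y) (h : |x| ≤ C * y) : |x / y| ≤ C := by
  rwa [abs_div, abs_of_pos hy, div_le_iff₀ hy]

/-- If `M` vanishes to third order at the ring, the curvature is bounded in the frame. -/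
lemma kerrCurv_bounded {a : ℝ} {M : ℝ → ℝ} {K : ℝ} (hK : 0 ≤ K) {x : Coord}
    (hs : 0 < sigma a (x 1) (x 2)) (h0 : |M (x 1)| ≤ K * |x 1| ^ 3)
    (h1 : |deriv M (x 1)| ≤ K * |x 1| ^ 2) (h2 : |deriv (deriv M) (x 1)| ≤ K * |x 1|) :
    ∃ u v w z : ℝ, |u| ≤ 20 * K ∧ |v| ≤ 20 * K ∧ |w| ≤ 20 * K ∧ |z| ≤ 20 * K ∧
      kerrCurv a M x = curvForm u v w z := by
  have hσ : sigma a (x 1) (x 2) = x 1 ^ 2 + (a * Real.cos (x 2)) ^ 2 := by rw [sigma]; ring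
  simp only [kerrCurv]
  generalize a * Real.cos (x 2) = c at *
  generalize sigma a (x 1) (x 2) = q at *
  generalize M (x 1) = m₀ at *
  generalize deriv M (x 1) = m₁ at *
  generalize deriv (deriv M) (x 1) = m₂ at *
  generalize x 1 = r at *
  -- Weight count: `r` and `c` have weight one and `Σ` weight two, so `m = O(r⁴)`, `m' = O(r³)` and
  -- `m'' = O(r²)` make every term of the curvature of weight zero.
  have hr2 : |r| ^ 2 ≤ q := by rw [sq_abs, hσ]; nlinarith [sq_nonneg c]
  have hr4 : |r| ^ 4 ≤ q ^ 2 := by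
    calc |r| ^ 4 = (|r| ^ 2) ^ 2 := by ring
      _ ≤ q ^ 2 := by gcongr
  have hrc : |r| * |c| ≤ q := by
    rw [hσ, ← sq_abs r, ← sq_abs c]; nlinarith [sq_nonneg (|r| - |c|), sq_nonneg |r|, sq_nonneg |c|]
  have hm : |r * m₀| ≤ K * q ^ 2 := by
    calc |r * m₀| = |r| * |m₀| := abs_mul _ _
      _ ≤ |r| * (K * |r| ^ 3) := by gcongr
      _ = K * |r| ^ 4 := by ring
      _ ≤ K * q ^ 2 := by gcongr
  have hm1 : |m₀ + r * m₁| ≤ 2 * K * |r| ^ 3 := by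
    calc |m₀ + r * m₁| ≤ |m₀| + |r| * |m₁| := (abs_add_le _ _).trans_eq (by rw [abs_mul])
      _ ≤ K * |r| ^ 3 + |r| * (K * |r| ^ 2) := by gcongr
      _ = 2 * K * |r| ^ 3 := by ring
  have hm2 : |2 * m₁ + r * m₂| ≤ 3 * K * q := by
    calc |2 * m₁ + r * m₂| ≤ 2 * |m₁| + |r| * |m₂| :=
          (abs_add_le _ _).trans_eq (by rw [abs_mul, abs_mul, abs_two])
      _ ≤ 2 * (K * |r| ^ 2) + |r| * (K * |r|) := by gcongr
      _ = 3 * K * |r| ^ 2 := by ring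
      _ ≤ 3 * K * q := by gcongr
  -- Here `X` stands for the quadratic forms in `r` and `c` that multiply `m / Σ³`.
  have hmX : ∀ X, |X| ≤ 3 * q → |r * m₀ * X / q ^ 3| ≤ 3 * K := by
    intro X hX
    refine abs_div_le_of_abs_le_mul (by positivity) ?_
    calc |r * m₀ * X| = |r * m₀| * |X| := abs_mul _ _
      _ ≤ K * q ^ 2 * (3 * q) := by gcongr
      _ = 3 * K * q ^ 3 := by ring
  have b1 := abs_le.mp (abs_div_le_of_abs_le_mul hs hm2)
  have b2 : |r * (m₀ + r * m₁) / q ^ 2| ≤ 2 * K := by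
    refine abs_div_le_of_abs_le_mul (by positivity) ?_
    calc |r * (m₀ + r * m₁)| = |r| * |m₀ + r * m₁| := abs_mul _ _
      _ ≤ |r| * (2 * K * |r| ^ 3) := by gcongr
      _ = 2 * K * |r| ^ 4 := by ring
      _ ≤ 2 * K * q ^ 2 := by gcongr
  have b3 : |(m₀ + r * m₁) * c / q ^ 2| ≤ 2 * K := by
    refine abs_div_le_of_abs_le_mul (by positivity) ?_
    calc |(m₀ + r * m₁) * c| = |m₀ + r * m₁| * |c| := abs_mul _ _
      _ ≤ 2 * K * |r| ^ 3 * |c| := by gcongr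
      _ = 2 * K * (|r| ^ 2 * (|r| * |c|)) := by ring
      _ ≤ 2 * K * (q * q) := by gcongr
      _ = 2 * K * q ^ 2 := by ring
  have b4 := abs_le.mp (hmX (3 * r ^ 2 - c ^ 2) (by
    rw [hσ, abs_le]; constructor <;> nlinarith [sq_nonneg r, sq_nonneg c]))
  have b5 := abs_le.mp (hmX (r ^ 2 - 3 * c ^ 2) (by
    rw [hσ, abs_le]; constructor <;> nlinarith [sq_nonneg r, sq_nonneg c]))
  have b6 := abs_le.mp (hmX (r ^ 2 - c ^ 2) (by
    rw [hσ, abs_le]; constructor <;> nlinarith [sq_nonneg r, sq_nonneg c]))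
  have b7 := abs_le.mp (hmX (r * c) (by
    rw [abs_mul]; linarith))
  replace b2 := abs_le.mp b2
  replace b3 := abs_le.mp b3
  -- The largest of the four bounds is that of `u`, namely `3K + 4·2K + 2·3K = 17K`, which leaves
  -- some room below `20K`.
  refine ⟨_, _, _, _, ?_, ?_, ?_, ?_, rfl⟩
  · have e : -(2 * m₁ + r * m₂) / q + 4 * r * (m₀ + r * m₁) / q ^ 2
        - 2 * (r * m₀) * (3 * r ^ 2 - c ^ 2) / q ^ 3 =
        -((2 * m₁ + r * m₂) / q) + 4 * (r * (m₀ + r * m₁) / q ^ 2)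
        - 2 * (r * m₀ * (3 * r ^ 2 - c ^ 2) / q ^ 3) := by ring
    rw [e, abs_le]
    constructor <;> linarith
  · have e : 2 * (r * m₀) * (r ^ 2 - 3 * c ^ 2) / q ^ 3 =
        2 * (r * m₀ * (r ^ 2 - 3 * c ^ 2) / q ^ 3) := by ring
    rw [e, abs_le]
    constructor <;> linarith
  · have e : -(r * (m₀ + r * m₁)) / q ^ 2 + 2 * (r * m₀) * (r ^ 2 - c ^ 2) / q ^ 3 =
        -(r * (m₀ + r * m₁) / q ^ 2) + 2 * (r * m₀ * (r ^ 2 - c ^ 2) / q ^ 3) := by ring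
    rw [e, abs_le]
    constructor <;> linarith
  · have e : (m₀ + r * m₁) * c / q ^ 2 - 4 * (r * m₀) * r * c / q ^ 3 =
        (m₀ + r * m₁) * c / q ^ 2 - 4 * (r * m₀ * (r * c) / q ^ 3) := by ring
    rw [e, abs_le]
    constructor <;> linarith

lemma continuous_curvForm : Continuous fun p : ℝ × ℝ × ℝ × ℝ =>
    (curvForm p.1 p.2.1 p.2.2.1 p.2.2.2 : Tensor₄) := by
  refine continuous_pi fun A => continuous_pi fun B => continuous_pi fun C => continuous_pi fun D =>
    ?_
  unfold curvForm
  fun_prop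

/-- If `M` vanishes to third order at the ring, a scalar that depends continuously on the
orientation and on the frame components of the curvature is finite at the ring. -/
theorem finiteAtRing_of_continuous {V : Type*} [NormedAddCommGroup V] {a : ℝ} (ha : a ≠ 0)
    {M : ℝ → ℝ} (hM : ContDiffAt ℝ 3 M 0) (h0 : M 0 = 0) (h1 : deriv M 0 = 0)
    (h2 : deriv (deriv M) 0 = 0) {f : Coord → V} {Φ : ℝ → Tensor₄ → V}
    (hΦ : Continuous fun p : ℝ × Tensor₄ => Φ p.1 p.2)
    (hf : ∀ x ∈ frameDomain a M,
      f x = Φ (SignType.sign (kerrCoframe a M x).det) (kerrCurv a M x)) :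
    FiniteAtRing a M f := by
  obtain ⟨K, hK, hb⟩ := bounds_of_jet_eq_zero hM h0 h1 h2
  set I : Set ℝ := Set.Icc (-(20 * K)) (20 * K)
  have hI : IsCompact I := isCompact_Icc
  -- A compact box that contains the orientation sign and the four curvature scalars.
  have hc : IsCompact (Set.Icc (-1 : ℝ) 1 ×ˢ I ×ˢ I ×ˢ I ×ˢ I) :=
    isCompact_Icc.prod (hI.prod (hI.prod (hI.prod hI)))
  have hΨ : Continuous fun p : ℝ × ℝ × ℝ × ℝ × ℝ =>
      Φ p.1 (curvForm p.2.1 p.2.2.1 p.2.2.2.1 p.2.2.2.2) :=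
    hΦ.comp (continuous_fst.prodMk (continuous_curvForm.comp continuous_snd))
  obtain ⟨B, hB⟩ := hc.exists_bound_of_continuousOn hΨ.continuousOn
  suffices hev : ∀ᶠ x in ringFilter a M, ‖f x‖ ≤ B by
    exact fun γ hγ => ⟨B, hγ.tendsto.eventually hev⟩
  filter_upwards [eventually_mem_frameDomain ha hM,
    (tendsto_radius_ringFilter a M).eventually hb] with x hx hr
  obtain ⟨u, v, w, z, hu, hv, hw, hz, he⟩ :=
    kerrCurv_bounded hK hx.2.2.2.2 hr.1 hr.2.1 hr.2.2
  rw [hf x hx, he]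
  refine hB ((SignType.sign (kerrCoframe a M x).det : ℝ), u, v, w, z)
    ⟨?_, abs_le.mp hu, abs_le.mp hv, abs_le.mp hw, abs_le.mp hz⟩
  cases SignType.sign (kerrCoframe a M x).det <;> norm_num

/-! ### Continuous dependence of the frame expressions on the curvature -/

section Continuity

lemma continuous_frameRicci (B D : Fin 4) : Continuous fun R : Tensor₄ => frameRicci R B D := by
  unfold frameRicci
  fun_prop

lemma continuous_frameScalar : Continuous frameScalar := by
  have := continuous_frameRicci
  unfold frameScalar
  fun_prop

lemma continuous_frameTfRicci (A B : Fin 4) : Continuous fun R : Tensor₄ => frameTfRicci R A B := by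
  have h1 := continuous_frameRicci
  have h2 := continuous_frameScalar
  unfold frameTfRicci
  fun_prop

lemma continuous_frameWeyl (A B C D : Fin 4) :
    Continuous fun R : Tensor₄ => frameWeyl R A B C D := by
  have h1 := continuous_frameRicci
  have h2 := continuous_frameScalar
  unfold frameWeyl
  fun_prop

lemma continuous_frameWeylBar (A B C D : Fin 4) :
    Continuous fun p : ℝ × Tensor₄ => frameWeylBar p.1 p.2 A B C D := by
  have h1 : ∀ A B C D, Continuous fun p : ℝ × Tensor₄ => frameWeyl p.2 A B C D :=
    fun A B C D => (continuous_frameWeyl A B C D).comp continuous_snd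
  unfold frameWeylBar frameWeylDual
  fun_prop

lemma continuous_frameEval (s : ContractionScheme) :
    Continuous fun p : ℝ × Tensor₄ => s.frameEval p.1 p.2 := by
  unfold ContractionScheme.frameEval
  refine continuous_finsetSum _ fun i _ => Continuous.mul ?_ continuous_const
  refine continuous_finsetProd _ fun k _ => ?_
  by_cases hk : s.isRiemann k
  · simp only [hk, if_true]
    fun_prop
  · simp only [if_neg hk]
    fun_prop

end Continuity

/-! ### Finiteness of the invariants when the 2-jet of `M` vanishes -/

section Finite

variable {a : ℝ} {M : ℝ → ℝ}

lemma finiteAtRing_eval (ha : a ≠ 0) (hM : ContDiffAt ℝ 3 M 0) (h0 : M 0 = 0)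
    (h1 : deriv M 0 = 0) (h2 : deriv (deriv M) 0 = 0) (s : ContractionScheme) :
    FiniteAtRing a M (s.eval (metric a M)) :=
  finiteAtRing_of_continuous ha hM h0 h1 h2 (continuous_frameEval s)
    fun _ hx => (hasFrame_kerr ha hx).eval_eq s

lemma finiteAtRing_curvatureInvariants (ha : a ≠ 0) (hM : ContDiffAt ℝ 3 M 0) (h0 : M 0 = 0)
    (h1 : deriv M 0 = 0) (h2 : deriv (deriv M) 0 = 0) (f : Coord → ℝ)
    (hf : f ∈ curvatureInvariants (metric a M)) : FiniteAtRing a M f := by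
  intro γ hγ
  induction hf using Submodule.span_induction with
  | mem f hf =>
    obtain ⟨s, rfl⟩ := hf
    exact finiteAtRing_eval ha hM h0 h1 h2 s γ hγ
  | zero => exact ⟨0, by simp⟩
  | add f g _ _ hf hg =>
    obtain ⟨B, hB⟩ := hf
    obtain ⟨C, hC⟩ := hg
    exact ⟨B + C, (hB.and hC).mono fun s hs => (norm_add_le _ _).trans (add_le_add hs.1 hs.2)⟩
  | smul c f _ hf =>
    obtain ⟨B, hB⟩ := hf
    exact ⟨‖c‖ * B, hB.mono fun s hs => (norm_smul_le c (f (γ s))).trans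
      (mul_le_mul_of_nonneg_left hs (norm_nonneg c))⟩

lemma finiteAtRing_scalarCurv (ha : a ≠ 0) (hM : ContDiffAt ℝ 3 M 0) (h0 : M 0 = 0)
    (h1 : deriv M 0 = 0) (h2 : deriv (deriv M) 0 = 0) :
    FiniteAtRing a M (scalarCurv (metric a M)) :=
  finiteAtRing_of_continuous ha hM h0 h1 h2 (Φ := fun _ R => frameScalar R)
    (continuous_frameScalar.comp continuous_snd) fun _ hx => (hasFrame_kerr ha hx).scalarCurv_eq

lemma finiteAtRing_invI6 (ha : a ≠ 0) (hM : ContDiffAt ℝ 3 M 0) (h0 : M 0 = 0)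
    (h1 : deriv M 0 = 0) (h2 : deriv (deriv M) 0 = 0) :
    FiniteAtRing a M (invI6 (metric a M)) :=
  finiteAtRing_of_continuous ha hM h0 h1 h2
    (Φ := fun _ R => (1 / 12) * ∑ A, ∑ B, frameTfRicci R A B *
      (mink A * mink B * frameTfRicci R A B))
    (by
      have h : ∀ A B, Continuous fun p : ℝ × Tensor₄ => frameTfRicci p.2 A B :=
        fun A B => (continuous_frameTfRicci A B).comp continuous_snd
      fun_prop)
    fun _ hx => (hasFrame_kerr ha hx).invI6_eq

lemma finiteAtRing_invI (ha : a ≠ 0) (hM : ContDiffAt ℝ 3 M 0) (h0 : M 0 = 0)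
    (h1 : deriv M 0 = 0) (h2 : deriv (deriv M) 0 = 0) :
    FiniteAtRing a M (invI (metric a M)) :=
  finiteAtRing_of_continuous ha hM h0 h1 h2
    (Φ := fun o R => (1 / 24) * ∑ A, ∑ B, ∑ C, ∑ D, frameWeylBar o R A B C D *
      ((mink A * mink B * mink C * mink D : ℝ) * frameWeylBar o R A B C D))
    (by
      have h := continuous_frameWeylBar
      fun_prop)
    fun _ hx => (hasFrame_kerr ha hx).invI_eq

lemma finiteAtRing_invK (ha : a ≠ 0) (hM : ContDiffAt ℝ 3 M 0) (h0 : M 0 = 0)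
    (h1 : deriv M 0 = 0) (h2 : deriv (deriv M) 0 = 0) :
    FiniteAtRing a M (invK (metric a M)) :=
  finiteAtRing_of_continuous ha hM h0 h1 h2
    (Φ := fun o R => (1 / 4) * ∑ A, ∑ B, ∑ C, ∑ D, frameWeylBar o R A C D B *
      ((mink C * mink D * frameTfRicci R C D * (mink A * mink B * frameTfRicci R A B) : ℝ) : ℂ))
    (by
      have h := continuous_frameWeylBar
      have h' : ∀ A B, Continuous fun p : ℝ × Tensor₄ => frameTfRicci p.2 A B :=
        fun A B => (continuous_frameTfRicci A B).comp continuous_snd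
      fun_prop)
    fun _ hx => (hasFrame_kerr ha hx).invK_eq

end Finite

/-! ### Lower bounds for invariants of a diagonal curvature -/

/-- A tensor whose only components are those of the form `T_{ABAB}` and `T_{ABBA}`. -/
def IsSectional (T : Tensor₄) : Prop :=
  ∀ A B C D, ¬ ((A = C ∧ B = D) ∨ (A = D ∧ B = C)) → T A B C D = 0

lemma mink_mul_self (A : Fin 4) : mink A * mink A = 1 := by
  fin_cases A <;> simp [mink]

lemma biv_mul_biv (i j A B C D : Fin 4) (h : ¬ ((A = C ∧ B = D) ∨ (A = D ∧ B = C))) :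
    biv i j A B * biv i j C D = 0 := by
  have key : ∀ A B : Fin 4, biv i j A B ≠ 0 → (i = A ∧ j = B) ∨ (i = B ∧ j = A) := by
    intro A B hAB
    by_contra hc
    push Not at hc
    refine hAB ?_
    rw [biv, Matrix.sub_apply, Matrix.single_apply, Matrix.single_apply, if_neg, if_neg, sub_zero]
    · exact fun h => hc.2 h.2 h.1
    · exact fun h => hc.1 h.1 h.2
  by_contra hne
  rcases key A B (left_ne_zero_of_mul hne) with ⟨rfl, rfl⟩ | ⟨rfl, rfl⟩ <;>
    rcases key C D (right_ne_zero_of_mul hne) with ⟨rfl, rfl⟩ | ⟨rfl, rfl⟩ <;> simp at h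

/-- The coefficient `z` multiplies all the mixed products of bivectors; without it only squares of a
single bivector remain. -/
lemma isSectional_curvForm (u v w : ℝ) : IsSectional (curvForm u v w 0) := by
  intro A B C D h
  simp [curvForm, biv_mul_biv _ _ A B C D h]

namespace IsSectional

variable {R : Tensor₄}

lemma frameRicci_eq_zero (h : IsSectional R) {B D : Fin 4} (hBD : B ≠ D) :
    frameRicci R B D = 0 := by
  refine Finset.sum_eq_zero fun A _ => ?_
  rw [h A B A D, mul_zero]
  rintro (⟨-, h⟩ | ⟨h1, h2⟩)
  · exact hBD h
  · exact hBD (h2.trans h1)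

lemma frameTfRicci_eq_zero (h : IsSectional R) {B D : Fin 4} (hBD : B ≠ D) :
    frameTfRicci R B D = 0 := by
  rw [frameTfRicci, h.frameRicci_eq_zero hBD, minkowski, Matrix.diagonal_apply_ne _ hBD]
  ring

/-- The Ricci tensor is diagonal, so every product of it with the metric, and of the metric with
itself, is again sectional. -/
lemma frameWeyl (h : IsSectional R) : IsSectional (frameWeyl R) := by
  intro A B C D hs
  have hd : ∀ A B : Fin 4, A ≠ B → minkowski A B = 0 :=
    fun A B hAB => Matrix.diagonal_apply_ne _ hAB
  have h1 : ∀ {S : Fin 4 → Fin 4 → ℝ}, (∀ A B, A ≠ B → S A B = 0) →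
      minkowski A C * S B D = 0 ∧ minkowski A D * S B C = 0 ∧ minkowski B C * S A D = 0 ∧
        minkowski B D * S A C = 0 := by
    intro S hS
    push Not at hs
    refine ⟨?_, ?_, ?_, ?_⟩
    · by_cases e : A = C
      · rw [hS _ _ (hs.1 e), mul_zero]
      · rw [hd _ _ e, zero_mul]
    · by_cases e : A = D
      · rw [hS _ _ (hs.2 e), mul_zero]
      · rw [hd _ _ e, zero_mul]
    · by_cases e : A = D
      · rw [hd _ _ (hs.2 e), zero_mul]
      · rw [hS _ _ e, mul_zero]
    · by_cases e : A = C
      · rw [hd _ _ (hs.1 e), zero_mul]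
      · rw [hS _ _ e, mul_zero]
  obtain ⟨e1, e2, e3, e4⟩ := h1 (S := frameRicci R) fun _ _ => h.frameRicci_eq_zero
  obtain ⟨e5, e6, -, -⟩ := h1 (S := fun A B => minkowski A B) hd
  rw [KerrLike.frameWeyl, h A B C D hs, e1, e2, e3, e4, e5, e6]
  ring

/-- On the surviving components each index value occurs an even number of times, so its sign squares
away. This gives positivity despite the indefinite metric. -/
lemma mink_mul_sq_nonneg (h : IsSectional R) (A B C D : Fin 4) :
    0 ≤ mink A * mink B * mink C * mink D * (R A B C D) ^ 2 := by
  by_cases hs : (A = C ∧ B = D) ∨ (A = D ∧ B = C)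
  · have : mink A * mink B * mink C * mink D = 1 := by
      rcases hs with ⟨rfl, rfl⟩ | ⟨rfl, rfl⟩
      · linear_combination mink B * mink B * mink_mul_self A + mink_mul_self B
      · linear_combination mink B * mink B * mink_mul_self A + mink_mul_self B
    rw [this, one_mul]
    exact sq_nonneg _
  · rw [h A B C D hs]
    simp

end IsSectional

lemma altSymbol_eq_zero {A B C D : Fin 4} (h : ¬ Function.Injective ![A, B, C, D]) :
    altSymbol A B C D = 0 := by
  rw [Function.Injective] at h
  push Not at h
  obtain ⟨i, j, hij, hne⟩ := h
  refine Matrix.det_zero_of_row_eq hne ?_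
  ext k
  simp only [Matrix.of_apply, hij]

lemma mink_prod_of_injective {A B C D : Fin 4} (h : Function.Injective ![A, B, C, D]) :
    mink A * mink B * mink C * mink D = -1 := by
  have h1 := (Finite.injective_iff_bijective.mp h).prod_comp mink
  simp only [Fin.prod_univ_four, Matrix.cons_val] at h1
  rw [h1]
  simp [mink]

lemma injective_swap {A B C D : Fin 4} (h : Function.Injective ![A, B, D, C]) :
    Function.Injective ![A, B, C, D] := by
  have : ![A, B, C, D] = ![A, B, D, C] ∘ Equiv.swap 2 3 := by
    funext i
    fin_cases i <;> rfl
  rw [this]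
  exact h.comp (Equiv.injective _)

/-- Dualising moves the support to four distinct indices, where the time index occurs exactly once
and the product of signs is `-1`. -/
lemma IsSectional.mink_mul_frameWeylDual_sq_nonpos {R : Tensor₄} (h : IsSectional R) (o : ℝ)
    (A B C D : Fin 4) :
    mink A * mink B * mink C * mink D * (frameWeylDual o R A B C D) ^ 2 ≤ 0 := by
  by_cases hi : Function.Injective ![A, B, C, D]
  · rw [mink_prod_of_injective hi]
    nlinarith [sq_nonneg (frameWeylDual o R A B C D)]
  · have : frameWeylDual o R A B C D = 0 := by
      rw [frameWeylDual, Finset.sum_eq_zero, mul_zero]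
      intro M _
      refine Finset.sum_eq_zero fun N _ => ?_
      by_cases hs : (M = C ∧ N = D) ∨ (M = D ∧ N = C)
      · have h0 : altSymbol A B M N = 0 := by
          rcases hs with ⟨rfl, rfl⟩ | ⟨rfl, rfl⟩
          · exact altSymbol_eq_zero hi
          · exact altSymbol_eq_zero fun hj => hi (injective_swap hj)
        rw [h0]
        ring
      · rw [h.frameWeyl M N C D hs]
        ring
    rw [this]
    simp

lemma le_sum_four {f : Fin 4 → Fin 4 → Fin 4 → Fin 4 → ℝ} (hf : ∀ A B C D, 0 ≤ f A B C D)
    (A B C D : Fin 4) : f A B C D ≤ ∑ A, ∑ B, ∑ C, ∑ D, f A B C D := by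
  have h := Finset.single_le_sum (f := uncurry₄ f) (s := Finset.univ)
    (fun j _ => hf _ _ _ _) (Finset.mem_univ ![A, B, C, D])
  rw [sum_multiIndex_four] at h
  exact h

/-- A lower bound for the modulus of `I` in terms of one component of the Weyl tensor. -/
lemma IsSectional.sq_frameWeyl_le {R : Tensor₄} (h : IsSectional R) (o : ℝ) :
    (KerrLike.frameWeyl R 0 1 0 1) ^ 2 ≤ 96 * ‖(1 / 24 : ℂ) * ∑ A, ∑ B, ∑ C, ∑ D,
      frameWeylBar o R A B C D *
        ((mink A * mink B * mink C * mink D : ℝ) * frameWeylBar o R A B C D)‖ := by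
  -- The real part of the square of `(C + i *C) / 2` is `(C² - (*C)²) / 4`, whence `1/96 = 1/24 ·
  -- 1/4`. By the two sign lemmas each summand is nonnegative, so a single one bounds the sum from
  -- below.
  have hre : ((1 / 24 : ℂ) * ∑ A, ∑ B, ∑ C, ∑ D, frameWeylBar o R A B C D *
      ((mink A * mink B * mink C * mink D : ℝ) * frameWeylBar o R A B C D)).re =
      (1 / 96) * ∑ A, ∑ B, ∑ C, ∑ D, (mink A * mink B * mink C * mink D *
        (KerrLike.frameWeyl R A B C D) ^ 2 - mink A * mink B * mink C * mink D *
          (frameWeylDual o R A B C D) ^ 2) := by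
    have h1 : (1 / 24 : ℂ) = ((1 / 24 : ℝ) : ℂ) := by norm_num
    rw [h1, Complex.re_ofReal_mul]
    simp only [Complex.re_sum, Finset.mul_sum]
    refine Finset.sum_congr rfl fun A _ => Finset.sum_congr rfl fun B _ =>
      Finset.sum_congr rfl fun C _ => Finset.sum_congr rfl fun D _ => ?_
    have h2 : frameWeylBar o R A B C D * ((mink A * mink B * mink C * mink D : ℝ) *
        frameWeylBar o R A B C D) = ((mink A * mink B * mink C * mink D : ℝ) : ℂ) *
        (frameWeylBar o R A B C D * frameWeylBar o R A B C D) := by ring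
    have h3 : frameWeylBar o R A B C D = ((KerrLike.frameWeyl R A B C D / 2 : ℝ) : ℂ)
        + ((frameWeylDual o R A B C D / 2 : ℝ) : ℂ) * Complex.I := by
      rw [frameWeylBar]
      push_cast
      ring
    rw [h2, Complex.re_ofReal_mul, h3, Complex.mul_re]
    simp only [Complex.add_re, Complex.add_im, Complex.ofReal_re, Complex.ofReal_im,
      Complex.re_ofReal_mul, Complex.im_ofReal_mul, Complex.I_re, Complex.I_im]
    ring
  have hle := le_sum_four (f := fun A B C D => mink A * mink B * mink C * mink D *
        (KerrLike.frameWeyl R A B C D) ^ 2 - mink A * mink B * mink C * mink D *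
          (frameWeylDual o R A B C D) ^ 2) (fun A B C D => by
      have h1 := h.frameWeyl.mink_mul_sq_nonneg A B C D
      have h2 := h.mink_mul_frameWeylDual_sq_nonpos o A B C D
      linarith) 0 1 0 1
  have hd := h.mink_mul_frameWeylDual_sq_nonpos o 0 1 0 1
  have hm : mink 0 * mink 1 * mink 0 * mink 1 = 1 := by simp [mink]
  have habs := (le_abs_self _).trans (Complex.abs_re_le_norm ((1 / 24 : ℂ) * ∑ A, ∑ B, ∑ C, ∑ D,
      frameWeylBar o R A B C D *
        ((mink A * mink B * mink C * mink D : ℝ) * frameWeylBar o R A B C D)))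
  rw [hre] at habs
  simp only [hm, one_mul] at hle hd
  linarith

/-- A lower bound for `I₆` in terms of one component of the trace-free Ricci tensor. -/
lemma IsSectional.sq_frameTfRicci_le {R : Tensor₄} (h : IsSectional R) :
    (frameTfRicci R 0 0) ^ 2 ≤ 12 * ((1 / 12) * ∑ A, ∑ B, frameTfRicci R A B *
      (mink A * mink B * frameTfRicci R A B)) := by
  -- The trace-free Ricci tensor is diagonal, so the two signs agree wherever it is nonzero.
  have hnn : ∀ A B, 0 ≤ frameTfRicci R A B * (mink A * mink B * frameTfRicci R A B) := by
    intro A B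
    by_cases e : A = B
    · subst e
      rw [mink_mul_self, one_mul]
      exact mul_self_nonneg _
    · rw [h.frameTfRicci_eq_zero e, zero_mul]
  have h1 := Finset.single_le_sum (f := fun A => ∑ B, frameTfRicci R A B *
    (mink A * mink B * frameTfRicci R A B)) (s := Finset.univ)
    (fun A _ => Finset.sum_nonneg fun B _ => hnn A B) (Finset.mem_univ 0)
  have h2 := Finset.single_le_sum (f := fun B => frameTfRicci R 0 B *
    (mink 0 * mink B * frameTfRicci R 0 B)) (s := Finset.univ)
    (fun B _ => hnn 0 B) (Finset.mem_univ 0)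
  simp only [mink_mul_self, one_mul] at h1 h2
  nlinarith

/-- The Kretschmann scalar `R_{abcd} R^{abcd}`. -/
def kretschmannScheme : ContractionScheme where
  n := 2
  isRiemann _ := true
  -- Slot `p` of one factor is paired with slot `p` of the other; `Fin (2 * 2)` is `Fin 4` by
  -- reduction.
  pairing := Equiv.prodComm (Fin 4) (Fin 2)

/-- The contraction is a sum of nonnegative terms, of which only the one with both index quadruples
equal to `2323` is kept. -/
lemma IsSectional.sq_le_kretschmann {R : Tensor₄} (h : IsSectional R) (o : ℝ) :
    (R 2 3 2 3) ^ 2 ≤ kretschmannScheme.frameEval o R := by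
  have he : kretschmannScheme.frameEval o R = ∑ i : Fin 2 × Fin 4 → Fin 4,
      (∏ k : Fin 2, R (i (k, 0)) (i (k, 1)) (i (k, 2)) (i (k, 3))) *
        ∏ p : Fin 4, minkowski (i (0, p)) (i (1, p)) := rfl
  have hd : ∀ A B : Fin 4, A ≠ B → minkowski A B = 0 :=
    fun A B hAB => Matrix.diagonal_apply_ne _ hAB
  have hdd : ∀ A : Fin 4, minkowski A A = mink A := fun A => Matrix.diagonal_apply_eq _ _
  rw [he]
  have hnn : ∀ i : Fin 2 × Fin 4 → Fin 4,
      0 ≤ (∏ k : Fin 2, R (i (k, 0)) (i (k, 1)) (i (k, 2)) (i (k, 3))) *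
        ∏ p : Fin 4, minkowski (i (0, p)) (i (1, p)) := by
    intro i
    by_cases hi : ∀ p, i (0, p) = i (1, p)
    · simp only [Fin.prod_univ_two, Fin.prod_univ_four, hi, hdd]
      have := h.mink_mul_sq_nonneg (i (1, 0)) (i (1, 1)) (i (1, 2)) (i (1, 3))
      nlinarith
    · push Not at hi
      obtain ⟨p, hp⟩ := hi
      have h0 : ∏ p : Fin 4, minkowski (i (0, p)) (i (1, p)) = 0 :=
        Finset.prod_eq_zero (Finset.mem_univ p) (hd _ _ hp)
      rw [h0, mul_zero]
  have h1 := Finset.single_le_sum (s := Finset.univ) (fun i _ => hnn i)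
    (Finset.mem_univ fun k : Fin 2 × Fin 4 => (![2, 3, 2, 3] : Fin 4 → Fin 4) k.2)
  refine le_trans (le_of_eq ?_) h1
  simp [Fin.prod_univ_four, hdd, mink]

/-! ### The curvature on the equatorial plane -/

lemma frameScalar_curvForm (u v w z : ℝ) :
    frameScalar (curvForm u v w z) = -2 * u - 8 * w + 2 * v := by
  simp [frameScalar, frameRicci, Fin.sum_univ_four, curvForm, biv, mink]
  ring

lemma frameTfRicci_curvForm (u v w z : ℝ) :
    frameTfRicci (curvForm u v w z) 0 0 = (u + v) / 2 := by
  rw [frameTfRicci, frameScalar_curvForm]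
  simp [frameRicci, Fin.sum_univ_four, curvForm, biv, mink, minkowski]
  ring

lemma frameWeyl_curvForm (u v w z : ℝ) :
    frameWeyl (curvForm u v w z) 0 1 0 1 = (u - v - 2 * w) / 3 := by
  rw [frameWeyl, frameScalar_curvForm]
  simp [frameRicci, Fin.sum_univ_four, curvForm, biv, mink, minkowski]
  ring

lemma curvForm_two_three (u v w z : ℝ) : curvForm u v w z 2 3 2 3 = v := by
  simp [curvForm, biv]

/-! ### Divergence on the equatorial plane -/

lemma tendsto_abs_mul_inv_pow {φ : ℝ → ℝ} {L : ℝ} (hL : L ≠ 0)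
    (hφ : Tendsto φ (𝓝[>] 0) (𝓝 L)) {k : ℕ} (hk : k ≠ 0) :
    Tendsto (fun r => |φ r| * (r ^ k)⁻¹) (𝓝[>] 0) atTop := by
  refine (hφ.abs).pos_mul_atTop (abs_pos.mpr hL) ?_
  have h1 : Tendsto (fun r : ℝ => r ^ k) (𝓝[>] 0) (𝓝[>] 0) := by
    refine tendsto_nhdsWithin_iff.mpr ⟨?_, ?_⟩
    · have : Tendsto (fun r : ℝ => r ^ k) (𝓝 0) (𝓝 (0 ^ k)) := (continuous_pow k).tendsto 0
      rw [zero_pow hk] at this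
      exact this.mono_left nhdsWithin_le_nhds
    · filter_upwards [self_mem_nhdsWithin] with r hr using pow_pos (Set.mem_Ioi.mp hr) k
  exact tendsto_inv_nhdsGT_zero.comp h1

/-- If the first nonzero derivative of `M` at `0` has order `j ≤ 2`, then `M / r^j` has a nonzero
limit and the remaining factor `r^{-(3-j)}` blows up. For `j = 2` the limit comes from l'Hôpital's
rule. -/
lemma tendsto_abs_div_cube {M : ℝ → ℝ} (hM : ContDiffAt ℝ 3 M 0)
    (h : ¬ (M 0 = 0 ∧ deriv M 0 = 0 ∧ deriv (deriv M) 0 = 0)) :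
    Tendsto (fun r => |M r / r ^ 3|) (𝓝[>] 0) atTop := by
  have hM1 : ContDiffAt ℝ 2 (deriv M) 0 := contDiffAt_deriv hM (by norm_num)
  have hpos : ∀ᶠ r : ℝ in 𝓝[>] 0, 0 < r := self_mem_nhdsWithin
  have key : ∀ {φ : ℝ → ℝ} {L : ℝ} {k : ℕ}, L ≠ 0 → Tendsto φ (𝓝[>] 0) (𝓝 L) → k ≠ 0 →
      (∀ r, 0 < r → M r / r ^ 3 = φ r * (r ^ k)⁻¹) →
      Tendsto (fun r => |M r / r ^ 3|) (𝓝[>] 0) atTop := by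
    intro φ L k hL hφ hk he
    refine (tendsto_abs_mul_inv_pow hL hφ hk).congr' ?_
    filter_upwards [hpos] with r hr
    rw [he r hr, abs_mul, abs_of_pos (inv_pos.mpr (pow_pos hr k))]
  have hc : Tendsto M (𝓝[>] 0) (𝓝 (M 0)) := hM.continuousAt.tendsto.mono_left nhdsWithin_le_nhds
  by_cases h0 : M 0 = 0
  swap
  · exact key h0 hc three_ne_zero fun r hr => div_eq_mul_inv _ _
  have hslope : ∀ {f : ℝ → ℝ}, DifferentiableAt ℝ f 0 → f 0 = 0 →
      Tendsto (fun r => f r / r) (𝓝[>] 0) (𝓝 (deriv f 0)) := by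
    intro f hf hf0
    have := hf.hasDerivAt.tendsto_slope.mono_left
      (nhdsWithin_mono (0 : ℝ) fun r (hr : 0 < r) => hr.ne')
    refine this.congr fun r => ?_
    rw [slope_def_field, hf0, sub_zero, sub_zero]
  by_cases h1 : deriv M 0 = 0
  swap
  · refine key h1 (hslope (hM.differentiableAt (by simp)) h0) two_ne_zero fun r hr => ?_
    field_simp
  have h2 : deriv (deriv M) 0 ≠ 0 := fun h2 => h ⟨h0, h1, h2⟩
  have hs := hslope (hM1.differentiableAt (by simp)) h1
  have hl : Tendsto (fun r => M r / r ^ 2) (𝓝[>] 0) (𝓝 (deriv (deriv M) 0 / 2)) := by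
    refine HasDerivAt.lhopital_zero_nhdsGT (f' := deriv M) (g' := fun r => 2 * r) ?_ ?_ ?_ ?_ ?_ ?_
    · exact nhdsWithin_le_nhds ((hM.eventually (by simp)).mono fun r hr =>
        (hr.differentiableAt (by simp)).hasDerivAt)
    · exact Eventually.of_forall fun r => by simpa using hasDerivAt_pow 2 r
    · filter_upwards [hpos] with r hr
      positivity
    · rwa [h0] at hc
    · have : Tendsto (fun r : ℝ => r ^ 2) (𝓝 0) (𝓝 (0 ^ 2)) := (continuous_pow 2).tendsto 0
      rw [zero_pow two_ne_zero] at this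
      exact this.mono_left nhdsWithin_le_nhds
    · refine (hs.div_const 2).congr fun r => ?_
      rw [div_div, mul_comm]
  refine key (div_ne_zero h2 two_ne_zero) hl one_ne_zero fun r hr => ?_
  field_simp

/-- The radial path in the equatorial plane. -/
def equatorialPath (ε s : ℝ) : Coord := ![0, ε * s, Real.pi / 2, 0]

lemma equatorialPath_radius (ε s : ℝ) : equatorialPath ε s 1 = ε * s := rfl

lemma equatorialPath_theta (ε s : ℝ) : equatorialPath ε s 2 = Real.pi / 2 := rfl

lemma exists_equatorialPath {a : ℝ} (ha : a ≠ 0) {M : ℝ → ℝ} (hM : ContDiffAt ℝ 3 M 0) :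
    ∃ ε : ℝ, 0 < ε ∧ IsPathToRing a M (equatorialPath ε) ∧
      ∀ s ∈ Set.Ioc (0 : ℝ) 1, equatorialPath ε s ∈ frameDomain a M := by
  obtain ⟨δ, hδ, h⟩ := Metric.eventually_nhds_iff.mp
    ((hM.eventually (by simp)).and (eventually_delta_pos ha hM))
  have hmem : ∀ s ∈ Set.Ioc (0 : ℝ) 1, equatorialPath (δ / 2) s ∈ frameDomain a M := by
    intro s hs
    have hr : 0 < δ / 2 * s := mul_pos (half_pos hδ) hs.1
    have hlt : dist (δ / 2 * s) 0 < δ := by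
      rw [dist_zero_right, Real.norm_eq_abs, abs_of_pos hr]
      nlinarith [hs.2]
    refine ⟨(h hlt).1, (h hlt).2, ?_, ?_, ?_⟩
    · exact Real.pi_div_two_pos
    · exact half_lt_self Real.pi_pos
    · rw [equatorialPath_radius, equatorialPath_theta, sigma]
      positivity
  -- As `s ≤ 1`, the scale `δ / 2` keeps the radius strictly inside the `δ`-neighbourhood.
  refine ⟨δ / 2, half_pos hδ, ⟨?_, ?_, ?_, tendsto_const_nhds⟩, hmem⟩
  · refine Continuous.continuousOn (continuous_pi fun i => ?_)
    fin_cases i <;> simp only [equatorialPath] <;> first | exact continuous_const | skip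
    exact continuous_const.mul continuous_id
  · intro s hs
    obtain ⟨-, h2, h3, h4, h5⟩ := hmem s hs
    exact ⟨h3, h4, h5.ne', h2.ne'⟩
  · have : Tendsto (fun s : ℝ => δ / 2 * s) (𝓝 0) (𝓝 (δ / 2 * 0)) :=
      (continuous_const.mul continuous_id).tendsto 0
    rw [mul_zero] at this
    exact this.mono_left nhdsWithin_le_nhds

/-- At `θ = π/2` the cosine vanishes, so `z = 0` and `Σ = r²`. The coefficient `v` then contains `M`
without derivatives, which makes it the one to test. -/
lemma kerrCurv_equatorialPath (a : ℝ) (M : ℝ → ℝ) {ε s : ℝ} (h : ε * s ≠ 0) :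
    ∃ u w, kerrCurv a M (equatorialPath ε s) =
      curvForm u (2 * (M (ε * s) / (ε * s) ^ 3)) w 0 := by
  have hv : 2 * (ε * s * M (ε * s)) * ((ε * s) ^ 2 - 3 * 0 ^ 2) /
      ((ε * s) ^ 2 + a ^ 2 * 0 ^ 2) ^ 3 = 2 * (M (ε * s) / (ε * s) ^ 3) := by
    generalize ε * s = r at h ⊢
    rw [zero_pow two_ne_zero, mul_zero, mul_zero, add_zero, sub_zero]
    field_simp
  simp only [kerrCurv, equatorialPath_radius, equatorialPath_theta, sigma, Real.cos_pi_div_two,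
    mul_zero, zero_div, sub_zero]
  rw [hv]
  exact ⟨_, _, rfl⟩

section

variable {a : ℝ} {M : ℝ → ℝ}

lemma tendsto_equatorialPath_abs {ε : ℝ} (hε : 0 < ε) (hM : ContDiffAt ℝ 3 M 0)
    (h : ¬ (M 0 = 0 ∧ deriv M 0 = 0 ∧ deriv (deriv M) 0 = 0)) :
    Tendsto (fun s => |2 * (M (ε * s) / (ε * s) ^ 3)|) (𝓝[>] 0) atTop := by
  have h1 : Tendsto (fun s : ℝ => ε * s) (𝓝[>] 0) (𝓝[>] 0) := by
    refine tendsto_nhdsWithin_iff.mpr ⟨?_, ?_⟩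
    · have : Tendsto (fun s : ℝ => ε * s) (𝓝 0) (𝓝 (ε * 0)) :=
        (continuous_const.mul continuous_id).tendsto 0
      rw [mul_zero] at this
      exact this.mono_left nhdsWithin_le_nhds
    · filter_upwards [self_mem_nhdsWithin] with s hs using mul_pos hε (Set.mem_Ioi.mp hs)
  have h2 := ((tendsto_abs_div_cube hM h).comp h1).const_mul_atTop (zero_lt_two' ℝ)
  refine h2.congr fun s => ?_
  rw [abs_mul, abs_two]
  rfl

/-- If the Kretschmann scalar does not diverge, then `M` vanishes to third order at the ring. -/
lemma jet_eq_zero_of_not_diverges (ha : a ≠ 0) (hM : ContDiffAt ℝ 3 M 0)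
    (h : ∀ f ∈ curvatureInvariants (metric a M), ¬ DivergesAtRing a M f) :
    M 0 = 0 ∧ deriv M 0 = 0 ∧ deriv (deriv M) 0 = 0 := by
  by_contra hj
  obtain ⟨ε, hε, hpath, hmem⟩ := exists_equatorialPath ha hM
  refine h (kretschmannScheme.eval (metric a M))
    (Submodule.subset_span ⟨kretschmannScheme, rfl⟩) ⟨equatorialPath ε, hpath, ?_⟩
  -- The comparison is `|v| - 1 ≤ v²`.
  refine tendsto_atTop_mono' _ ?_
    ((tendsto_equatorialPath_abs hε hM hj).atTop_add (tendsto_const_nhds (x := (-1 : ℝ))))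
  filter_upwards [Ioc_mem_nhdsGT (zero_lt_one' ℝ)] with s hs
  obtain ⟨u, w, he⟩ := kerrCurv_equatorialPath a M (mul_pos hε hs.1).ne'
  rw [(hasFrame_kerr ha (hmem s hs)).eval_eq, he]
  have h1 := (isSectional_curvForm u (2 * (M (ε * s) / (ε * s) ^ 3)) w).sq_le_kretschmann
    (SignType.sign (kerrCoframe a M (equatorialPath ε s)).det : ℝ)
  rw [curvForm_two_three, ← sq_abs] at h1
  refine le_trans ?_ (h1.trans (le_abs_self _))
  nlinarith [sq_nonneg (|2 * (M (ε * s) / (ε * s) ^ 3)| - 1 / 2)]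

/-- If `ℛ`, `I₆` and `I` are finite at the ring, then `M` vanishes to third order there. -/
lemma jet_eq_zero_of_finiteAtRing (ha : a ≠ 0) (hM : ContDiffAt ℝ 3 M 0)
    (hR : FiniteAtRing a M (scalarCurv (metric a M))) (h6 : FiniteAtRing a M (invI6 (metric a M)))
    (hI : FiniteAtRing a M (invI (metric a M))) :
    M 0 = 0 ∧ deriv M 0 = 0 ∧ deriv (deriv M) 0 = 0 := by
  by_contra hj
  obtain ⟨ε, hε, hpath, hmem⟩ := exists_equatorialPath ha hM
  obtain ⟨B₁, hB₁⟩ := hR _ hpath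
  obtain ⟨B₂, hB₂⟩ := h6 _ hpath
  obtain ⟨B₃, hB₃⟩ := hI _ hpath
  have hev : ∀ᶠ s in 𝓝[>] (0 : ℝ), |2 * (M (ε * s) / (ε * s) ^ 3)| ≤
      B₁ + (1 + 48 * B₂) + (1 + 864 * B₃) := by
    filter_upwards [Ioc_mem_nhdsGT (zero_lt_one' ℝ), hB₁, hB₂, hB₃] with s hs h1 h2 h3
    obtain ⟨u, w, he⟩ := kerrCurv_equatorialPath a M (mul_pos hε hs.1).ne'
    have hF := hasFrame_kerr ha (hmem s hs)
    rw [he] at hF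
    generalize 2 * (M (ε * s) / (ε * s) ^ 3) = v at *
    have hS := isSectional_curvForm u v w
    rw [hF.scalarCurv_eq, frameScalar_curvForm, Real.norm_eq_abs, abs_le] at h1
    rw [hF.invI6_eq] at h2
    rw [hF.invI_eq] at h3
    have g2 := hS.sq_frameTfRicci_le
    have g3 := hS.sq_frameWeyl_le
      (SignType.sign (kerrCoframe a M (equatorialPath ε s)).det : ℝ)
    rw [frameTfRicci_curvForm] at g2
    rw [frameWeyl_curvForm] at g3
    replace g2 := g2.trans (mul_le_mul_of_nonneg_left ((le_abs_self _).trans h2) (by norm_num))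
    replace g3 := g3.trans (mul_le_mul_of_nonneg_left h3 (by norm_num))
    -- From `|t| ≤ 1 + t²`, where `(u + v)² ≤ 4 · 12 B₂`; in the same way `(u - v - 2w)² ≤ 9 · 96
    -- B₃` gives the constant 864.
    have e2 : |u + v| ≤ 1 + 48 * B₂ := by
      rw [abs_le]
      constructor <;> nlinarith [sq_nonneg (u + v - 1), sq_nonneg (u + v + 1), sq_nonneg (u + v)]
    have e3 : |u - v - 2 * w| ≤ 1 + 864 * B₃ := by
      rw [abs_le]
      constructor <;> nlinarith [sq_nonneg (u - v - 2 * w - 1), sq_nonneg (u - v - 2 * w + 1),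
        sq_nonneg (u - v - 2 * w)]
    -- Here `v = ℛ/12 + (u + v)/2 - (u - v - 2w)/3`, with coefficients at most one in absolute
    -- value.
    rw [abs_le] at e2 e3 ⊢
    constructor <;> linarith
  obtain ⟨s, hs1, hs2⟩ :=
    (((tendsto_equatorialPath_abs hε hM hj).eventually_gt_atTop _).and hev).exists
  exact absurd hs2 (not_le.mpr hs1)

lemma not_divergesAtRing_of_finiteAtRing {V : Type*} [Norm V] {f : Coord → V}
    (h : FiniteAtRing a M f) : ¬ DivergesAtRing a M f := by
  rintro ⟨γ, hγ, ht⟩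
  obtain ⟨B, hB⟩ := h γ hγ
  obtain ⟨s, hs1, hs2⟩ := ((ht.eventually_gt_atTop B).and hB).exists
  exact absurd hs2 (not_le.mpr hs1)

end

end KerrLike

end

/-! ### The equivalence -/

theorem theorem1 (a : ℝ) (ha : a ≠ 0) (M : ℝ → ℝ) (hM : ContDiffAt ℝ 3 M 0) :
    List.TFAE [
      ∀ f ∈ KerrLike.curvatureInvariants (KerrLike.metric a M), KerrLike.FiniteAtRing a M f,
      ∀ f ∈ KerrLike.curvatureInvariants (KerrLike.metric a M), ¬ KerrLike.DivergesAtRing a M f,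
      KerrLike.FiniteAtRing a M (KerrLike.scalarCurv (KerrLike.metric a M)) ∧
        KerrLike.FiniteAtRing a M (KerrLike.invI6 (KerrLike.metric a M)) ∧
        KerrLike.FiniteAtRing a M (KerrLike.invI (KerrLike.metric a M)) ∧
        KerrLike.FiniteAtRing a M (KerrLike.invK (KerrLike.metric a M)),
      M 0 = 0 ∧ deriv M 0 = 0 ∧ iteratedDeriv 2 M 0 = 0] := by
  have hd : iteratedDeriv 2 M 0 = deriv (deriv M) 0 := by
    rw [iteratedDeriv_succ, iteratedDeriv_one]
  rw [hd]
  tfae_have 1 → 2 := fun h f hf => KerrLike.not_divergesAtRing_of_finiteAtRing (h f hf)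
  tfae_have 2 → 4 := KerrLike.jet_eq_zero_of_not_diverges ha hM
  tfae_have 4 → 1 := fun ⟨h0, h1, h2⟩ f hf =>
    KerrLike.finiteAtRing_curvatureInvariants ha hM h0 h1 h2 f hf
  tfae_have 4 → 3 := fun ⟨h0, h1, h2⟩ =>
    ⟨KerrLike.finiteAtRing_scalarCurv ha hM h0 h1 h2, KerrLike.finiteAtRing_invI6 ha hM h0 h1 h2,
      KerrLike.finiteAtRing_invI ha hM h0 h1 h2, KerrLike.finiteAtRing_invK ha hM h0 h1 h2⟩
  tfae_have 3 → 4 := fun ⟨hR, h6, hI, _⟩ => KerrLike.jet_eq_zero_of_finiteAtRing ha hM hR h6 hI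
  tfae_finish
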